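/- **Conventions.** Fix $n\in\mathbb N$, $AP=\{p_1,\dots,p_n\}$ and the alphabet $\Sigma=2^{AP}$. A *nested word* $\bar w=(w,\mu,\mathtt{call},\mathtt{ret})$ is a finite word or an $\omega$-word $w=a_1a_2\dots$ over $\Sigma$ with a binary relation $\mu$ and unary relations $\mathtt{call},\mathtt{ret}$ on its positions such that (1) $\mu(i,j)$ implies $\mathtt{call}(i)$, $\mathtt{ret}(j)$, $i<j$; (2) $\mu(i,j),\mu(i,j')$ imply $j=j'$, and $\mu(i,j),\mu(i',j)$ imply $i=i'$; (3) if $i\le j$, $\mathtt{call}(i)$ and $\mathtt{ret}(j)$, then there is $k$ with $i\le k\le j$ and $\mu(i,k)$ or $\mu(k,j)$. If $\mu(i,j)$, then $i$ is a matched call, $j$ a matched return and $r(i)=j$; other calls and returns are pending. $\mathcal C(i)$ is the greatest matched call $c<i$ with $r(c)>i$, if any. Formulas of $\mathrm{NWTL}^+$ are built from $\top$, $p\in AP$, $\mathtt{call}$, $\mathtt{ret}$ by $\neg,\vee$, the unary operators $\bigcirc,\bigcirc_\mu,\ominus,\ominus_\mu$ (next position; $\mu$-successor; previous position; $\mu$-predecessor;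 each requires that position to exist), and, for each $\kappa\in\{\text{linear},\text{call},\text{abstract},\text{summary}\}$, the binary operators $\mathbf U^\kappa,\mathbf S^\kappa$; $|\varphi|$ is the number of symbols of $\varphi$. A *$\kappa$-path* from $i$ to $j$ is a sequence $i=i_0<\dots<i_k=j$ ($k\ge 0$) such that for all $m<k$: $i_{m+1}=i_m+1$ (linear); $i_m=\mathcal C(i_{m+1})$ (call); either $i_m$ is a matched call and $i_{m+1}=r(i_m)$, or $i_m$ is not a call, $i_m+1$ is not a matched return and $i_{m+1}=i_m+1$ (abstract); $i_{m+1}=r(i_m)$ if $i_m$ is a matched call with $r(i_m)\le j$, and $i_{m+1}=i_m+1$ otherwise (summary). $(\bar w,i)\models\varphi\,\mathbf U^\kappa\psi$ iff for some position $j\ge i$ there is a $\kappa$-path $i_0<\dots<i_k$ from $i$ to $j$ with $(\bar w,j)\models\psi$ and $(\bar w,i_m)\models\varphi$ for $0\le m<k$; $(\bar w,i)\models\varphi\,\mathbf S^\kappa\psi$ iff for some position $j\le i$ there is a $\kappa$-path $i_0<\dots<i_k$ from $j$ to $i$ with $(\bar w,j)\models\psi$ and $(\bar w,i_m)\models\varphi$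 for $0<m\le k$. $\bar w$ is a *model* of $\varphi$ if it has a first position and $(\bar w,1)\models\varphi$. A *nondeterministic Büchi nested word automaton* consists of finite sets $Q$ (states) and $P$ (hierarchical symbols), subsets $Q_0,Q_f\subseteq Q$ and $P_0,P_f\subseteq P$, and relations $\delta_c\subseteq Q\times\Sigma\times Q\times P$, $\delta_i\subseteq Q\times\Sigma\times Q$, $\delta_r\subseteq Q\times P\times\Sigma\times Q$. A run over $\bar w$ consists of states $q_0,q_1,\dots$ and symbols $p_i$ for the calls $i$, with $q_0\in Q_0$ and, for each position $i$: $(q_{i-1},a_i,q_i,p_i)\in\delta_c$ if $i$ is a call; $(q_{i-1},a_i,q_i)\in\delta_i$ if $i$ is neither a call nor a return; $(q_{i-1},p_j,a_i,q_i)\in\delta_r$ if $\mu(j,i)$; $(q_{i-1},p,a_i,q_i)\in\delta_r$ for some $p\in P_0$ if $i$ is a pending return. It is accepting if $p_i\in P_f$ for all pending calls $i$ and, for $\bar w$ of finite length $\ell$, $q_\ell\in Q_f$, respectively, for a nested $\omega$-word, $q_i\in Q_f$ for infinitely many $i$. **Theorem.** There are an absolute constant $C$ and two computable functions that map every $n$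 and every $\mathrm{NWTL}^+$ formula $\varphi$ over $AP=\{p_1,\dots,p_n\}$ to (explicit lists describing) nondeterministic Büchi nested word automata $A_\varphi$ and $A^{\mathrm{fin}}_\varphi$ over $2^{AP}$ such that - each of the two automata has at most $2^{C|\varphi|}$ states and hierarchical symbols together, and its whole description, including all transitions, has at most $2^{C|\varphi|}\cdot|\Sigma|$ entries (hence $2^{O(|\varphi|)}$ if every proposition of $AP$ occurs in $\varphi$); - a nested $\omega$-word is accepted by $A_\varphi$ if and only if it is a model of $\varphi$; - a finite nested word is accepted by $A^{\mathrm{fin}}_\varphi$ if and only if it is a model of $\varphi$. -/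

import Mathlib

/-!
Nested words, the temporal logic with summary, linear, call and abstract until/since,
nondeterministic Büchi nested word automata, and explicit finite descriptions of them.
-/

namespace NW

/-- A nested word over `A`, finite or infinite. Its positions are the `i` with `i < length`
(counted from `0`, so position `i` here is position `i + 1` in the usual counting);
`length = ⊤` is the case of a nested ω-word. Labels outside the positions play no role.
`edge` is the matching relation, `call` and `ret` are the unary relations of call and
return positions. -/
structure NestedWord (A : Type) where
  length : ℕ∞
  label : ℕ → A
  edge : ℕ → ℕ → Prop
  call : ℕ → Prop
  ret : ℕ → Prop
  call_lt : ∀ i, call i → (i : ℕ∞) < length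
  ret_lt : ∀ i, ret i → (i : ℕ∞) < length
  edge_call : ∀ i j, edge i j → call i
  edge_ret : ∀ i j, edge i j → ret j
  edge_lt : ∀ i j, edge i j → i < j
  edge_right_unique : ∀ i j j', edge i j → edge i j' → j = j'
  edge_left_unique : ∀ i i' j, edge i j → edge i' j → i = i'
  nesting : ∀ i j, i ≤ j → call i → ret j → ∃ k, i ≤ k ∧ k ≤ j ∧ (edge i k ∨ edge k j)

namespace NestedWord

variable {A : Type} (w : NestedWord A)

/-- `i` is a position of `w`. -/
def IsPos (i : ℕ) : Prop := (i : ℕ∞) < w.length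

/-- `j` is a return with a matching call. -/
def MatchedRet (j : ℕ) : Prop := ∃ i, w.edge i j

/-- `c` is a matched call before `i` whose matching return is after `i`. -/
def Encloses (c i : ℕ) : Prop := c < i ∧ ∃ r, w.edge c r ∧ i < r

/-- `c` is the innermost call within which `i` is executed. -/
def InnermostCall (c i : ℕ) : Prop := w.Encloses c i ∧ ∀ c', w.Encloses c' i → c' ≤ c

end NestedWord

/-- The four notions of path. -/
inductive PathKind where
  | linear
  | call
  | abstr
  | summary

/-- `b` is the successor of `a` on a path of the given kind that ends in `j`
(only summary paths look at `j`). -/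
def Step {A : Type} (w : NestedWord A) (j : ℕ) : PathKind → ℕ → ℕ → Prop
  | .linear, a, b => b = a + 1
  | .call, a, b => w.InnermostCall a b
  | .abstr, a, b => w.edge a b ∨ (¬ w.call a ∧ ¬ w.MatchedRet (a + 1) ∧ b = a + 1)
  | .summary, a, b =>
      (w.edge a b ∧ b ≤ j) ∨ ((¬ ∃ r, w.edge a r ∧ r ≤ j) ∧ b = a + 1)

/-- `s 0 < s 1 < ... < s k` is a path of kind `κ` from `i` to `j`. -/
def IsPath {A : Type} (w : NestedWord A) (κ : PathKind) (i j k : ℕ) (s : ℕ → ℕ) : Prop :=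
  s 0 = i ∧ s k = j ∧ ∀ p < k, s p < s (p + 1) ∧ Step w j κ (s p) (s (p + 1))

/-- Formulas over the atomic propositions `0, ..., n - 1`. The operators `untl .summary` and
`snce .summary` are those of the base logic; `linear`, `call` and `abstr` give the other
until/since pairs. `anext` and `aprev` are the abstract next and previous, which follow the
matching relation. -/
inductive Formula (n : ℕ) where
  | top : Formula n
  | prop : Fin n → Formula n
  | call : Formula n
  | ret : Formula n
  | neg : Formula n → Formula n
  | or : Formula n → Formula n → Formula n
  | next : Formula n → Formula n
  | anext : Formula n → Formula n
  | prev : Formula n → Formula n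
  | aprev : Formula n → Formula n
  | untl : PathKind → Formula n → Formula n → Formula n
  | snce : PathKind → Formula n → Formula n → Formula n

/-- The alphabet: sets of atomic propositions. -/
abbrev Letter (n : ℕ) : Type := Finset (Fin n)

namespace Formula

/-- Satisfaction of a formula at a position `i` of `w`. -/
def Sat {n : ℕ} (w : NestedWord (Letter n)) : Formula n → ℕ → Prop
  | top, _ => True
  | prop p, i => p ∈ w.label i
  | call, i => w.call i
  | ret, i => w.ret i
  | neg φ, i => ¬ Sat w φ i
  | or φ ψ, i => Sat w φ i ∨ Sat w ψ i
  | next φ, i => w.IsPos (i + 1) ∧ Sat w φ (i + 1)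
  | anext φ, i => ∃ j, w.edge i j ∧ Sat w φ j
  | prev φ, i => ∃ j, j + 1 = i ∧ Sat w φ j
  | aprev φ, i => ∃ j, w.edge j i ∧ Sat w φ j
  | untl κ φ ψ, i => ∃ j k s, w.IsPos j ∧ i ≤ j ∧ IsPath w κ i j k s ∧
      Sat w ψ j ∧ ∀ p < k, Sat w φ (s p)
  | snce κ φ ψ, i => ∃ j k s, j ≤ i ∧ IsPath w κ j i k s ∧
      Sat w ψ j ∧ ∀ p, 0 < p → p ≤ k → Sat w φ (s p)

/-- `w` is a model of `φ`: it has a first position, and `φ` holds there. -/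
def IsModel {n : ℕ} (φ : Formula n) (w : NestedWord (Letter n)) : Prop :=
  w.IsPos 0 ∧ Sat w φ 0

/-- The number of symbols (nodes of the syntax tree) of a formula. -/
def size {n : ℕ} : Formula n → ℕ
  | top => 1
  | prop _ => 1
  | call => 1
  | ret => 1
  | neg φ => φ.size + 1
  | or φ ψ => φ.size + ψ.size + 1
  | next φ => φ.size + 1
  | anext φ => φ.size + 1
  | prev φ => φ.size + 1
  | aprev φ => φ.size + 1
  | untl _ φ ψ => φ.size + ψ.size + 1
  | snce _ φ ψ => φ.size + ψ.size + 1

end Formula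

/-- A number for each kind of path, used in writing formulas as strings. -/
def PathKind.toNat : PathKind → ℕ
  | linear => 0
  | call => 1
  | abstr => 2
  | summary => 3

/-- A formula as a string in prefix notation: this is what an algorithm reads. -/
def Formula.code {n : ℕ} : Formula n → List ℕ
  | top => [0]
  | call => [1]
  | ret => [2]
  | neg φ => 3 :: φ.code
  | or φ ψ => 4 :: (φ.code ++ ψ.code)
  | next φ => 5 :: φ.code
  | anext φ => 6 :: φ.code
  | prev φ => 7 :: φ.code
  | aprev φ => 8 :: φ.code
  | untl κ φ ψ => (9 + κ.toNat) :: (φ.code ++ ψ.code)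
  | snce κ φ ψ => (13 + κ.toNat) :: (φ.code ++ ψ.code)
  | prop p => [17 + p.val]

/-- A nondeterministic Büchi nested word automaton over `A` with states `Q` and hierarchical
symbols `P` (finite types in all uses below). -/
structure BNWA (A Q P : Type) where
  init : Set Q
  final : Set Q
  hinit : Set P
  hfinal : Set P
  callTrans : Set (Q × A × Q × P)
  intTrans : Set (Q × A × Q)
  retTrans : Set (Q × P × A × Q)

namespace BNWA

variable {A Q P : Type}

/-- `q`, `h` is a run over `w`: `q i` is the state before position `i` is read (and `q (i + 1)`
the state after it), `h` assigns hierarchical symbols to the call positions. -/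
def IsRun (M : BNWA A Q P) (w : NestedWord A) (q : ℕ → Q) (h : {i // w.call i} → P) : Prop :=
  q 0 ∈ M.init ∧
  (∀ c : {i // w.call i}, (q c.1, w.label c.1, q (c.1 + 1), h c) ∈ M.callTrans) ∧
  (∀ i, w.IsPos i → ¬ w.call i → ¬ w.ret i → (q i, w.label i, q (i + 1)) ∈ M.intTrans) ∧
  (∀ (c : {i // w.call i}) (i : ℕ), w.edge c.1 i →
    (q i, h c, w.label i, q (i + 1)) ∈ M.retTrans) ∧
  (∀ i, w.ret i → ¬ w.MatchedRet i →
    ∃ p ∈ M.hinit, (q i, p, w.label i, q (i + 1)) ∈ M.retTrans)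

/-- Acceptance: pending calls carry final hierarchical symbols, and the last state is accepting
(finite words), respectively accepting states occur infinitely often (ω-words). -/
def Accepts (M : BNWA A Q P) (w : NestedWord A) : Prop :=
  ∃ (q : ℕ → Q) (h : {i // w.call i} → P), M.IsRun w q h ∧
    (∀ c : {i // w.call i}, (¬ ∃ j, w.edge c.1 j) → h c ∈ M.hfinal) ∧
    (∀ l : ℕ, w.length = l → q l ∈ M.final) ∧
    (w.length = ⊤ → ∃ᶠ i in Filter.atTop, q i ∈ M.final)

end BNWA

/-- An explicit finite description of an automaton: numbers of states and of hierarchical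
symbols, and lists of the distinguished ones and of all transitions. A letter is written as
the list of truth values of the atomic propositions. -/
structure BNWACode where
  numStates : ℕ
  numSymbols : ℕ
  init : List ℕ
  final : List ℕ
  hinit : List ℕ
  hfinal : List ℕ
  callTrans : List (ℕ × List Bool × ℕ × ℕ)
  intTrans : List (ℕ × List Bool × ℕ)
  retTrans : List (ℕ × ℕ × List Bool × ℕ)

/-- The list of truth values that describes a letter. -/
def Letter.code {n : ℕ} (a : Letter n) : List Bool := List.ofFn fun p => decide (p ∈ a)

namespace BNWACode

/-- The automaton over sets of `n` atomic propositions that is described. -/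
def toBNWA (M : BNWACode) (n : ℕ) : BNWA (Letter n) (Fin M.numStates) (Fin M.numSymbols) where
  init := {q | q.val ∈ M.init}
  final := {q | q.val ∈ M.final}
  hinit := {p | p.val ∈ M.hinit}
  hfinal := {p | p.val ∈ M.hfinal}
  callTrans := {t | (t.1.val, Letter.code t.2.1, t.2.2.1.val, t.2.2.2.val) ∈ M.callTrans}
  intTrans := {t | (t.1.val, Letter.code t.2.1, t.2.2.val) ∈ M.intTrans}
  retTrans := {t | (t.1.val, t.2.1.val, Letter.code t.2.2.1, t.2.2.2.val) ∈ M.retTrans}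

/-- The number of states and hierarchical symbols. -/
def stateSize (M : BNWACode) : ℕ := M.numStates + M.numSymbols

/-- The length of the whole description: states, hierarchical symbols, and all listed entries. -/
def totalSize (M : BNWACode) : ℕ :=
  M.numStates + M.numSymbols + M.init.length + M.final.length + M.hinit.length +
    M.hfinal.length + M.callTrans.length + M.intTrans.length + M.retTrans.length

/-- Descriptions as tuples, to make them inputs and outputs of computable functions. -/
def equivTuple : BNWACode ≃ ℕ × ℕ × List ℕ × List ℕ × List ℕ × List ℕ ×
    List (ℕ × List Bool × ℕ × ℕ) × List (ℕ × List Bool × ℕ) ×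
    List (ℕ × ℕ × List Bool × ℕ) where
  toFun M := (M.numStates, M.numSymbols, M.init, M.final, M.hinit, M.hfinal, M.callTrans,
    M.intTrans, M.retTrans)
  invFun t := ⟨t.1, t.2.1, t.2.2.1, t.2.2.2.1, t.2.2.2.2.1, t.2.2.2.2.2.1, t.2.2.2.2.2.2.1,
    t.2.2.2.2.2.2.2.1, t.2.2.2.2.2.2.2.2⟩
  left_inv _ := rfl
  right_inv _ := rfl

instance : Primcodable BNWACode := Primcodable.ofEquiv _ equivTuple

end BNWACode

end NW

/-!
The automaton guesses, at every position of the nested word, the truth values of all subformulas,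
and checks its guesses locally: each operator obeys an expansion law that relates its value at a
position to the values at the next position, at the previous one, or at the other end of the
matching edge. These are the pairs of positions that an automaton sees together, if the hierarchical
symbol of a call is the state reached there. A state is thus one label for each subformula, drawn
from a fixed finite set, which makes `2 ^ O(|φ|)` states and symbols.

Three points need care.

* The call until, call since, summary until and summary since have no such expansion law by
  themselves. They get one when auxiliary predicates are guessed as well: whether a call until holds
  later within the innermost enclosing call, what a call since says at that call, and summary until
  and since restricted to witnesses inside the innermost matched pair. This is what the structures
  `LinearUntlEqs`, …, `SummarySnceEqs` contain; `callUntlEqs_sem` etc. say that the actual truth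
  values obey the laws, and `CallUntlEqs.iff` etc. that nothing else does. For summary paths this
  rests on `IsPath.visits_iff`: the path from `i` to `j` visits the positions in `[i, j]` that are
  inside no matched pair contained in `[i, j]`.

* In an infinite word the laws of a future operator do not determine it: an until could be promised
  forever. A wrong guess for a linear until is wrong at all later positions, so it is excluded by
  requiring that infinitely often the until is false or is fulfilled at once. For the abstract and
  the summary until, `false_of_chain` follows the unfulfilled promise, jumping over matched calls,
  along all later positions that lie inside no matched pair, and the requirement is restricted to
  such positions (a summary until may also be fulfilled inside the call that starts there). What
  concerns the inside of a matched pair only is determined by backward induction from its return.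
  The finitely many requirements are merged into one Büchi condition by `frequently_all_iff`.

* The laws mention facts about positions that are not local: whether a call or return is matched,
  whether a position lies inside a matched pair, whether it is the last one. These are guessed too,
  and verified by local conditions and by the acceptance conditions (`StructRun.correct`). The
  initial and final hierarchical symbols take care of pending returns and pending calls.

`Tree.Run.z_iff` and `Tree.exists_labelling` combine the operators of a formula to soundness and
completeness. For computability, states are numbers whose digits are the labels of the nodes of the
syntax tree. The check at one node is a function on a finite set, so it is primitive recursive no
matter how it is defined, and the formula is read from right to left with a stack (`checkStep`), as
usual for prefix notation.
-/

namespace NW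

/-! ### Combinatorics of nested words -/

namespace NestedWord

variable {A : Type} {w : NestedWord A}

/-- `i` is a call with a matching return. -/
def MatchedCall (w : NestedWord A) (i : ℕ) : Prop := ∃ j, w.edge i j

/-- `i` lies strictly between a matched call and its return. -/
def Inside (w : NestedWord A) (i : ℕ) : Prop := ∃ c, w.Encloses c i

theorem IsPos.mono {i j : ℕ} (h : w.IsPos j) (hij : i ≤ j) : w.IsPos i :=
  lt_of_le_of_lt (by exact_mod_cast hij) h

theorem isPos_of_edge {i j : ℕ} (h : w.edge i j) : w.IsPos j :=
  w.ret_lt j (w.edge_ret i j h)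

theorem not_ret_of_call {i : ℕ} (hc : w.call i) : ¬ w.ret i := by
  intro hr
  obtain ⟨k, h1, h2, h3⟩ := w.nesting i i le_rfl hc hr
  rcases h3 with h3 | h3 <;> have := w.edge_lt _ _ h3 <;> omega

theorem not_call_of_matchedRet {i : ℕ} (hr : w.MatchedRet i) : ¬ w.call i := by
  obtain ⟨c, hc⟩ := hr
  exact fun h => not_ret_of_call h (w.edge_ret _ _ hc)

/-- A call inside a matched pair is matched, with its return inside that pair. -/
theorem exists_edge_of_call_inside {c r i : ℕ} (h : w.edge c r) (hi : w.call i) (h1 : c < i)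
    (h2 : i < r) : ∃ j, w.edge i j ∧ j < r := by
  obtain ⟨k, hk1, hk2, hk | hk⟩ := w.nesting i r h2.le hi (w.edge_ret _ _ h)
  · refine ⟨k, hk, lt_of_le_of_ne hk2 ?_⟩
    rintro rfl
    have := w.edge_left_unique _ _ _ h hk
    omega
  · have := w.edge_left_unique _ _ _ h hk
    omega

/-- A return inside a matched pair is matched, with its call inside that pair. -/
theorem exists_edge_of_ret_inside {c r j : ℕ} (h : w.edge c r) (hj : w.ret j) (h1 : c < j)
    (h2 : j < r) : ∃ i, w.edge i j ∧ c < i := by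
  obtain ⟨k, hk1, hk2, hk | hk⟩ := w.nesting c j h1.le (w.edge_call _ _ h) hj
  · have := w.edge_right_unique _ _ _ h hk
    omega
  · refine ⟨k, hk, lt_of_le_of_ne hk1 ?_⟩
    rintro rfl
    have := w.edge_right_unique _ _ _ h hk
    omega

theorem edge_inside_of_call {c r i j : ℕ} (h : w.edge c r) (h' : w.edge i j) (h1 : c < i)
    (h2 : i < r) : j < r := by
  obtain ⟨k, hk, hk'⟩ := exists_edge_of_call_inside h (w.edge_call _ _ h') h1 h2
  rwa [w.edge_right_unique _ _ _ h' hk]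

theorem edge_inside_of_ret {c r i j : ℕ} (h : w.edge c r) (h' : w.edge i j) (h1 : c < j)
    (h2 : j < r) : c < i := by
  obtain ⟨k, hk, hk'⟩ := exists_edge_of_ret_inside h (w.edge_ret _ _ h') h1 h2
  rwa [w.edge_left_unique _ _ _ h' hk]

theorem encloses_ret {c i c' : ℕ} (h : w.edge c i) : w.Encloses c' i ↔ w.Encloses c' c := by
  have := w.edge_lt _ _ h
  constructor
  · rintro ⟨h1, r, h2, h3⟩
    exact ⟨edge_inside_of_ret h2 h h1 h3, r, h2, by omega⟩
  · rintro ⟨h1, r, h2, h3⟩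
    exact ⟨by omega, r, h2, edge_inside_of_call h2 h h1 h3⟩

theorem encloses_succ {c i : ℕ} (h : ¬ w.MatchedRet (i + 1)) :
    w.Encloses c (i + 1) ↔ w.Encloses c i ∨ (c = i ∧ w.MatchedCall i) := by
  constructor
  · rintro ⟨h1, r, h2, h3⟩
    rcases Nat.lt_or_ge c i with h4 | h4
    · exact Or.inl ⟨h4, r, h2, by omega⟩
    · obtain rfl : c = i := by omega
      exact Or.inr ⟨rfl, r, h2⟩
  · rintro (⟨h1, r, h2, h3⟩ | ⟨rfl, r, h2⟩)
    · refine ⟨by omega, r, h2, lt_of_le_of_ne h3 ?_⟩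
      rintro rfl
      exact h ⟨c, h2⟩
    · refine ⟨by omega, r, h2, lt_of_le_of_ne (w.edge_lt _ _ h2) ?_⟩
      rintro rfl
      exact h ⟨c, h2⟩

theorem not_encloses_zero {c : ℕ} : ¬ w.Encloses c 0 := fun h => by
  have := h.1
  omega

theorem inside_ret {c i : ℕ} (h : w.edge c i) : w.Inside i ↔ w.Inside c :=
  exists_congr fun _ => encloses_ret h

theorem inside_succ {i : ℕ} (h : ¬ w.MatchedRet (i + 1)) :
    w.Inside (i + 1) ↔ w.Inside i ∨ w.MatchedCall i := by
  simp [Inside, encloses_succ h, exists_or]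

theorem innermostCall_ret {c i c' : ℕ} (h : w.edge c i) :
    w.InnermostCall c' i ↔ w.InnermostCall c' c := by
  simp [InnermostCall, encloses_ret h]

theorem innermostCall_succ_of_matchedCall {c i : ℕ} (h : ¬ w.MatchedRet (i + 1))
    (hi : w.MatchedCall i) : w.InnermostCall c (i + 1) ↔ c = i := by
  simp only [InnermostCall, encloses_succ h]
  constructor
  · rintro ⟨⟨h1, -⟩ | ⟨rfl, -⟩, h3⟩
    · have := h3 i (Or.inr ⟨rfl, hi⟩)
      omega
    · rfl
  · rintro rfl
    refine ⟨Or.inr ⟨rfl, hi⟩, ?_⟩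
    rintro c' (h1 | ⟨rfl, -⟩)
    · exact h1.1.le
    · exact le_rfl

theorem innermostCall_succ {c i : ℕ} (h : ¬ w.MatchedRet (i + 1)) (hi : ¬ w.MatchedCall i) :
    w.InnermostCall c (i + 1) ↔ w.InnermostCall c i := by
  simp [InnermostCall, encloses_succ h, hi]

theorem Inside.exists_innermostCall {i : ℕ} (h : w.Inside i) : ∃ c, w.InnermostCall c i := by
  classical
  obtain ⟨c, hc⟩ := h
  have hb : ∀ c', w.Encloses c' i → c' ≤ i := fun c' h' => h'.1.le
  exact ⟨Nat.findGreatest (fun c => w.Encloses c i) i,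
    Nat.findGreatest_spec (P := fun c => w.Encloses c i) (hb c hc) hc,
    fun c' h' => Nat.le_findGreatest (hb c' h') h'⟩

/-- The only matched call that can sit directly before a matched return is its own. -/
theorem edge_of_matchedCall_of_matchedRet_succ {i : ℕ} (hi : w.MatchedCall i)
    (hr : w.MatchedRet (i + 1)) : w.edge i (i + 1) := by
  obtain ⟨r, h⟩ := hi
  obtain ⟨c, h'⟩ := hr
  have h1 := w.edge_lt _ _ h
  have h2 := w.edge_lt _ _ h'
  rcases Nat.lt_or_ge c i with h3 | h3
  · have := edge_inside_of_call h' h h3 (by omega)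
    omega
  · obtain rfl : c = i := by omega
    exact h'

theorem MatchedCall.call {i : ℕ} (h : w.MatchedCall i) : w.call i := w.edge_call _ _ h.choose_spec

/-- Follow the word from `i` on, jumping over matched calls. If `P` is preserved, then every later
position satisfies `P` or lies inside a pair that was jumped over. -/
theorem chain_of_step {P : ℕ → Prop} (hret : ∀ i r, P i → w.edge i r → P r)
    (hsucc : ∀ i, P i → ¬ w.MatchedCall i → P (i + 1)) {i j : ℕ} (hi : P i) (hij : i ≤ j)
    (hj : ¬ w.Inside j) : P j := by
  have key : ∀ j, i ≤ j → P j ∨ ∃ a r, P a ∧ w.edge a r ∧ a < j ∧ j < r := by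
    intro j hj
    induction j, hj using Nat.le_induction with
    | base => exact Or.inl hi
    | succ j hj ih =>
      rcases ih with h | ⟨a, r, h1, h2, h3, h4⟩
      · by_cases hm : w.MatchedCall j
        · obtain ⟨r, hr⟩ := hm
          have := w.edge_lt _ _ hr
          rcases Nat.lt_or_ge (j + 1) r with h5 | h5
          · exact Or.inr ⟨j, r, h, hr, by omega, h5⟩
          · obtain rfl : r = j + 1 := by omega
            exact Or.inl (hret _ _ h hr)
        · exact Or.inl (hsucc _ h hm)
      · rcases Nat.lt_or_ge (j + 1) r with h5 | h5
        · exact Or.inr ⟨a, r, h1, h2, by omega, h5⟩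
        · obtain rfl : r = j + 1 := by omega
          exact Or.inl (hret _ _ h1 h2)
  rcases key j hij with h | ⟨a, r, h1, h2, h3, h4⟩
  · exact h
  · exact absurd ⟨a, h3, r, h2, h4⟩ hj

/-- Arbitrarily late there are numbers that lie inside no matched pair. -/
theorem exists_ge_not_inside (w : NestedWord A) (i : ℕ) : ∃ j, i ≤ j ∧ ¬ w.Inside j := by
  by_cases h : w.Inside i
  · classical
    -- leave the outermost pair around `i`
    have hex := h
    obtain ⟨h1, r, h2, h3⟩ := Nat.find_spec hex
    refine ⟨r, h3.le, ?_⟩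
    rw [inside_ret h2]
    rintro ⟨c, hc1, s, hc2, hc3⟩
    exact Nat.find_min hex hc1 ⟨by omega, s, hc2, h3.trans (edge_inside_of_call hc2 h2 hc1 hc3)⟩
  · exact ⟨i, le_rfl, h⟩

end NestedWord

end NW

namespace NW

open NestedWord

/-! ### Paths, until and since -/

variable {A : Type} {w : NestedWord A}

/-- The meaning of `untl κ` for arbitrary predicates in place of the two subformulas. -/
def SemUntl (w : NestedWord A) (κ : PathKind) (x y : ℕ → Prop) (i : ℕ) : Prop :=
  ∃ j k s, w.IsPos j ∧ i ≤ j ∧ IsPath w κ i j k s ∧ y j ∧ ∀ p < k, x (s p)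

/-- The meaning of `snce κ` for arbitrary predicates in place of the two subformulas. -/
def SemSnce (w : NestedWord A) (κ : PathKind) (x y : ℕ → Prop) (i : ℕ) : Prop :=
  ∃ j k s, j ≤ i ∧ IsPath w κ j i k s ∧ y j ∧ ∀ p, 0 < p → p ≤ k → x (s p)

theorem IsPath.cons {κ : PathKind} {i i' j k : ℕ} {s : ℕ → ℕ} (h : IsPath w κ i' j k s)
    (hi : i < i') (hs : Step w j κ i i') :
    IsPath w κ i j (k + 1) (fun p => Nat.casesOn p i s) := by
  refine ⟨rfl, h.2.1, ?_⟩
  rintro (_ | p) hp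
  · simpa [h.1] using ⟨hi, hs⟩
  · exact h.2.2 p (by omega)

theorem IsPath.tail {κ : PathKind} {i j k : ℕ} {s : ℕ → ℕ} (h : IsPath w κ i j (k + 1) s) :
    IsPath w κ (s 1) j k (fun p => s (p + 1)) :=
  ⟨rfl, h.2.1, fun p hp => h.2.2 (p + 1) (by omega)⟩

theorem IsPath.lt_of_lt {κ : PathKind} {i j k : ℕ} {s : ℕ → ℕ} (h : IsPath w κ i j k s)
    {p q : ℕ} (hpq : p < q) (hq : q ≤ k) : s p < s q := by
  induction q, hpq using Nat.le_induction with
  | base => exact (h.2.2 p (by omega)).1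
  | succ q hpq ih => exact (ih (by omega)).trans (h.2.2 q (by omega)).1

theorem IsPath.le {κ : PathKind} {i j k : ℕ} {s : ℕ → ℕ} (h : IsPath w κ i j k s) : i ≤ j := by
  rcases Nat.eq_zero_or_pos k with rfl | hk
  · exact (h.1.symm.trans h.2.1).le
  · have := h.lt_of_lt hk le_rfl
    rw [h.1, h.2.1] at this
    exact this.le

section StepIndependent

variable {κ : PathKind} {x y : ℕ → Prop}

/-- Unfolding of `untl` for the kinds of path whose steps do not look at the end point. -/
theorem semUntl_iff (hκ : ∀ j j' a b, Step w j κ a b → Step w j' κ a b) (i : ℕ) :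
    SemUntl w κ x y i ↔
      (w.IsPos i ∧ y i) ∨ (x i ∧ ∃ i', i < i' ∧ Step w 0 κ i i' ∧ SemUntl w κ x y i') := by
  constructor
  · rintro ⟨j, k, s, hj, hij, hp, hy, hx⟩
    cases k with
    | zero =>
      obtain rfl : i = j := hp.1.symm.trans hp.2.1
      exact Or.inl ⟨hj, hy⟩
    | succ k =>
      have h0 := hp.2.2 0 (by omega)
      have hx0 := hx 0 (by omega)
      rw [hp.1] at h0 hx0
      exact Or.inr ⟨hx0, s 1, h0.1, hκ _ _ _ _ h0.2, j, k, _, hj, hp.tail.le, hp.tail, hy,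
        fun p hp => hx (p + 1) (by omega)⟩
  · rintro (⟨hi, hy⟩ | ⟨hx, i', hi, hs, j, k, s, hj, hij, hp, hy, hx'⟩)
    · exact ⟨i, 0, fun _ => i, hi, le_rfl, ⟨rfl, rfl, by simp⟩, hy, by simp⟩
    · refine ⟨j, k + 1, _, hj, by omega, hp.cons hi (hκ _ _ _ _ hs), hy, ?_⟩
      rintro (_ | p) hp
      · exact hx
      · exact hx' p (by omega)

/-- Unfolding of `snce` for the kinds of path whose steps do not look at the end point. -/
theorem semSnce_iff (hκ : ∀ j j' a b, Step w j κ a b → Step w j' κ a b) (i : ℕ) :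
    SemSnce w κ x y i ↔
      y i ∨ (x i ∧ ∃ i', i' < i ∧ Step w 0 κ i' i ∧ SemSnce w κ x y i') := by
  constructor
  · rintro ⟨j, k, s, hij, hp, hy, hx⟩
    cases k with
    | zero =>
      obtain rfl : j = i := hp.1.symm.trans hp.2.1
      exact Or.inl hy
    | succ k =>
      have hk := hp.2.2 k (by omega)
      have hxk := hx (k + 1) (by omega) le_rfl
      rw [hp.2.1] at hk hxk
      have hp' : IsPath w κ j (s k) k s :=
        ⟨hp.1, rfl, fun p hpk =>
          ⟨(hp.2.2 p (by omega)).1, hκ _ _ _ _ (hp.2.2 p (by omega)).2⟩⟩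
      exact Or.inr ⟨hxk, s k, hk.1, hκ _ _ _ _ hk.2, j, k, s, hp'.le, hp', hy,
        fun p h0 hp => hx p h0 (by omega)⟩
  · rintro (hy | ⟨hx, i', hi, hs, j, k, s, hij, hp, hy, hx'⟩)
    · exact ⟨i, 0, fun _ => i, le_rfl, ⟨rfl, rfl, by simp⟩, hy, by intros; omega⟩
    · refine ⟨j, k + 1, fun p => if p ≤ k then s p else i, by omega, ⟨?_, ?_, ?_⟩, hy, ?_⟩
      · simpa using hp.1
      · simp
      · intro p hpk
        rcases Nat.lt_or_ge p k with h | h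
        · simp only [h.le, Nat.succ_le_of_lt h, if_true]
          exact ⟨(hp.2.2 p h).1, hκ _ _ _ _ (hp.2.2 p h).2⟩
        · obtain rfl : p = k := by omega
          simp only [le_refl, if_true, hp.2.1]
          rw [if_neg (by omega)]
          exact ⟨hi, hκ _ _ _ _ hs⟩
      · intro p h0 hpk
        dsimp only
        split_ifs with h
        · exact hx' p h0 h
        · exact hx

/-- `untl` is the least solution of its unfolding. -/
theorem SemUntl.induction (hκ : ∀ j j' a b, Step w j κ a b → Step w j' κ a b) {P : ℕ → Prop}
    (hbase : ∀ i, w.IsPos i → y i → P i)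
    (hstep : ∀ i i', x i → w.IsPos i' → Step w 0 κ i i' → P i' → P i) {i : ℕ}
    (h : SemUntl w κ x y i) : P i := by
  obtain ⟨j, k, s, hj, hij, hp, hy, hx⟩ := h
  induction k generalizing i s with
  | zero =>
    obtain rfl : i = j := hp.1.symm.trans hp.2.1
    exact hbase i hj hy
  | succ k ih =>
    have h0 := hp.2.2 0 (by omega)
    have hx0 := hx 0 (by omega)
    rw [hp.1] at h0 hx0
    exact hstep i (s 1) hx0 (hj.mono hp.tail.le) (hκ _ _ _ _ h0.2)
      (ih _ hp.tail.le hp.tail fun p hp => hx (p + 1) (by omega))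

end StepIndependent

/-! ### Summary paths and the positions they visit -/

/-- `a` lies strictly inside a matched pair that is contained in `[i, j]`. -/
def Covered (w : NestedWord A) (i j a : ℕ) : Prop :=
  ∃ c r, w.edge c r ∧ i ≤ c ∧ c < a ∧ a < r ∧ r ≤ j

/-- The positions on the summary path from `i` to `j`. -/
def OnSummary (w : NestedWord A) (i j a : ℕ) : Prop := i ≤ a ∧ a ≤ j ∧ ¬ Covered w i j a

theorem exists_summary_path {i j : ℕ} (h : i ≤ j) : ∃ k s, IsPath w .summary i j k s := by
  induction hn : j - i using Nat.strong_induction_on generalizing i with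
  | _ n ih =>
    rcases h.eq_or_lt with rfl | hlt
    · exact ⟨0, fun _ => i, rfl, rfl, by simp⟩
    · have : ∃ i', i < i' ∧ i' ≤ j ∧ Step w j .summary i i' := by
        by_cases he : ∃ r, w.edge i r ∧ r ≤ j
        · obtain ⟨r, hr, hrj⟩ := he
          exact ⟨r, w.edge_lt _ _ hr, hrj, Or.inl ⟨hr, hrj⟩⟩
        · exact ⟨i + 1, by omega, hlt, Or.inr ⟨he, rfl⟩⟩
      obtain ⟨i', h1, h2, h3⟩ := this
      obtain ⟨k, s, hs⟩ := ih (j - i') (by omega) h2 rfl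
      exact ⟨_, _, hs.cons h1 h3⟩

theorem covered_iff_of_step {i b j a : ℕ} (h : Step w j .summary i b) (hb : b ≤ a) :
    Covered w i j a ↔ Covered w b j a := by
  constructor
  · rintro ⟨c, r, h1, h2, h3, h4, h5⟩
    refine ⟨c, r, h1, ?_, h3, h4, h5⟩
    rcases h with ⟨he, hbj⟩ | ⟨hn, rfl⟩
    · by_contra hcb
      rcases h2.eq_or_lt with rfl | h2
      · have := w.edge_right_unique _ _ _ he h1
        omega
      · have := edge_inside_of_call he h1 h2 (by omega)
        omega
    · rcases h2.eq_or_lt with rfl | h2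
      · exact absurd ⟨r, h1, h5⟩ hn
      · exact h2
  · rintro ⟨c, r, h1, h2, h3, h4, h5⟩
    refine ⟨c, r, h1, ?_, h3, h4, h5⟩
    rcases h with ⟨he, -⟩ | ⟨-, rfl⟩
    · have := w.edge_lt _ _ he
      omega
    · omega

theorem onSummary_step {i b j a : ℕ} (h : Step w j .summary i b) (hib : i < b) (hij : i < j) :
    OnSummary w i j a ↔ a = i ∨ OnSummary w b j a := by
  rcases Nat.lt_trichotomy a i with h1 | rfl | h1
  · exact ⟨fun h => absurd h.1 (by omega),
      fun h => by rcases h with h | h; omega; exact absurd h.1 (by omega)⟩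
  · refine ⟨fun _ => Or.inl rfl, fun _ => ⟨le_rfl, hij.le, ?_⟩⟩
    rintro ⟨c, r, -, h2, h3, -⟩
    omega
  · rcases Nat.lt_or_ge a b with h2 | h2
    · refine ⟨fun h3 => absurd ?_ h3.2.2,
        fun h => by rcases h with h | h; omega; exact absurd h.1 (by omega)⟩
      rcases h with ⟨he, hbj⟩ | ⟨-, rfl⟩
      · exact ⟨i, b, he, le_rfl, h1, h2, hbj⟩
      · omega
    · simp only [OnSummary, covered_iff_of_step h h2]
      constructor
      · rintro ⟨-, h4⟩
        exact Or.inr ⟨h2, h4⟩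
      · rintro (h4 | ⟨-, h4⟩)
        · omega
        · exact ⟨h1.le, h4⟩

/-- The summary path from `i` to `j` visits exactly the positions in `[i, j]` that are not inside
a matched pair contained in `[i, j]`. -/
theorem IsPath.visits_iff {i j k : ℕ} {s : ℕ → ℕ} (h : IsPath w .summary i j k s) (a : ℕ) :
    (∃ p ≤ k, s p = a) ↔ OnSummary w i j a := by
  induction k generalizing i s with
  | zero =>
    obtain rfl : i = j := h.1.symm.trans h.2.1
    constructor
    · rintro ⟨p, hp, rfl⟩
      obtain rfl : p = 0 := by omega
      rw [h.1]
      refine ⟨le_rfl, le_rfl, ?_⟩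
      rintro ⟨c, r, -, h2, h3, -⟩
      omega
    · rintro ⟨h1, h2, -⟩
      exact ⟨0, le_rfl, by rw [h.1]; omega⟩
  | succ k ih =>
    have h0 := h.2.2 0 (by omega)
    have hle := h.tail.le
    rw [h.1] at h0
    rw [onSummary_step h0.2 h0.1 (lt_of_lt_of_le h0.1 hle), ← ih h.tail]
    constructor
    · rintro ⟨_ | p, hp, rfl⟩
      · exact Or.inl h.1
      · exact Or.inr ⟨p, by omega, rfl⟩
    · rintro (rfl | ⟨p, hp, rfl⟩)
      · exact ⟨0, by omega, h.1⟩
      · exact ⟨p + 1, by omega, rfl⟩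

/-- `x` holds along the summary path from `i` to `j` (its end point excepted), and `y` at `j`. -/
def SumUntl (w : NestedWord A) (x y : ℕ → Prop) (i j : ℕ) : Prop :=
  i ≤ j ∧ y j ∧ ∀ a, a ≠ j → OnSummary w i j a → x a

/-- `y` holds at `j`, and `x` along the summary path from `j` to `i` (its start excepted). -/
def SumSnce (w : NestedWord A) (x y : ℕ → Prop) (j i : ℕ) : Prop :=
  j ≤ i ∧ y j ∧ ∀ a, a ≠ j → OnSummary w j i a → x a

theorem semUntl_summary {x y : ℕ → Prop} {i : ℕ} :
    SemUntl w .summary x y i ↔ ∃ j, w.IsPos j ∧ SumUntl w x y i j := by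
  constructor
  · rintro ⟨j, k, s, hj, hij, hp, hy, hx⟩
    refine ⟨j, hj, hij, hy, fun a ha hon => ?_⟩
    obtain ⟨p, hpk, rfl⟩ := (hp.visits_iff a).2 hon
    refine hx p (lt_of_le_of_ne hpk ?_)
    rintro rfl
    exact ha hp.2.1
  · rintro ⟨j, hj, hij, hy, hx⟩
    obtain ⟨k, s, hp⟩ := exists_summary_path (w := w) hij
    refine ⟨j, k, s, hj, hij, hp, hy, fun p hpk => hx _ ?_ ((hp.visits_iff _).1 ⟨p, hpk.le, rfl⟩)⟩
    rw [← hp.2.1]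
    exact (hp.lt_of_lt hpk le_rfl).ne

theorem semSnce_summary {x y : ℕ → Prop} {i : ℕ} :
    SemSnce w .summary x y i ↔ ∃ j, SumSnce w x y j i := by
  constructor
  · rintro ⟨j, k, s, hij, hp, hy, hx⟩
    refine ⟨j, hij, hy, fun a ha hon => ?_⟩
    obtain ⟨p, hpk, rfl⟩ := (hp.visits_iff a).2 hon
    refine hx p (Nat.pos_of_ne_zero ?_) hpk
    rintro rfl
    exact ha hp.1
  · rintro ⟨j, hij, hy, hx⟩
    obtain ⟨k, s, hp⟩ := exists_summary_path (w := w) hij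
    refine ⟨j, k, s, hij, hp, hy,
      fun p h0 hpk => hx _ ?_ ((hp.visits_iff _).1 ⟨p, hpk, rfl⟩)⟩
    rw [← hp.1]
    exact (hp.lt_of_lt h0 hpk).ne'

theorem sumUntl_self {x y : ℕ → Prop} {i : ℕ} : SumUntl w x y i i ↔ y i := by
  refine ⟨fun h => h.2.1, fun h => ⟨le_rfl, h, fun a ha hon => absurd ?_ ha⟩⟩
  have := hon.1
  have := hon.2.1
  omega

theorem sumSnce_self {x y : ℕ → Prop} {i : ℕ} : SumSnce w x y i i ↔ y i := by
  refine ⟨fun h => h.2.1, fun h => ⟨le_rfl, h, fun a ha hon => absurd ?_ ha⟩⟩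
  have := hon.1
  have := hon.2.1
  omega

theorem sumUntl_step {x y : ℕ → Prop} {i b j : ℕ} (h : Step w j .summary i b) (hib : i < b)
    (hbj : b ≤ j) : SumUntl w x y i j ↔ x i ∧ SumUntl w x y b j := by
  simp only [SumUntl, onSummary_step h hib (hib.trans_le hbj)]
  constructor
  · rintro ⟨h1, h2, h3⟩
    exact ⟨h3 i (by omega) (Or.inl rfl), hbj, h2, fun a ha hon => h3 a ha (Or.inr hon)⟩
  · rintro ⟨h1, h2, h3, h4⟩
    refine ⟨by omega, h3, ?_⟩
    rintro a ha (rfl | hon)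
    · exact h1
    · exact h4 a ha hon

/-- Past a matched return `i`, a summary path that starts at or before the call `c` of `i` jumps
from `c` to `i`. -/
theorem onSummary_edge {c i j a : ℕ} (h : w.edge c i) (hj : j ≤ c) :
    OnSummary w j i a ↔ a = i ∨ OnSummary w j c a := by
  have hci := w.edge_lt _ _ h
  constructor
  · rintro ⟨h1, h2, h3⟩
    by_cases hai : a = i
    · exact Or.inl hai
    · have hac : a ≤ c := by
        by_contra hac
        exact h3 ⟨c, i, h, hj, by omega, by omega, le_rfl⟩
      refine Or.inr ⟨h1, hac, ?_⟩
      rintro ⟨c', r, e, l1, l2, l3, l4⟩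
      exact h3 ⟨c', r, e, l1, l2, l3, by omega⟩
  · rintro (rfl | ⟨h1, h2, h3⟩)
    · refine ⟨by omega, le_rfl, ?_⟩
      rintro ⟨c', r, -, -, -, l3, l4⟩
      omega
    · refine ⟨h1, by omega, ?_⟩
      rintro ⟨c', r, e, l1, l2, l3, l4⟩
      refine h3 ⟨c', r, e, l1, l2, l3, ?_⟩
      rcases l4.eq_or_lt with rfl | l4
      · have := w.edge_left_unique _ _ _ h e
        omega
      · by_contra hr
        have := edge_inside_of_ret h e (by omega) l4
        omega

/-- In all other cases the last step of a summary path goes to the next position. -/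
theorem onSummary_succ {i j a : ℕ} (h : ∀ c, w.edge c (i + 1) → c < j) (hj : j ≤ i) :
    OnSummary w j (i + 1) a ↔ a = i + 1 ∨ OnSummary w j i a := by
  constructor
  · rintro ⟨h1, h2, h3⟩
    by_cases hai : a = i + 1
    · exact Or.inl hai
    · refine Or.inr ⟨h1, by omega, ?_⟩
      rintro ⟨c', r, e, l1, l2, l3, l4⟩
      exact h3 ⟨c', r, e, l1, l2, l3, by omega⟩
  · rintro (rfl | ⟨h1, h2, h3⟩)
    · refine ⟨by omega, le_rfl, ?_⟩
      rintro ⟨c', r, -, -, -, l3, l4⟩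
      omega
    · refine ⟨h1, by omega, ?_⟩
      rintro ⟨c', r, e, l1, l2, l3, l4⟩
      refine h3 ⟨c', r, e, l1, l2, l3, ?_⟩
      rcases l4.eq_or_lt with rfl | l4
      · have := h _ e
        omega
      · omega

theorem sumSnce_edge {x y : ℕ → Prop} {c i j : ℕ} (h : w.edge c i) (hj : j ≤ c) :
    SumSnce w x y j i ↔ x i ∧ SumSnce w x y j c := by
  have hci := w.edge_lt _ _ h
  simp only [SumSnce, onSummary_edge h hj]
  constructor
  · rintro ⟨h1, h2, h3⟩
    exact ⟨h3 i (by omega) (Or.inl rfl), hj, h2, fun a ha hon => h3 a ha (Or.inr hon)⟩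
  · rintro ⟨h1, h2, h3, h4⟩
    refine ⟨by omega, h3, ?_⟩
    rintro a ha (rfl | hon)
    · exact h1
    · exact h4 a ha hon

theorem sumSnce_succ {x y : ℕ → Prop} {i j : ℕ} (h : ∀ c, w.edge c (i + 1) → c < j)
    (hj : j ≤ i) : SumSnce w x y j (i + 1) ↔ x (i + 1) ∧ SumSnce w x y j i := by
  simp only [SumSnce, onSummary_succ h hj]
  constructor
  · rintro ⟨h1, h2, h3⟩
    exact ⟨h3 _ (by omega) (Or.inl rfl), hj, h2, fun a ha hon => h3 a ha (Or.inr hon)⟩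
  · rintro ⟨h1, h2, h3, h4⟩
    refine ⟨by omega, h3, ?_⟩
    rintro a ha (rfl | hon)
    · exact h1
    · exact h4 a ha hon

end NW

namespace NW

open NestedWord Filter

variable {A : Type} {w : NestedWord A} {x y z d e : ℕ → Prop}

/-! ### Progress outside matched pairs -/

namespace NestedWord

theorem not_inside_zero : ¬ w.Inside 0 := fun ⟨_, h⟩ => not_encloses_zero h

theorem not_inside_succ {i : ℕ} (h : ¬ w.Inside i) (hm : ¬ w.MatchedCall i) :
    ¬ w.Inside (i + 1) := by
  by_cases hr : w.MatchedRet (i + 1)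
  · obtain ⟨c, hc⟩ := hr
    have h1 := w.edge_lt _ _ hc
    have h2 : c ≠ i := by
      rintro rfl
      exact hm ⟨_, hc⟩
    exact absurd ⟨c, by omega, _, hc, by omega⟩ h
  · rw [inside_succ hr]
    tauto

/-- A property of positions that propagates along the word, jumping over matched calls, reaches all
later positions outside matched pairs. If the property excludes `F`, and `F` recurs outside matched
pairs in infinite words, then it holds nowhere. -/
theorem false_of_chain {P F : ℕ → Prop} (hret : ∀ i r, P i → w.edge i r → P r)
    (hsucc : ∀ i, P i → ¬ w.MatchedCall i → P (i + 1)) (hpos : ∀ i, P i → w.IsPos i)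
    (hF : (∀ i, w.IsPos i) → ∃ᶠ i in atTop, F i) (hins : ∀ i, F i → ¬ w.Inside i)
    (hPF : ∀ i, P i → ¬ F i) (i : ℕ) : ¬ P i := by
  intro hi
  by_cases hw : ∀ i, w.IsPos i
  · obtain ⟨j, hj, hFj⟩ := (frequently_atTop.1 (hF hw)) i
    exact hPF j (chain_of_step hret hsucc hi hj (hins j hFj)) hFj
  · push Not at hw
    obtain ⟨l, hl⟩ := hw
    obtain ⟨j, hj, hj'⟩ := w.exists_ge_not_inside (max i l)
    exact hl ((hpos j (chain_of_step hret hsucc hi (by omega) hj')).mono (by omega))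

end NestedWord

/-! ### Linear paths -/

theorem step_linear (j j' a b : ℕ) (h : Step w j .linear a b) : Step w j' .linear a b := h

/-- Expansion laws of the linear until. -/
structure LinearUntlEqs (w : NestedWord A) (x y z : ℕ → Prop) : Prop where
  succ : ∀ i, w.IsPos (i + 1) → (z i ↔ y i ∨ (x i ∧ z (i + 1)))
  last : ∀ i, w.IsPos i → ¬ w.IsPos (i + 1) → (z i ↔ y i)

theorem SemUntl.isPos {κ : PathKind} {i : ℕ} (h : SemUntl w κ x y i) : w.IsPos i := by
  obtain ⟨j, k, s, hj, hij, -⟩ := h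
  exact hj.mono hij

theorem linearUntlEqs_sem : LinearUntlEqs w x y (SemUntl w .linear x y) where
  succ i hi := by
    rw [semUntl_iff step_linear]
    have := hi.mono (Nat.le_succ i)
    constructor
    · rintro (⟨-, h⟩ | ⟨hx, i', -, rfl, h⟩)
      · exact Or.inl h
      · exact Or.inr ⟨hx, h⟩
    · rintro (h | ⟨hx, h⟩)
      · exact Or.inl ⟨this, h⟩
      · exact Or.inr ⟨hx, i + 1, by omega, rfl, h⟩
  last i hi hl := by
    rw [semUntl_iff step_linear]
    constructor
    · rintro (⟨-, h⟩ | ⟨hx, i', -, rfl, h⟩)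
      · exact h
      · exact absurd h.isPos hl
    · exact fun h => Or.inl ⟨hi, h⟩

theorem linearUntl_frequently :
    ∃ᶠ i in atTop, ¬ SemUntl w .linear x y i ∨ y i := by
  refine frequently_atTop.2 fun N => ?_
  by_cases h : SemUntl w .linear x y N
  · obtain ⟨j, k, s, hj, hij, hp, hy, hx⟩ := h
    exact ⟨j, hij, Or.inr hy⟩
  · exact ⟨N, le_rfl, Or.inl h⟩

theorem LinearUntlEqs.iff (h : LinearUntlEqs w x y z)
    (hF : (∀ i, w.IsPos i) → ∃ᶠ i in atTop, ¬ z i ∨ y i) {i : ℕ} (hi : w.IsPos i) :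
    z i ↔ SemUntl w .linear x y i := by
  have hs := linearUntlEqs_sem (w := w) (x := x) (y := y)
  have hbase : ∀ i, w.IsPos i → y i → z i := fun i hi hy => by
    by_cases hl : w.IsPos (i + 1)
    · exact (h.succ i hl).2 (Or.inl hy)
    · exact (h.last i hi hl).2 hy
  constructor
  · intro hz
    by_contra hU
    have key : ∀ j, i ≤ j → w.IsPos j ∧ z j ∧ ¬ SemUntl w .linear x y j := by
      intro j hj
      induction j, hj using Nat.le_induction with
      | base => exact ⟨hi, hz, hU⟩
      | succ j hj ih =>
        obtain ⟨h1, h2, h3⟩ := ih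
        by_cases hl : w.IsPos (j + 1)
        · rw [h.succ j hl] at h2
          rw [hs.succ j hl] at h3
          exact ⟨hl, by tauto, by tauto⟩
        · rw [h.last j h1 hl] at h2
          rw [hs.last j h1 hl] at h3
          exact absurd h2 h3
    by_cases hw : ∀ i, w.IsPos i
    · obtain ⟨j, hj, hFj⟩ := (frequently_atTop.1 (hF hw)) i
      obtain ⟨h1, h2, h3⟩ := key j hj
      have := (semUntl_iff step_linear j).not.1 h3
      tauto
    · push Not at hw
      obtain ⟨l, hl⟩ := hw
      exact hl ((key (max i l) (by omega)).1.mono (by omega))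
  · intro hU
    refine hU.induction step_linear hbase ?_
    rintro i _ hx hi rfl hz
    exact (h.succ i hi).2 (Or.inr ⟨hx, hz⟩)

/-- Expansion laws of the linear since. -/
structure LinearSnceEqs (w : NestedWord A) (x y z : ℕ → Prop) : Prop where
  zero : w.IsPos 0 → (z 0 ↔ y 0)
  succ : ∀ i, w.IsPos (i + 1) → (z (i + 1) ↔ y (i + 1) ∨ (x (i + 1) ∧ z i))

theorem linearSnceEqs_sem : LinearSnceEqs w x y (SemSnce w .linear x y) where
  zero _ := by
    rw [semSnce_iff step_linear]
    simp
  succ i _ := by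
    rw [semSnce_iff step_linear]
    constructor
    · rintro (h | ⟨hx, i', -, h', h⟩)
      · exact Or.inl h
      · obtain rfl : i = i' := Nat.succ.inj h'
        exact Or.inr ⟨hx, h⟩
    · rintro (h | ⟨hx, h⟩)
      · exact Or.inl h
      · exact Or.inr ⟨hx, i, by omega, rfl, h⟩

theorem LinearSnceEqs.iff (h : LinearSnceEqs w x y z) {i : ℕ} (hi : w.IsPos i) :
    z i ↔ SemSnce w .linear x y i := by
  have hs := linearSnceEqs_sem (w := w) (x := x) (y := y)
  induction i with
  | zero => rw [h.zero hi, hs.zero hi]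
  | succ i ih =>
    have ih' : z i ↔ SemSnce w .linear x y i := ih (hi.mono (Nat.le_succ i))
    rw [h.succ i hi, hs.succ i hi, ih']

/-! ### Abstract paths -/

theorem step_abstr (j j' a b : ℕ) (h : Step w j .abstr a b) : Step w j' .abstr a b := h

/-- Expansion laws of the abstract until. -/
structure AbstrUntlEqs (w : NestedWord A) (x y z : ℕ → Prop) : Prop where
  succ : ∀ i, w.IsPos (i + 1) → ¬ w.call i →
    (z i ↔ y i ∨ (x i ∧ ¬ w.MatchedRet (i + 1) ∧ z (i + 1)))
  edge : ∀ c r, w.edge c r → (z c ↔ y c ∨ (x c ∧ z r))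
  pending : ∀ i, w.call i → ¬ w.MatchedCall i → (z i ↔ y i)
  last : ∀ i, w.IsPos i → ¬ w.IsPos (i + 1) → (z i ↔ y i)

theorem abstrUntlEqs_sem : AbstrUntlEqs w x y (SemUntl w .abstr x y) where
  succ i hi hc := by
    rw [semUntl_iff step_abstr]
    have := hi.mono (Nat.le_succ i)
    constructor
    · rintro (⟨-, h⟩ | ⟨hx, i', -, (he | ⟨-, hr, rfl⟩), h⟩)
      · exact Or.inl h
      · exact absurd (w.edge_call _ _ he) hc
      · exact Or.inr ⟨hx, hr, h⟩
    · rintro (h | ⟨hx, hr, h⟩)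
      · exact Or.inl ⟨this, h⟩
      · exact Or.inr ⟨hx, i + 1, by omega, Or.inr ⟨hc, hr, rfl⟩, h⟩
  edge c r he := by
    rw [semUntl_iff step_abstr]
    have hlt := w.edge_lt _ _ he
    have := (isPos_of_edge he).mono hlt.le
    constructor
    · rintro (⟨-, h⟩ | ⟨hx, i', -, (he' | ⟨hc, -⟩), h⟩)
      · exact Or.inl h
      · rw [w.edge_right_unique _ _ _ he he']
        exact Or.inr ⟨hx, h⟩
      · exact absurd (w.edge_call _ _ he) hc
    · rintro (h | ⟨hx, h⟩)
      · exact Or.inl ⟨this, h⟩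
      · exact Or.inr ⟨hx, r, hlt, Or.inl he, h⟩
  pending i hc hm := by
    rw [semUntl_iff step_abstr]
    constructor
    · rintro (⟨-, h⟩ | ⟨hx, i', -, (he' | ⟨hc', -⟩), h⟩)
      · exact h
      · exact absurd ⟨_, he'⟩ hm
      · exact absurd hc hc'
    · exact fun h => Or.inl ⟨w.call_lt i hc, h⟩
  last i hi hl := by
    rw [semUntl_iff step_abstr]
    constructor
    · rintro (⟨-, h⟩ | ⟨hx, i', hlt, -, h⟩)
      · exact h
      · exact absurd (h.isPos.mono hlt) hl
    · exact fun h => Or.inl ⟨hi, h⟩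

theorem abstrUntl_frequently :
    ∃ᶠ i in atTop, ¬ w.Inside i ∧ (¬ SemUntl w .abstr x y i ∨ y i) := by
  refine frequently_atTop.2 fun N => ?_
  obtain ⟨j, hj, hins⟩ := w.exists_ge_not_inside N
  by_cases h : SemUntl w .abstr x y j
  · obtain ⟨k, hk, h1, h2⟩ : ∃ k, j ≤ k ∧ ¬ w.Inside k ∧ y k := by
      refine h.induction (P := fun i => ¬ w.Inside i → ∃ k, i ≤ k ∧ ¬ w.Inside k ∧ y k)
        step_abstr (fun i _ hy hi => ⟨i, le_rfl, hi, hy⟩) ?_ hins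
      rintro i i' - - hs ih hi
      have : i ≤ i' ∧ ¬ w.Inside i' := by
        rcases hs with he | ⟨hc, -, rfl⟩
        · exact ⟨(w.edge_lt _ _ he).le, by rwa [inside_ret he]⟩
        · exact ⟨by omega, not_inside_succ hi fun hm => hc hm.call⟩
      obtain ⟨k, hk, h⟩ := ih this.2
      exact ⟨k, by omega, h⟩
    exact ⟨k, by omega, h1, Or.inr h2⟩
  · exact ⟨j, hj, hins, Or.inl h⟩

theorem AbstrUntlEqs.iff (h : AbstrUntlEqs w x y z)
    (hF : (∀ i, w.IsPos i) → ∃ᶠ i in atTop, ¬ w.Inside i ∧ (¬ z i ∨ y i)) {i : ℕ}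
    (hi : w.IsPos i) : z i ↔ SemUntl w .abstr x y i := by
  have hs := abstrUntlEqs_sem (w := w) (x := x) (y := y)
  constructor
  · intro hz
    by_contra hU
    refine false_of_chain (P := fun i => w.IsPos i ∧ z i ∧ ¬ SemUntl w .abstr x y i) ?_ ?_
      (fun i h => h.1) hF (fun i h => h.1) ?_ i ⟨hi, hz, hU⟩
    · rintro i r ⟨h1, h2, h3⟩ he
      rw [h.edge _ _ he] at h2
      rw [hs.edge _ _ he] at h3
      exact ⟨isPos_of_edge he, by tauto, by tauto⟩
    · rintro i ⟨h1, h2, h3⟩ hm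
      by_cases hc : w.call i
      · rw [h.pending _ hc hm] at h2
        rw [hs.pending _ hc hm] at h3
        exact absurd h2 h3
      · by_cases hl : w.IsPos (i + 1)
        · rw [h.succ _ hl hc] at h2
          rw [hs.succ _ hl hc] at h3
          exact ⟨hl, by tauto, by tauto⟩
        · rw [h.last _ h1 hl] at h2
          rw [hs.last _ h1 hl] at h3
          exact absurd h2 h3
    · rintro i ⟨h1, h2, h3⟩ ⟨-, h4⟩
      have := (semUntl_iff step_abstr i).not.1 h3
      tauto
  · intro hU
    refine hU.induction step_abstr ?_ ?_
    · intro i hi hy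
      by_cases hm : w.MatchedCall i
      · obtain ⟨r, he⟩ := hm
        exact (h.edge _ _ he).2 (Or.inl hy)
      · by_cases hc : w.call i
        · exact (h.pending _ hc hm).2 hy
        · by_cases hl : w.IsPos (i + 1)
          · exact (h.succ _ hl hc).2 (Or.inl hy)
          · exact (h.last _ hi hl).2 hy
    · rintro i i' hx hi' (he | ⟨hc, hr, rfl⟩) hz
      · exact (h.edge _ _ he).2 (Or.inr ⟨hx, hz⟩)
      · exact (h.succ _ hi' hc).2 (Or.inr ⟨hx, hr, hz⟩)

/-- Expansion laws of the abstract since. -/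
structure AbstrSnceEqs (w : NestedWord A) (x y z : ℕ → Prop) : Prop where
  zero : w.IsPos 0 → (z 0 ↔ y 0)
  succ : ∀ i, w.IsPos (i + 1) → ¬ w.MatchedRet (i + 1) →
    (z (i + 1) ↔ y (i + 1) ∨ (x (i + 1) ∧ ¬ w.call i ∧ z i))
  edge : ∀ c r, w.edge c r → (z r ↔ y r ∨ (x r ∧ z c))

theorem abstrSnceEqs_sem : AbstrSnceEqs w x y (SemSnce w .abstr x y) where
  zero _ := by
    rw [semSnce_iff step_abstr]
    simp
  succ i _ hr := by
    rw [semSnce_iff step_abstr]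
    constructor
    · rintro (h | ⟨hx, i', -, (he | ⟨hc, -, h'⟩), h⟩)
      · exact Or.inl h
      · exact absurd ⟨_, he⟩ hr
      · obtain rfl : i = i' := Nat.succ.inj h'
        exact Or.inr ⟨hx, hc, h⟩
    · rintro (h | ⟨hx, hc, h⟩)
      · exact Or.inl h
      · exact Or.inr ⟨hx, i, by omega, Or.inr ⟨hc, hr, rfl⟩, h⟩
  edge c r he := by
    rw [semSnce_iff step_abstr]
    constructor
    · rintro (h | ⟨hx, i', -, (he' | ⟨-, hr, rfl⟩), h⟩)
      · exact Or.inl h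
      · rw [w.edge_left_unique _ _ _ he he']
        exact Or.inr ⟨hx, h⟩
      · exact absurd ⟨_, he⟩ hr
    · rintro (h | ⟨hx, h⟩)
      · exact Or.inl h
      · exact Or.inr ⟨hx, c, w.edge_lt _ _ he, Or.inl he, h⟩

theorem AbstrSnceEqs.iff (h : AbstrSnceEqs w x y z) {i : ℕ} (hi : w.IsPos i) :
    z i ↔ SemSnce w .abstr x y i := by
  have hs := abstrSnceEqs_sem (w := w) (x := x) (y := y)
  induction i using Nat.strong_induction_on with
  | _ i ih =>
    by_cases hr : w.MatchedRet i
    · obtain ⟨c, he⟩ := hr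
      have hlt := w.edge_lt _ _ he
      have ih' : z c ↔ SemSnce w .abstr x y c := ih c hlt (hi.mono hlt.le)
      rw [h.edge _ _ he, hs.edge _ _ he, ih']
    · cases i with
      | zero => rw [h.zero hi, hs.zero hi]
      | succ i =>
        have ih' : z i ↔ SemSnce w .abstr x y i := ih i (by omega) (hi.mono (Nat.le_succ i))
        rw [h.succ i hi hr, hs.succ i hi hr, ih']

/-! ### Call paths -/

theorem step_call (j j' a b : ℕ) (h : Step w j .call a b) : Step w j' .call a b := h

/-- At `i` or later within the innermost matched pair around `i`, outside deeper pairs, `z`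
holds. -/
def LaterInCall (w : NestedWord A) (z : ℕ → Prop) (i : ℕ) : Prop :=
  ∃ c i', w.InnermostCall c i ∧ i ≤ i' ∧ w.InnermostCall c i' ∧ z i'

/-- Expansion laws of the call until `z`, where `d` is `LaterInCall w z` inside matched pairs. -/
structure CallUntlEqs (w : NestedWord A) (x y z d : ℕ → Prop) : Prop where
  call : ∀ i, w.IsPos (i + 1) → w.MatchedCall i →
    (z i ↔ y i ∨ (x i ∧ ¬ w.MatchedRet (i + 1) ∧ d (i + 1)))
  other : ∀ i, w.IsPos i → ¬ w.MatchedCall i → (z i ↔ y i)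
  later_succ : ∀ i, w.IsPos (i + 1) → w.Inside i → ¬ w.MatchedCall i →
    (d i ↔ z i ∨ (¬ w.MatchedRet (i + 1) ∧ d (i + 1)))
  later_edge : ∀ c r, w.edge c r → w.Inside c → (d c ↔ z c ∨ d r)

theorem callUntlEqs_sem :
    CallUntlEqs w x y (SemUntl w .call x y) (LaterInCall w (SemUntl w .call x y)) where
  call i hi hm := by
    rw [semUntl_iff step_call]
    have := hi.mono (Nat.le_succ i)
    constructor
    · rintro (⟨-, h⟩ | ⟨hx, i', hlt, hin, h⟩)
      · exact Or.inl h
      · have hr : ¬ w.MatchedRet (i + 1) := by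
          intro hr
          obtain ⟨-, r, he, hr'⟩ := hin.1
          have := w.edge_right_unique _ _ _ he (edge_of_matchedCall_of_matchedRet_succ hm hr)
          omega
        exact Or.inr ⟨hx, hr, i, i', (innermostCall_succ_of_matchedCall hr hm).2 rfl, hlt, hin, h⟩
    · rintro (h | ⟨hx, hr, c, i', h1, h2, h3, h4⟩)
      · exact Or.inl ⟨this, h⟩
      · obtain rfl := (innermostCall_succ_of_matchedCall hr hm).1 h1
        exact Or.inr ⟨hx, i', h2, h3, h4⟩
  other i hi hm := by
    rw [semUntl_iff step_call]
    constructor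
    · rintro (⟨-, h⟩ | ⟨hx, i', hlt, hin, h⟩)
      · exact h
      · obtain ⟨-, r, he, -⟩ := hin.1
        exact absurd ⟨r, he⟩ hm
    · exact fun h => Or.inl ⟨hi, h⟩
  later_succ i hi hin hm := by
    constructor
    · rintro ⟨c, i', h1, h2, h3, h4⟩
      rcases h2.eq_or_lt with rfl | h2
      · exact Or.inl h4
      · have hr : ¬ w.MatchedRet (i + 1) := by
          rintro ⟨c', he⟩
          have hlt := w.edge_lt _ _ he
          have hne : c' ≠ i := by
            rintro rfl
            exact hm ⟨_, he⟩
          have hle := h1.2 c' ⟨by omega, _, he, by omega⟩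
          obtain ⟨-, r, he', hr'⟩ := h3.1
          rcases hle.eq_or_lt with rfl | hle
          · have := w.edge_right_unique _ _ _ he he'
            omega
          · have := h1.1.1
            have := edge_inside_of_call he he' hle (by omega)
            omega
        exact Or.inr ⟨hr, c, i', (innermostCall_succ hr hm).2 h1, h2, h3, h4⟩
    · rintro (h | ⟨hr, c, i', h1, h2, h3, h4⟩)
      · obtain ⟨c, hc⟩ := hin.exists_innermostCall
        exact ⟨c, i, hc, le_rfl, hc, h⟩
      · exact ⟨c, i', (innermostCall_succ hr hm).1 h1, by omega, h3, h4⟩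
  later_edge i r he hin := by
    have hlt := w.edge_lt _ _ he
    constructor
    · rintro ⟨c, i', h1, h2, h3, h4⟩
      rcases h2.eq_or_lt with rfl | h2
      · exact Or.inl h4
      · refine Or.inr ⟨c, i', (innermostCall_ret he).2 h1, ?_, h3, h4⟩
        by_contra hlt'
        have := h3.2 i ⟨h2, r, he, by omega⟩
        have := h1.1.1
        omega
    · rintro (h | ⟨c, i', h1, h2, h3, h4⟩)
      · obtain ⟨c, hc⟩ := hin.exists_innermostCall
        exact ⟨c, i, hc, le_rfl, hc, h⟩
      · exact ⟨c, i', (innermostCall_ret he).1 h1, by omega, h3, h4⟩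

/-- Inside a matched pair the expansion laws of the call until have only one solution. -/
theorem CallUntlEqs.agree {z' d' : ℕ → Prop} (h : CallUntlEqs w x y z d)
    (h' : CallUntlEqs w x y z' d') {c r i : ℕ} (he : w.edge c r) (h1 : c < i) (h2 : i < r) :
    (z i ↔ z' i) ∧ (d i ↔ d' i) := by
  induction hn : r - i using Nat.strong_induction_on generalizing i with
  | _ n ih =>
    have hi : w.IsPos (i + 1) := (isPos_of_edge he).mono h2
    have hin : w.Inside i := ⟨c, h1, r, he, h2⟩
    have hnext : ¬ w.MatchedRet (i + 1) → (d (i + 1) ↔ d' (i + 1)) := fun hr => by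
      have : i + 1 ≠ r := by
        rintro rfl
        exact hr ⟨c, he⟩
      exact (ih (r - (i + 1)) (by omega) (by omega) (by omega) rfl).2
    by_cases hm : w.MatchedCall i
    · obtain ⟨s, hs⟩ := hm
      have hsr := edge_inside_of_call he hs h1 h2
      have his := w.edge_lt _ _ hs
      have hz : z i ↔ z' i := by
        rw [h.call i hi ⟨s, hs⟩, h'.call i hi ⟨s, hs⟩]
        tauto
      refine ⟨hz, ?_⟩
      rw [h.later_edge i s hs hin, h'.later_edge i s hs hin, hz,
        (ih (r - s) (by omega) (by omega) (by omega) rfl).2]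
    · have hz : z i ↔ z' i := by
        rw [h.other i (hi.mono (Nat.le_succ i)) hm, h'.other i (hi.mono (Nat.le_succ i)) hm]
      refine ⟨hz, ?_⟩
      rw [h.later_succ i hi hin hm, h'.later_succ i hi hin hm, hz]
      tauto

/-- The call until needs no progress condition: it is trivial except at matched calls, where it
depends only on positions inside the matched pair. -/
theorem CallUntlEqs.iff (h : CallUntlEqs w x y z d) {i : ℕ} (hi : w.IsPos i) :
    z i ↔ SemUntl w .call x y i := by
  have hs := callUntlEqs_sem (w := w) (x := x) (y := y)
  by_cases hm : w.MatchedCall i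
  · obtain ⟨r, he⟩ := hm
    have hlt := w.edge_lt _ _ he
    have hi' := (isPos_of_edge he).mono hlt
    rw [h.call i hi' ⟨r, he⟩, hs.call i hi' ⟨r, he⟩]
    by_cases hr : w.MatchedRet (i + 1)
    · simp [hr]
    · have : i + 1 ≠ r := by
        rintro rfl
        exact hr ⟨_, he⟩
      rw [(h.agree hs he (by omega : i < i + 1) (by omega)).2]
  · rw [h.other i hi hm, hs.other i hi hm]

/-- Expansion laws of the call since `z`, where `d` is the value of `z` at the innermost call. -/
structure CallSnceEqs (w : NestedWord A) (x y z d : ℕ → Prop) : Prop where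
  unfold : ∀ i, w.IsPos i → (z i ↔ y i ∨ (x i ∧ d i))
  zero : w.IsPos 0 → ¬ d 0
  edge : ∀ c r, w.edge c r → (d r ↔ d c)
  succ_call : ∀ i, w.IsPos (i + 1) → ¬ w.MatchedRet (i + 1) → w.MatchedCall i → (d (i + 1) ↔ z i)
  succ_other : ∀ i, w.IsPos (i + 1) → ¬ w.MatchedRet (i + 1) → ¬ w.MatchedCall i →
    (d (i + 1) ↔ d i)

theorem callSnceEqs_sem : CallSnceEqs w x y (SemSnce w .call x y)
    (fun i => ∃ c, w.InnermostCall c i ∧ SemSnce w .call x y c) where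
  unfold i _ := by
    rw [semSnce_iff step_call]
    refine or_congr Iff.rfl (and_congr Iff.rfl (exists_congr fun c => ?_))
    exact ⟨fun h => h.2, fun h => ⟨h.1.1.1, h⟩⟩
  zero _ := fun ⟨c, h, _⟩ => not_encloses_zero h.1
  edge c r he := by simp [innermostCall_ret he]
  succ_call i _ hr hm := by simp [innermostCall_succ_of_matchedCall hr hm]
  succ_other i _ hr hm := by simp [innermostCall_succ hr hm]

theorem CallSnceEqs.iff (h : CallSnceEqs w x y z d) {i : ℕ} (hi : w.IsPos i) :
    z i ↔ SemSnce w .call x y i := by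
  have hs := callSnceEqs_sem (w := w) (x := x) (y := y)
  have key : ∀ i, w.IsPos i → (d i ↔ ∃ c, w.InnermostCall c i ∧ SemSnce w .call x y c) := by
    intro i
    induction i using Nat.strong_induction_on with
    | _ i ih =>
      intro hi
      by_cases hr : w.MatchedRet i
      · obtain ⟨c, he⟩ := hr
        have hlt := w.edge_lt _ _ he
        rw [h.edge _ _ he, ih c hlt (hi.mono hlt.le)]
        exact (hs.edge _ _ he).symm
      · cases i with
        | zero => exact iff_of_false (h.zero hi) (hs.zero hi)
        | succ i =>
          have hi' := hi.mono (Nat.le_succ i)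
          by_cases hm : w.MatchedCall i
          · rw [h.succ_call i hi hr hm, h.unfold i hi', ih i (by omega) hi', ← hs.unfold i hi']
            exact (hs.succ_call i hi hr hm).symm
          · rw [h.succ_other i hi hr hm, ih i (by omega) hi']
            exact (hs.succ_other i hi hr hm).symm
  rw [h.unfold i hi, hs.unfold i hi, key i hi]

/-! ### Summary paths: expansion laws -/

/-- The summary until, with its witness before the end of all matched pairs around `i`. -/
def SumUntlIn (w : NestedWord A) (x y : ℕ → Prop) (i : ℕ) : Prop :=
  ∃ j, w.IsPos j ∧ SumUntl w x y i j ∧ ∀ c r, w.edge c r → c < i → i < r → j < r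

/-- Expansion laws of the summary until `z`. Here `d` is `SumUntlIn`, and `e` says at a matched call
that `d` holds at the next position, within the call. -/
structure SummaryUntlEqs (w : NestedWord A) (x y z d e : ℕ → Prop) : Prop where
  succ : ∀ i, w.IsPos (i + 1) → ¬ w.MatchedCall i → (z i ↔ y i ∨ (x i ∧ z (i + 1)))
  last : ∀ i, w.IsPos i → ¬ w.IsPos (i + 1) → (z i ↔ y i)
  edge : ∀ c r, w.edge c r → (z c ↔ y c ∨ (x c ∧ (z r ∨ e c)))
  enter : ∀ i, w.IsPos (i + 1) → w.MatchedCall i → (e i ↔ ¬ w.MatchedRet (i + 1) ∧ d (i + 1))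
  in_succ : ∀ i, w.IsPos (i + 1) → ¬ w.MatchedCall i →
    (d i ↔ y i ∨ (x i ∧ ¬ w.MatchedRet (i + 1) ∧ d (i + 1)))
  in_edge : ∀ c r, w.edge c r → (d c ↔ y c ∨ (x c ∧ (d r ∨ e c)))

/-- Entering a matched call for good: its body satisfies the until without leaving it. -/
def SumUntlEnter (w : NestedWord A) (x y : ℕ → Prop) (i : ℕ) : Prop :=
  w.MatchedCall i ∧ ¬ w.MatchedRet (i + 1) ∧ SumUntlIn w x y (i + 1)

theorem step_summary_edge {i r j : ℕ} (he : w.edge i r) (h : r ≤ j) : Step w j .summary i r :=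
  Or.inl ⟨he, h⟩

theorem step_summary_enter {i r j : ℕ} (he : w.edge i r) (h : j < r) :
    Step w j .summary i (i + 1) := by
  refine Or.inr ⟨?_, rfl⟩
  rintro ⟨s, hs, hsj⟩
  have := w.edge_right_unique _ _ _ he hs
  omega

theorem step_summary_succ {i j : ℕ} (hm : ¬ w.MatchedCall i) : Step w j .summary i (i + 1) :=
  Or.inr ⟨fun ⟨s, hs, _⟩ => hm ⟨s, hs⟩, rfl⟩

theorem SumUntl.enter {i r j : ℕ} (he : w.edge i r) (hj : j < r) (hij : i < j)
    (h : SumUntl w x y i j) : x i ∧ ¬ w.MatchedRet (i + 1) ∧ SumUntl w x y (i + 1) j := by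
  obtain ⟨h1, h2⟩ := (sumUntl_step (step_summary_enter he hj) (Nat.lt_succ_self i) hij).1 h
  refine ⟨h1, fun hr => ?_, h2⟩
  have := w.edge_right_unique _ _ _ he (edge_of_matchedCall_of_matchedRet_succ ⟨r, he⟩ hr)
  omega

theorem lt_of_sumUntlIn_succ {i r j : ℕ} (he : w.edge i r) (hr : ¬ w.MatchedRet (i + 1))
    (h : ∀ c r, w.edge c r → c < i + 1 → i + 1 < r → j < r) : j < r := by
  refine h i r he (by omega) (lt_of_le_of_ne (w.edge_lt _ _ he) ?_)
  rintro rfl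
  exact hr ⟨i, he⟩

theorem summaryUntlEqs_sem : SummaryUntlEqs w x y (SemUntl w .summary x y) (SumUntlIn w x y)
    (SumUntlEnter w x y) where
  succ i hi hm := by
    simp only [semUntl_summary]
    constructor
    · rintro ⟨j, hj, h⟩
      rcases h.1.eq_or_lt with rfl | hlt
      · exact Or.inl h.2.1
      · obtain ⟨h1, h2⟩ := (sumUntl_step (step_summary_succ hm) (Nat.lt_succ_self i) hlt).1 h
        exact Or.inr ⟨h1, j, hj, h2⟩
    · rintro (h | ⟨hx, j, hj, h⟩)
      · exact ⟨i, hi.mono (Nat.le_succ i), sumUntl_self.2 h⟩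
      · exact ⟨j, hj, (sumUntl_step (step_summary_succ hm) (Nat.lt_succ_self i) h.1).2 ⟨hx, h⟩⟩
  last i hi hl := by
    simp only [semUntl_summary]
    constructor
    · rintro ⟨j, hj, h⟩
      rcases h.1.eq_or_lt with rfl | hlt
      · exact h.2.1
      · exact absurd (hj.mono hlt) hl
    · exact fun h => ⟨i, hi, sumUntl_self.2 h⟩
  edge c r he := by
    have hlt := w.edge_lt _ _ he
    simp only [semUntl_summary]
    constructor
    · rintro ⟨j, hj, h⟩
      rcases h.1.eq_or_lt with rfl | hcj
      · exact Or.inl h.2.1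
      · rcases Nat.lt_or_ge j r with hjr | hjr
        · obtain ⟨h1, h2, h3⟩ := h.enter he hjr hcj
          refine Or.inr ⟨h1, Or.inr ⟨⟨r, he⟩, h2, j, hj, h3, fun c' r' he' h4 h5 => ?_⟩⟩
          rcases Nat.lt_or_ge c' c with h6 | h6
          · exact hjr.trans (edge_inside_of_call he' he h6 (by omega))
          · obtain rfl : c' = c := by omega
            rwa [← w.edge_right_unique _ _ _ he he']
        · obtain ⟨h1, h2⟩ := (sumUntl_step (step_summary_edge he hjr) hlt hjr).1 h
          exact Or.inr ⟨h1, Or.inl ⟨j, hj, h2⟩⟩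
    · rintro (h | ⟨hx, ⟨j, hj, h⟩ | ⟨-, hr, j, hj, h, hin⟩⟩)
      · exact ⟨c, (isPos_of_edge he).mono hlt.le, sumUntl_self.2 h⟩
      · exact ⟨j, hj, (sumUntl_step (step_summary_edge he h.1) hlt h.1).2 ⟨hx, h⟩⟩
      · exact ⟨j, hj, (sumUntl_step (step_summary_enter he (lt_of_sumUntlIn_succ he hr hin))
          (Nat.lt_succ_self c) h.1).2 ⟨hx, h⟩⟩
  enter i _ hm := by simp [SumUntlEnter, hm]
  in_succ i hi hm := by
    constructor
    · rintro ⟨j, hj, h, hin⟩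
      rcases h.1.eq_or_lt with rfl | hlt
      · exact Or.inl h.2.1
      · obtain ⟨h1, h2⟩ := (sumUntl_step (step_summary_succ hm) (Nat.lt_succ_self i) hlt).1 h
        refine Or.inr ⟨h1, ?_, j, hj, h2, fun c r he hc hr => hin c r he ?_ (by omega)⟩
        · rintro ⟨c, he⟩
          have := w.edge_lt _ _ he
          have hne : c ≠ i := by
            rintro rfl
            exact hm ⟨_, he⟩
          have := hin c (i + 1) he (by omega) (by omega)
          omega
        · refine lt_of_le_of_ne (Nat.lt_succ_iff.1 hc) ?_
          rintro rfl
          exact hm ⟨_, he⟩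
    · rintro (h | ⟨hx, hr, j, hj, h, hin⟩)
      · exact ⟨i, hi.mono (Nat.le_succ i), sumUntl_self.2 h, fun c r he h1 h2 => h2⟩
      · refine ⟨j, hj, (sumUntl_step (step_summary_succ hm) (Nat.lt_succ_self i) h.1).2 ⟨hx, h⟩,
          fun c r he h1 h2 => hin c r he (by omega) (lt_of_le_of_ne h2 ?_)⟩
        rintro rfl
        exact hr ⟨c, he⟩
  in_edge c r he := by
    have hlt := w.edge_lt _ _ he
    constructor
    · rintro ⟨j, hj, h, hin⟩
      rcases h.1.eq_or_lt with rfl | hcj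
      · exact Or.inl h.2.1
      · rcases Nat.lt_or_ge j r with hjr | hjr
        · obtain ⟨h1, h2, h3⟩ := h.enter he hjr hcj
          refine Or.inr ⟨h1, Or.inr ⟨⟨r, he⟩, h2, j, hj, h3, fun c' r' he' h4 h5 => ?_⟩⟩
          rcases Nat.lt_or_ge c' c with h6 | h6
          · exact hjr.trans (edge_inside_of_call he' he h6 (by omega))
          · obtain rfl : c' = c := by omega
            rwa [← w.edge_right_unique _ _ _ he he']
        · obtain ⟨h1, h2⟩ := (sumUntl_step (step_summary_edge he hjr) hlt hjr).1 h
          refine Or.inr ⟨h1, Or.inl ⟨j, hj, h2, fun c' r' he' h3 h4 => ?_⟩⟩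
          have := (encloses_ret he).1 ⟨h3, r', he', h4⟩
          exact hin c' r' he' this.1 (by omega)
    · rintro (h | ⟨hx, ⟨j, hj, h, hin⟩ | ⟨-, hr, j, hj, h, hin⟩⟩)
      · exact ⟨c, (isPos_of_edge he).mono hlt.le, sumUntl_self.2 h, fun c r he h1 h2 => h2⟩
      · refine ⟨j, hj, (sumUntl_step (step_summary_edge he h.1) hlt h.1).2 ⟨hx, h⟩,
          fun c' r' he' h1 h2 => hin c' r' he' (by omega) ?_⟩
        exact edge_inside_of_call he' he h1 h2
      · have hjr := lt_of_sumUntlIn_succ he hr hin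
        refine ⟨j, hj, (sumUntl_step (step_summary_enter he hjr)
          (Nat.lt_succ_self c) h.1).2 ⟨hx, h⟩, fun c' r' he' h1 h2 => ?_⟩
        exact hjr.trans (edge_inside_of_call he' he h1 h2)

/-- Inside a matched pair the expansion laws determine the auxiliary predicate `d`. -/
theorem SummaryUntlEqs.agree_in {z' d' e' : ℕ → Prop} (h : SummaryUntlEqs w x y z d e)
    (h' : SummaryUntlEqs w x y z' d' e') {c r i : ℕ} (he : w.edge c r) (h1 : c < i) (h2 : i < r) :
    d i ↔ d' i := by
  induction hn : r - i using Nat.strong_induction_on generalizing i with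
  | _ n ih =>
    have hi : w.IsPos (i + 1) := (isPos_of_edge he).mono h2
    have hnext : ¬ w.MatchedRet (i + 1) → (d (i + 1) ↔ d' (i + 1)) := fun hr => by
      have : i + 1 ≠ r := by
        rintro rfl
        exact hr ⟨c, he⟩
      exact ih (r - (i + 1)) (by omega) (by omega) (by omega) rfl
    by_cases hm : w.MatchedCall i
    · have hm' := hm
      obtain ⟨s, hs⟩ := hm
      have hsr := edge_inside_of_call he hs h1 h2
      have his := w.edge_lt _ _ hs
      rw [h.in_edge i s hs, h'.in_edge i s hs, h.enter i hi hm', h'.enter i hi hm',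
        ih (r - s) (by omega) (by omega) (by omega) rfl]
      tauto
    · rw [h.in_succ i hi hm, h'.in_succ i hi hm]
      tauto

theorem SummaryUntlEqs.agree_enter {z' d' e' : ℕ → Prop} (h : SummaryUntlEqs w x y z d e)
    (h' : SummaryUntlEqs w x y z' d' e') {i : ℕ} (hm : w.MatchedCall i) : e i ↔ e' i := by
  have hm' := hm
  obtain ⟨r, he⟩ := hm
  have hlt := w.edge_lt _ _ he
  have hi := (isPos_of_edge he).mono hlt
  rw [h.enter i hi hm', h'.enter i hi hm']
  by_cases hr : w.MatchedRet (i + 1)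
  · simp [hr]
  · have : i + 1 ≠ r := by
      rintro rfl
      exact hr ⟨_, he⟩
    rw [h.agree_in h' he (by omega : i < i + 1) (by omega)]

theorem summaryUntl_frequently (hw : ∀ i, w.IsPos i) :
    ∃ᶠ i in atTop, ¬ w.Inside i ∧ (¬ SemUntl w .summary x y i ∨ y i ∨
      (x i ∧ w.MatchedCall i ∧ SumUntlEnter w x y i)) := by
  have key : ∀ k i, ¬ w.Inside i → SumUntl w x y i k → ∃ t, i ≤ t ∧ ¬ w.Inside t ∧
      (y t ∨ (x t ∧ w.MatchedCall t ∧ SumUntlEnter w x y t)) := by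
    intro k i
    induction hn : k - i using Nat.strong_induction_on generalizing i with
    | _ n ih =>
      intro hi h
      rcases h.1.eq_or_lt with rfl | hlt
      · exact ⟨i, le_rfl, hi, Or.inl h.2.1⟩
      by_cases hm : w.MatchedCall i
      · obtain ⟨r, he⟩ := hm
        have hir := w.edge_lt _ _ he
        rcases Nat.lt_or_ge k r with hkr | hkr
        · obtain ⟨h1, h2, h3⟩ := h.enter he hkr hlt
          refine ⟨i, le_rfl, hi, Or.inr ⟨h1, ⟨r, he⟩, ⟨r, he⟩, h2, k, hw k, h3, ?_⟩⟩
          intro c' r' he' h4 h5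
          rcases Nat.lt_or_ge c' i with h6 | h6
          · exact absurd ⟨c', h6, r', he', by omega⟩ hi
          · obtain rfl : c' = i := by omega
            rwa [← w.edge_right_unique _ _ _ he he']
        · obtain ⟨h1, h2⟩ := (sumUntl_step (step_summary_edge he hkr) hir hkr).1 h
          obtain ⟨t, h3, h4⟩ := ih (k - r) (by omega) r rfl (by rwa [inside_ret he]) h2
          exact ⟨t, by omega, h4⟩
      · obtain ⟨h1, h2⟩ := (sumUntl_step (step_summary_succ hm) (Nat.lt_succ_self i) hlt).1 h
        obtain ⟨t, h3, h4⟩ := ih (k - (i + 1)) (by omega) (i + 1) rfl (not_inside_succ hi hm) h2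
        exact ⟨t, by omega, h4⟩
  refine frequently_atTop.2 fun N => ?_
  obtain ⟨j, hj, hins⟩ := w.exists_ge_not_inside N
  by_cases h : SemUntl w .summary x y j
  · obtain ⟨k, -, hk⟩ := semUntl_summary.1 h
    obtain ⟨t, h1, h2, h3⟩ := key k j hins hk
    exact ⟨t, by omega, h2, Or.inr h3⟩
  · exact ⟨j, hj, hins, Or.inl h⟩

/-- Where `z` holds and the until fails, the same is true at the next position or, from a matched
call on, at its return; so it is true somewhere outside all matched pairs, against the progress
condition. The predicates `d` and `e` are correct where they matter, by `agree_in` and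
`agree_enter`. -/
theorem SummaryUntlEqs.iff (h : SummaryUntlEqs w x y z d e)
    (hF : (∀ i, w.IsPos i) → ∃ᶠ i in atTop, ¬ w.Inside i ∧ (¬ z i ∨ y i ∨
      (x i ∧ w.MatchedCall i ∧ e i))) {i : ℕ} (hi : w.IsPos i) :
    z i ↔ SemUntl w .summary x y i := by
  have hs := summaryUntlEqs_sem (w := w) (x := x) (y := y)
  constructor
  · intro hz
    by_contra hU
    refine false_of_chain (P := fun i => w.IsPos i ∧ z i ∧ ¬ SemUntl w .summary x y i) ?_ ?_
      (fun i h => h.1) hF (fun i h => h.1) ?_ i ⟨hi, hz, hU⟩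
    · rintro i r ⟨h1, h2, h3⟩ he
      rw [h.edge _ _ he, h.agree_enter hs ⟨r, he⟩] at h2
      rw [hs.edge _ _ he] at h3
      exact ⟨isPos_of_edge he, by tauto, by tauto⟩
    · rintro i ⟨h1, h2, h3⟩ hm
      by_cases hl : w.IsPos (i + 1)
      · rw [h.succ _ hl hm] at h2
        rw [hs.succ _ hl hm] at h3
        exact ⟨hl, by tauto, by tauto⟩
      · rw [h.last _ h1 hl] at h2
        rw [hs.last _ h1 hl] at h3
        exact absurd h2 h3
    · rintro i ⟨h1, h2, h3⟩ ⟨-, h4 | h4 | ⟨h5, h6, h7⟩⟩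
      · exact h4 h2
      · exact h3 (semUntl_summary.2 ⟨i, h1, sumUntl_self.2 h4⟩)
      · rw [h.agree_enter hs h6] at h7
        obtain ⟨r, he⟩ := h6
        exact h3 ((hs.edge i r he).2 (Or.inr ⟨h5, Or.inr h7⟩))
  · rw [semUntl_summary]
    rintro ⟨j, hj, hU⟩
    induction hn : j - i using Nat.strong_induction_on generalizing i with
    | _ n ih =>
      by_cases hm : w.MatchedCall i
      · obtain ⟨r, he⟩ := hm
        rw [h.edge i r he]
        rcases hU.1.eq_or_lt with rfl | hlt
        · exact Or.inl hU.2.1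
        have hir := w.edge_lt _ _ he
        rcases Nat.lt_or_ge j r with hjr | hjr
        · obtain ⟨h1, h2, h3⟩ := hU.enter he hjr hlt
          rw [h.agree_enter hs ⟨r, he⟩]
          refine Or.inr ⟨h1, Or.inr ⟨⟨r, he⟩, h2, j, hj, h3, fun c' r' he' h4 h5 => ?_⟩⟩
          rcases Nat.lt_or_ge c' i with h6 | h6
          · exact hjr.trans (edge_inside_of_call he' he h6 (by omega))
          · obtain rfl : c' = i := by omega
            rwa [← w.edge_right_unique _ _ _ he he']
        · obtain ⟨h1, h2⟩ := (sumUntl_step (step_summary_edge he hjr) hir hjr).1 hU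
          exact Or.inr ⟨h1, Or.inl (ih (j - r) (by omega) (isPos_of_edge he) h2 rfl)⟩
      · rcases hU.1.eq_or_lt with rfl | hlt
        · by_cases hl : w.IsPos (i + 1)
          · exact (h.succ i hl hm).2 (Or.inl hU.2.1)
          · exact (h.last i hi hl).2 hU.2.1
        · have hl := hj.mono hlt
          obtain ⟨h1, h2⟩ := (sumUntl_step (step_summary_succ hm) (Nat.lt_succ_self i) hlt).1 hU
          exact (h.succ i hl hm).2 (Or.inr ⟨h1, ih (j - (i + 1)) (by omega) hl h2 rfl⟩)

/-- The summary since, with its witness after the beginning of all matched pairs around `i`. -/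
def SumSnceIn (w : NestedWord A) (x y : ℕ → Prop) (i : ℕ) : Prop :=
  ∃ j, SumSnce w x y j i ∧ ∀ c, w.Encloses c i → c < j

/-- Expansion laws of the summary since `z`, where `d` is `SumSnceIn`. -/
structure SummarySnceEqs (w : NestedWord A) (x y z d : ℕ → Prop) : Prop where
  zero : w.IsPos 0 → (z 0 ↔ y 0)
  succ : ∀ i, w.IsPos (i + 1) → ¬ w.MatchedRet (i + 1) →
    (z (i + 1) ↔ y (i + 1) ∨ (x (i + 1) ∧ z i))
  edge : ∀ c i, w.edge c (i + 1) →
    (z (i + 1) ↔ y (i + 1) ∨ (x (i + 1) ∧ (z c ∨ (¬ w.MatchedCall i ∧ d i))))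
  in_zero : w.IsPos 0 → (d 0 ↔ y 0)
  in_succ : ∀ i, w.IsPos (i + 1) → ¬ w.MatchedRet (i + 1) →
    (d (i + 1) ↔ y (i + 1) ∨ (x (i + 1) ∧ ¬ w.MatchedCall i ∧ d i))
  in_edge : ∀ c i, w.edge c (i + 1) →
    (d (i + 1) ↔ y (i + 1) ∨ (x (i + 1) ∧ (d c ∨ (¬ w.MatchedCall i ∧ d i))))

theorem SumSnce.zero_iff {j : ℕ} : SumSnce w x y j 0 ↔ j = 0 ∧ y 0 := by
  constructor
  · intro h
    obtain rfl : j = 0 := by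
      have := h.1
      omega
    exact ⟨rfl, h.2.1⟩
  · rintro ⟨rfl, h⟩
    exact sumSnce_self.2 h

/-- Directly before the return of `c`, every pair around is at least as large as that of `c`. -/
theorem encloses_le_of_edge_succ {c c' i : ℕ} (he : w.edge c (i + 1)) (h : w.Encloses c' i) :
    c' ≤ c := by
  obtain ⟨h1, r, h2, h3⟩ := h
  by_contra hlt
  have := edge_inside_of_call he h2 (by omega) (by omega)
  omega

theorem summarySnceEqs_sem :
    SummarySnceEqs w x y (SemSnce w .summary x y) (SumSnceIn w x y) where
  zero _ := by simp [semSnce_summary, SumSnce.zero_iff]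
  succ i _ hr := by
    have hnr : ∀ j c, w.edge c (i + 1) → c < j := fun j c he => absurd ⟨c, he⟩ hr
    simp only [semSnce_summary]
    constructor
    · rintro ⟨j, h⟩
      rcases h.1.eq_or_lt with rfl | hlt
      · exact Or.inl h.2.1
      · obtain ⟨h1, h2⟩ := (sumSnce_succ (hnr j) (Nat.lt_succ_iff.1 hlt)).1 h
        exact Or.inr ⟨h1, j, h2⟩
    · rintro (h | ⟨hx, j, h⟩)
      · exact ⟨_, sumSnce_self.2 h⟩
      · exact ⟨j, (sumSnce_succ (hnr j) h.1).2 ⟨hx, h⟩⟩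
  edge c i he := by
    have hci := w.edge_lt _ _ he
    simp only [semSnce_summary]
    constructor
    · rintro ⟨j, h⟩
      rcases h.1.eq_or_lt with rfl | hlt
      · exact Or.inl h.2.1
      rcases Nat.lt_or_ge c j with hcj | hcj
      · have hm : ¬ w.MatchedCall i := fun hm => by
          have := w.edge_left_unique _ _ _ he
            (edge_of_matchedCall_of_matchedRet_succ hm ⟨c, he⟩)
          omega
        obtain ⟨h1, h2⟩ := (sumSnce_succ (fun c' he' => by
          rwa [← w.edge_left_unique _ _ _ he he']) (Nat.lt_succ_iff.1 hlt)).1 h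
        exact Or.inr ⟨h1, Or.inr ⟨hm, j, h2,
          fun c' h' => (encloses_le_of_edge_succ he h').trans_lt hcj⟩⟩
      · obtain ⟨h1, h2⟩ := (sumSnce_edge he hcj).1 h
        exact Or.inr ⟨h1, Or.inl ⟨j, h2⟩⟩
    · rintro (h | ⟨hx, ⟨j, h⟩ | ⟨hm, j, h, hin⟩⟩)
      · exact ⟨_, sumSnce_self.2 h⟩
      · exact ⟨j, (sumSnce_edge he h.1).2 ⟨hx, h⟩⟩
      · have hne : c ≠ i := by
          rintro rfl
          exact hm ⟨_, he⟩
        have hcj := hin c ⟨by omega, _, he, by omega⟩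
        exact ⟨j, (sumSnce_succ (fun c' he' => by
          rwa [← w.edge_left_unique _ _ _ he he']) h.1).2 ⟨hx, h⟩⟩
  in_zero _ := by simp [SumSnceIn, SumSnce.zero_iff, not_encloses_zero]
  in_succ i _ hr := by
    have hnr : ∀ j c, w.edge c (i + 1) → c < j := fun j c he => absurd ⟨c, he⟩ hr
    constructor
    · rintro ⟨j, h, hin⟩
      simp only [encloses_succ hr] at hin
      rcases h.1.eq_or_lt with rfl | hlt
      · exact Or.inl h.2.1
      · obtain ⟨h1, h2⟩ := (sumSnce_succ (hnr j) (Nat.lt_succ_iff.1 hlt)).1 h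
        refine Or.inr ⟨h1, fun hm => ?_, j, h2, fun c hc => hin c (Or.inl hc)⟩
        have := hin i (Or.inr ⟨rfl, hm⟩)
        omega
    · rintro (h | ⟨hx, hm, j, h, hin⟩)
      · exact ⟨_, sumSnce_self.2 h, fun c hc => hc.1⟩
      · refine ⟨j, (sumSnce_succ (hnr j) h.1).2 ⟨hx, h⟩, fun c hc => hin c ?_⟩
        have := (encloses_succ hr).1 hc
        tauto
  in_edge c i he := by
    have hci := w.edge_lt _ _ he
    constructor
    · rintro ⟨j, h, hin⟩
      rcases h.1.eq_or_lt with rfl | hlt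
      · exact Or.inl h.2.1
      rcases Nat.lt_or_ge c j with hcj | hcj
      · have hm : ¬ w.MatchedCall i := fun hm => by
          have := w.edge_left_unique _ _ _ he
            (edge_of_matchedCall_of_matchedRet_succ hm ⟨c, he⟩)
          omega
        obtain ⟨h1, h2⟩ := (sumSnce_succ (fun c' he' => by
          rwa [← w.edge_left_unique _ _ _ he he']) (Nat.lt_succ_iff.1 hlt)).1 h
        exact Or.inr ⟨h1, Or.inr ⟨hm, j, h2,
          fun c' h' => (encloses_le_of_edge_succ he h').trans_lt hcj⟩⟩
      · obtain ⟨h1, h2⟩ := (sumSnce_edge he hcj).1 h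
        exact Or.inr ⟨h1, Or.inl ⟨j, h2, fun c' hc' => hin c' ((encloses_ret he).2 hc')⟩⟩
    · rintro (h | ⟨hx, ⟨j, h, hin⟩ | ⟨hm, j, h, hin⟩⟩)
      · exact ⟨_, sumSnce_self.2 h, fun c hc => hc.1⟩
      · exact ⟨j, (sumSnce_edge he h.1).2 ⟨hx, h⟩,
          fun c' hc' => hin c' ((encloses_ret he).1 hc')⟩
      · have hne : c ≠ i := by
          rintro rfl
          exact hm ⟨_, he⟩
        have hcj := hin c ⟨by omega, _, he, by omega⟩
        exact ⟨j, (sumSnce_succ (fun c' he' => by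
          rwa [← w.edge_left_unique _ _ _ he he']) h.1).2 ⟨hx, h⟩,
          fun c' hc' => ((encloses_ret he).1 hc').1.trans hcj⟩

theorem SummarySnceEqs.iff (h : SummarySnceEqs w x y z d) {i : ℕ} (hi : w.IsPos i) :
    z i ↔ SemSnce w .summary x y i := by
  have hs := summarySnceEqs_sem (w := w) (x := x) (y := y)
  have key : ∀ i, w.IsPos i →
      (z i ↔ SemSnce w .summary x y i) ∧ (d i ↔ SumSnceIn w x y i) := by
    intro i
    induction i using Nat.strong_induction_on with
    | _ i ih =>
      intro hi
      cases i with
      | zero => exact ⟨by rw [h.zero hi, hs.zero hi], by rw [h.in_zero hi, hs.in_zero hi]⟩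
      | succ i =>
        have hi' := hi.mono (Nat.le_succ i)
        obtain ⟨ih1, ih2⟩ := ih i (by omega) hi'
        by_cases hr : w.MatchedRet (i + 1)
        · obtain ⟨c, he⟩ := hr
          have hlt := w.edge_lt _ _ he
          obtain ⟨ih3, ih4⟩ := ih c hlt (hi.mono hlt.le)
          exact ⟨by rw [h.edge c i he, hs.edge c i he, ih3, ih2],
            by rw [h.in_edge c i he, hs.in_edge c i he, ih4, ih2]⟩
        · exact ⟨by rw [h.succ i hi hr, hs.succ i hi hr, ih1],
            by rw [h.in_succ i hi hr, hs.in_succ i hi hr, ih2]⟩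
  exact (key i hi).1

end NW

namespace NW

open NestedWord Filter

/-! ### Local conditions at one node of the syntax tree -/

/-- What the automaton guesses about one position and one node of the syntax tree. The first six
bits describe the position: it exists, is a call, is a return, is matched, lies inside a matched
pair, is the last one. `fair` marks positions that witness progress of an until, `z` is the truth
value of the node, and `d`, `e` are the auxiliary predicates of the expansion laws. -/
structure Core where
  ex : Bool
  call : Bool
  ret : Bool
  mat : Bool
  ins : Bool
  last : Bool
  fair : Bool
  z : Bool
  d : Bool
  e : Bool

/-- Marked as a matched call. -/
def Core.mc (g : Core) : Bool := g.call && g.mat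

/-- Marked as a matched return. -/
def Core.mr (g : Core) : Bool := g.ret && g.mat

/-- The guess for a node together with the guessed truth values `x`, `y` of its children. -/
structure View extends Core where
  x : Bool
  y : Bool

/-- The local conditions on the bits that describe positions. Here `c` belongs to the current
position, `p` to the previous one (`p.ex` is false if there is none) and `h` to the matching call
(relevant for returns; `h.ex` is false for pending ones). -/
def StructOK (isCall isRet : Bool) (p c h : Core) : Prop :=
  c.ex ∧ c.call = isCall ∧ c.ret = isRet ∧ (p.ex → ¬ p.last) ∧
  (isRet → (c.mat ↔ h.ex)) ∧ (isRet → h.ex → h.mat) ∧ (¬ isCall → ¬ isRet → ¬ c.mat) ∧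
  (c.mr → (c.ins ↔ h.ins)) ∧ (¬ c.mr → (c.ins ↔ p.ex ∧ (p.ins ∨ p.mc)))

/-- The local conditions on truth values at a node whose symbol has code `s`: the expansion laws of
the operator. `lb` is the truth value of the proposition in question; `p`, `c`, `h` are as in
`StructOK`. -/
def OpOK (s : ℕ) (lb : Bool) (p c h : View) : Prop :=
  match s with
  | 0 => c.fair ∧ c.z
  | 1 => c.fair ∧ (c.z ↔ c.call)
  | 2 => c.fair ∧ (c.z ↔ c.ret)
  | 3 => c.fair ∧ (c.z ↔ ¬ c.x)
  | 4 => c.fair ∧ (c.z ↔ c.x ∨ c.y)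
  | 5 => c.fair ∧ (p.ex → (p.z ↔ c.x)) ∧ (c.last → ¬ c.z)
  | 6 => c.fair ∧ (¬ c.mc → ¬ c.z) ∧ (c.mr → (h.z ↔ c.x))
  | 7 => c.fair ∧ (¬ p.ex → ¬ c.z) ∧ (p.ex → (c.z ↔ p.x))
  | 8 => c.fair ∧ (¬ c.mr → ¬ c.z) ∧ (c.mr → (c.z ↔ h.x))
  | 9 => (c.fair ↔ ¬ c.z ∨ c.y) ∧ (p.ex → (p.z ↔ p.y ∨ (p.x ∧ c.z))) ∧ (c.last → (c.z ↔ c.y))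
  | 10 => c.fair ∧ (p.ex → p.mc → (p.z ↔ p.y ∨ (p.x ∧ ¬ c.mr ∧ c.d))) ∧
      (¬ c.mc → (c.z ↔ c.y)) ∧
      (p.ex → p.ins → ¬ p.mc → (p.d ↔ p.z ∨ (¬ c.mr ∧ c.d))) ∧
      (c.mr → h.ins → (h.d ↔ h.z ∨ c.d))
  | 11 => (c.fair ↔ ¬ c.ins ∧ (¬ c.z ∨ c.y)) ∧
      (p.ex → ¬ p.call → (p.z ↔ p.y ∨ (p.x ∧ ¬ c.mr ∧ c.z))) ∧
      (c.mr → (h.z ↔ h.y ∨ (h.x ∧ c.z))) ∧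
      (c.call → ¬ c.mc → (c.z ↔ c.y)) ∧ (c.last → (c.z ↔ c.y))
  | 12 => (c.fair ↔ ¬ c.ins ∧ (¬ c.z ∨ c.y ∨ (c.x ∧ c.mc ∧ c.e))) ∧
      (p.ex → ¬ p.mc → (p.z ↔ p.y ∨ (p.x ∧ c.z))) ∧
      (c.last → (c.z ↔ c.y)) ∧
      (c.mr → (h.z ↔ h.y ∨ (h.x ∧ (c.z ∨ h.e)))) ∧
      (p.ex → p.mc → (p.e ↔ ¬ c.mr ∧ c.d)) ∧
      (p.ex → ¬ p.mc → (p.d ↔ p.y ∨ (p.x ∧ ¬ c.mr ∧ c.d))) ∧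
      (c.mr → (h.d ↔ h.y ∨ (h.x ∧ (c.d ∨ h.e))))
  | 13 => c.fair ∧ (¬ p.ex → (c.z ↔ c.y)) ∧ (p.ex → (c.z ↔ c.y ∨ (c.x ∧ p.z)))
  | 14 => c.fair ∧ (c.z ↔ c.y ∨ (c.x ∧ c.d)) ∧ (¬ p.ex → ¬ c.d) ∧
      (c.mr → (c.d ↔ h.d)) ∧
      (p.ex → ¬ c.mr → p.mc → (c.d ↔ p.z)) ∧ (p.ex → ¬ c.mr → ¬ p.mc → (c.d ↔ p.d))
  | 15 => c.fair ∧ (¬ p.ex → (c.z ↔ c.y)) ∧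
      (p.ex → ¬ c.mr → (c.z ↔ c.y ∨ (c.x ∧ ¬ p.call ∧ p.z))) ∧
      (c.mr → (c.z ↔ c.y ∨ (c.x ∧ h.z)))
  | 16 => c.fair ∧ (¬ p.ex → (c.z ↔ c.y)) ∧
      (p.ex → ¬ c.mr → (c.z ↔ c.y ∨ (c.x ∧ p.z))) ∧
      (p.ex → c.mr → (c.z ↔ c.y ∨ (c.x ∧ (h.z ∨ (¬ p.mc ∧ p.d))))) ∧
      (¬ p.ex → (c.d ↔ c.y)) ∧
      (p.ex → ¬ c.mr → (c.d ↔ c.y ∨ (c.x ∧ ¬ p.mc ∧ p.d))) ∧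
      (p.ex → c.mr → (c.d ↔ c.y ∨ (c.x ∧ (h.d ∨ (¬ p.mc ∧ p.d)))))
  | _ => c.fair ∧ (c.z ↔ lb)

variable {A : Type} {w : NestedWord A}

/-- The meaning of the operator with code `s`, for predicates `x`, `y` in place of its arguments and
`lb` in place of a proposition. -/
def SemOp (w : NestedWord A) (s : ℕ) (lb x y : ℕ → Prop) (i : ℕ) : Prop :=
  match s with
  | 0 => True
  | 1 => w.call i
  | 2 => w.ret i
  | 3 => ¬ x i
  | 4 => x i ∨ y i
  | 5 => w.IsPos (i + 1) ∧ x (i + 1)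
  | 6 => ∃ j, w.edge i j ∧ x j
  | 7 => ∃ j, j + 1 = i ∧ x j
  | 8 => ∃ j, w.edge j i ∧ x j
  | 9 => SemUntl w .linear x y i
  | 10 => SemUntl w .call x y i
  | 11 => SemUntl w .abstr x y i
  | 12 => SemUntl w .summary x y i
  | 13 => SemSnce w .linear x y i
  | 14 => SemSnce w .call x y i
  | 15 => SemSnce w .abstr x y i
  | 16 => SemSnce w .summary x y i
  | _ => lb i

/-- A sequence of views whose descriptions of positions are correct. Index `0` stands for the time
before the first position, `i + 1` for position `i`; `H i` is the view at the call that matches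
`i`. -/
structure StructCorrect (w : NestedWord A) (V H : ℕ → View) : Prop where
  start : (V 0).ex = false
  edge : ∀ c i, w.edge c i → H i = V (c + 1)
  ex : ∀ i, w.IsPos i → (V (i + 1)).ex = true
  call : ∀ i, w.IsPos i → ((V (i + 1)).call = true ↔ w.call i)
  ret : ∀ i, w.IsPos i → ((V (i + 1)).ret = true ↔ w.ret i)
  mc : ∀ i, w.IsPos i → ((V (i + 1)).mc = true ↔ w.MatchedCall i)
  mr : ∀ i, w.IsPos i → ((V (i + 1)).mr = true ↔ w.MatchedRet i)
  ins : ∀ i, w.IsPos i → ((V (i + 1)).ins = true ↔ w.Inside i)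
  last : ∀ i, w.IsPos i → ((V (i + 1)).last = true ↔ ¬ w.IsPos (i + 1))

section Laws

variable {V H : ℕ → View} {lb : ℕ → Bool}

/-- Local conditions that relate a position to the next one. -/
theorem StructCorrect.forall_prev (S : StructCorrect w V H) {R : ℕ → Prop} :
    (∀ i, w.IsPos i → (V i).ex = true → R i) ↔ ∀ i, w.IsPos (i + 1) → R (i + 1) := by
  constructor
  · exact fun h i hi => h (i + 1) hi (S.ex i (hi.mono (Nat.le_succ i)))
  · rintro h (_ | i) hi hex
    · simp [S.start] at hex
    · exact h i hi

/-- Local conditions at the first position. -/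
theorem StructCorrect.forall_first (S : StructCorrect w V H) {R : ℕ → Prop} :
    (∀ i, w.IsPos i → ¬ (V i).ex = true → R i) ↔ (w.IsPos 0 → R 0) := by
  constructor
  · exact fun h hi => h 0 hi (by simp [S.start])
  · rintro h (_ | i) hi hex
    · exact h hi
    · exact absurd (S.ex i (hi.mono (Nat.le_succ i))) hex

/-- Local conditions along the matching relation. -/
theorem StructCorrect.forall_mr (S : StructCorrect w V H) {R : View → ℕ → Prop} :
    (∀ i, w.IsPos i → (V (i + 1)).mr = true → R (H i) i) ↔
      ∀ c r, w.edge c r → R (V (c + 1)) r := by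
  constructor
  · intro h c r he
    rw [← S.edge _ _ he]
    exact h r (isPos_of_edge he) ((S.mr r (isPos_of_edge he)).2 ⟨c, he⟩)
  · intro h i hi hr
    obtain ⟨c, he⟩ := (S.mr i hi).1 hr
    rw [S.edge _ _ he]
    exact h c i he

theorem forall_pos_and {P Q : ℕ → Prop} :
    (∀ i, w.IsPos i → P i ∧ Q i) ↔ (∀ i, w.IsPos i → P i) ∧ ∀ i, w.IsPos i → Q i :=
  ⟨fun h => ⟨fun i hi => (h i hi).1, fun i hi => (h i hi).2⟩, fun h i hi => ⟨h.1 i hi, h.2 i hi⟩⟩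

/-- Every condition `OpOK` holds along a sequence of views. -/
def OpCorrect (w : NestedWord A) (s : ℕ) (lb : ℕ → Bool) (V H : ℕ → View) : Prop :=
  ∀ i, w.IsPos i → OpOK s (lb i) (V i) (V (i + 1)) (H i)

theorem opCorrect_linearUntl (S : StructCorrect w V H) : OpCorrect w 9 lb V H ↔
    (∀ i, w.IsPos i → ((V (i + 1)).fair = true ↔ ¬ (V (i + 1)).z = true ∨ (V (i + 1)).y = true)) ∧
    LinearUntlEqs w (fun i => (V (i + 1)).x = true) (fun i => (V (i + 1)).y = true)
      (fun i => (V (i + 1)).z = true) := by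
  simp only [OpCorrect, OpOK, forall_pos_and, S.forall_prev]
  refine and_congr Iff.rfl ⟨fun h => ⟨h.1, fun i hi hl => h.2 i hi ((S.last i hi).2 hl)⟩,
    fun h => ⟨h.succ, fun i hi hl => h.last i hi ((S.last i hi).1 hl)⟩⟩

theorem opCorrect_callUntl (S : StructCorrect w V H) : OpCorrect w 10 lb V H ↔
    (∀ i, w.IsPos i → (V (i + 1)).fair = true) ∧
    CallUntlEqs w (fun i => (V (i + 1)).x = true) (fun i => (V (i + 1)).y = true)
      (fun i => (V (i + 1)).z = true) (fun i => (V (i + 1)).d = true) := by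
  simp only [OpCorrect, OpOK, forall_pos_and, S.forall_prev,
    S.forall_mr (R := fun v i => v.ins = true → (v.d = true ↔ v.z = true ∨ (V (i + 1)).d = true))]
  refine and_congr Iff.rfl ⟨fun ⟨h1, h2, h3, h4⟩ => ⟨?_, ?_, ?_, ?_⟩,
    fun ⟨h1, h2, h3, h4⟩ => ⟨?_, ?_, ?_, ?_⟩⟩
  · intro i hi hm
    have hi' := hi.mono (Nat.le_succ i)
    rw [← S.mr _ hi]
    exact h1 i hi ((S.mc i hi').2 hm)
  · exact fun i hi hm => h2 i hi (mt (S.mc i hi).1 hm)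
  · intro i hi hn hm
    have hi' := hi.mono (Nat.le_succ i)
    rw [← S.mr _ hi]
    exact h3 i hi ((S.ins i hi').2 hn) (mt (S.mc i hi').1 hm)
  · intro c r he hn
    exact h4 c r he ((S.ins c ((isPos_of_edge he).mono (w.edge_lt _ _ he).le)).2 hn)
  · intro i hi hm
    have hi' := hi.mono (Nat.le_succ i)
    rw [S.mr _ hi]
    exact h1 i hi ((S.mc i hi').1 hm)
  · exact fun i hi hm => h2 i hi (mt (S.mc i hi).2 hm)
  · intro i hi hn hm
    have hi' := hi.mono (Nat.le_succ i)
    rw [S.mr _ hi]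
    exact h3 i hi ((S.ins i hi').1 hn) (mt (S.mc i hi').2 hm)
  · intro c r he hn
    exact h4 c r he ((S.ins c ((isPos_of_edge he).mono (w.edge_lt _ _ he).le)).1 hn)

theorem opCorrect_abstrUntl (S : StructCorrect w V H) : OpCorrect w 11 lb V H ↔
    (∀ i, w.IsPos i → ((V (i + 1)).fair = true ↔ ¬ w.Inside i ∧
      (¬ (V (i + 1)).z = true ∨ (V (i + 1)).y = true))) ∧
    AbstrUntlEqs w (fun i => (V (i + 1)).x = true) (fun i => (V (i + 1)).y = true)
      (fun i => (V (i + 1)).z = true) := by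
  simp only [OpCorrect, OpOK, forall_pos_and, S.forall_prev, S.forall_mr
    (R := fun v i => (v.z = true ↔ v.y = true ∨ (v.x = true ∧ (V (i + 1)).z = true)))]
  refine and_congr ?_ ⟨fun ⟨h1, h2, h3, h4⟩ => ⟨?_, h2, ?_, ?_⟩,
    fun ⟨h1, h2, h3, h4⟩ => ⟨?_, h2, ?_, ?_⟩⟩
  · refine forall₂_congr fun i hi => ?_
    rw [S.ins i hi]
  · intro i hi hc
    have hi' := hi.mono (Nat.le_succ i)
    rw [← S.mr _ hi]
    exact h1 i hi (mt (S.call i hi').1 hc)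
  · intro i hc hm
    have hi := w.call_lt i hc
    exact h3 i hi ((S.call i hi).2 hc) (mt (S.mc i hi).1 hm)
  · exact fun i hi hl => h4 i hi ((S.last i hi).2 hl)
  · intro i hi hc
    have hi' := hi.mono (Nat.le_succ i)
    rw [S.mr _ hi]
    exact h1 i hi (mt (S.call i hi').2 hc)
  · intro i hi hc hm
    exact h3 i ((S.call i hi).1 hc) (mt (S.mc i hi).2 hm)
  · exact fun i hi hl => h4 i hi ((S.last i hi).1 hl)

theorem opCorrect_summaryUntl (S : StructCorrect w V H) : OpCorrect w 12 lb V H ↔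
    (∀ i, w.IsPos i → ((V (i + 1)).fair = true ↔ ¬ w.Inside i ∧
      (¬ (V (i + 1)).z = true ∨ (V (i + 1)).y = true ∨
        ((V (i + 1)).x = true ∧ w.MatchedCall i ∧ (V (i + 1)).e = true)))) ∧
    SummaryUntlEqs w (fun i => (V (i + 1)).x = true) (fun i => (V (i + 1)).y = true)
      (fun i => (V (i + 1)).z = true) (fun i => (V (i + 1)).d = true)
      (fun i => (V (i + 1)).e = true) := by
  simp only [OpCorrect, OpOK, forall_pos_and, S.forall_prev,
    S.forall_mr (R := fun v i =>
      (v.z = true ↔ v.y = true ∨ (v.x = true ∧ ((V (i + 1)).z = true ∨ v.e = true)))),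
    S.forall_mr (R := fun v i =>
      (v.d = true ↔ v.y = true ∨ (v.x = true ∧ ((V (i + 1)).d = true ∨ v.e = true))))]
  refine and_congr ?_ ⟨fun ⟨h1, h2, h3, h4, h5, h6⟩ => ⟨?_, ?_, h3, ?_, ?_, h6⟩,
    fun ⟨h1, h2, h3, h4, h5, h6⟩ => ⟨?_, ?_, h3, ?_, ?_, h6⟩⟩
  · refine forall₂_congr fun i hi => ?_
    rw [S.ins i hi, S.mc i hi]
  · exact fun i hi hm => h1 i hi (mt (S.mc i (hi.mono (Nat.le_succ i))).1 hm)
  · exact fun i hi hl => h2 i hi ((S.last i hi).2 hl)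
  · intro i hi hm
    rw [← S.mr _ hi]
    exact h4 i hi ((S.mc i (hi.mono (Nat.le_succ i))).2 hm)
  · intro i hi hm
    rw [← S.mr _ hi]
    exact h5 i hi (mt (S.mc i (hi.mono (Nat.le_succ i))).1 hm)
  · exact fun i hi hm => h1 i hi (mt (S.mc i (hi.mono (Nat.le_succ i))).2 hm)
  · exact fun i hi hl => h2 i hi ((S.last i hi).1 hl)
  · intro i hi hm
    rw [S.mr _ hi]
    exact h4 i hi ((S.mc i (hi.mono (Nat.le_succ i))).1 hm)
  · intro i hi hm
    rw [S.mr _ hi]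
    exact h5 i hi (mt (S.mc i (hi.mono (Nat.le_succ i))).2 hm)

theorem opCorrect_linearSnce (S : StructCorrect w V H) : OpCorrect w 13 lb V H ↔
    (∀ i, w.IsPos i → (V (i + 1)).fair = true) ∧
    LinearSnceEqs w (fun i => (V (i + 1)).x = true) (fun i => (V (i + 1)).y = true)
      (fun i => (V (i + 1)).z = true) := by
  simp only [OpCorrect, OpOK, forall_pos_and, S.forall_prev, S.forall_first]
  exact and_congr Iff.rfl ⟨fun h => ⟨h.1, h.2⟩, fun h => ⟨h.1, h.2⟩⟩

theorem opCorrect_callSnce (S : StructCorrect w V H) : OpCorrect w 14 lb V H ↔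
    (∀ i, w.IsPos i → (V (i + 1)).fair = true) ∧
    CallSnceEqs w (fun i => (V (i + 1)).x = true) (fun i => (V (i + 1)).y = true)
      (fun i => (V (i + 1)).z = true) (fun i => (V (i + 1)).d = true) := by
  simp only [OpCorrect, OpOK, forall_pos_and, S.forall_prev, S.forall_first,
    S.forall_mr (R := fun v i => ((V (i + 1)).d = true ↔ v.d = true))]
  refine and_congr Iff.rfl ⟨fun ⟨h1, h2, h3, h4, h5⟩ => ⟨h1, h2, h3, ?_, ?_⟩,
    fun ⟨h1, h2, h3, h4, h5⟩ => ⟨h1, h2, h3, ?_, ?_⟩⟩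
  · exact fun i hi hr hm => h4 i hi (mt (S.mr _ hi).1 hr)
      ((S.mc i (hi.mono (Nat.le_succ i))).2 hm)
  · exact fun i hi hr hm => h5 i hi (mt (S.mr _ hi).1 hr)
      (mt (S.mc i (hi.mono (Nat.le_succ i))).1 hm)
  · exact fun i hi hr hm => h4 i hi (mt (S.mr _ hi).2 hr)
      ((S.mc i (hi.mono (Nat.le_succ i))).1 hm)
  · exact fun i hi hr hm => h5 i hi (mt (S.mr _ hi).2 hr)
      (mt (S.mc i (hi.mono (Nat.le_succ i))).2 hm)

theorem opCorrect_abstrSnce (S : StructCorrect w V H) : OpCorrect w 15 lb V H ↔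
    (∀ i, w.IsPos i → (V (i + 1)).fair = true) ∧
    AbstrSnceEqs w (fun i => (V (i + 1)).x = true) (fun i => (V (i + 1)).y = true)
      (fun i => (V (i + 1)).z = true) := by
  simp only [OpCorrect, OpOK, forall_pos_and, S.forall_prev, S.forall_first, S.forall_mr
    (R := fun v i => ((V (i + 1)).z = true ↔
      (V (i + 1)).y = true ∨ ((V (i + 1)).x = true ∧ v.z = true)))]
  refine and_congr Iff.rfl ⟨fun ⟨h1, h2, h3⟩ => ⟨h1, ?_, h3⟩, fun ⟨h1, h2, h3⟩ => ⟨h1, ?_, h3⟩⟩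
  · intro i hi hr
    rw [← S.call _ (hi.mono (Nat.le_succ i))]
    exact h2 i hi (mt (S.mr _ hi).1 hr)
  · intro i hi hr
    rw [S.call _ (hi.mono (Nat.le_succ i))]
    exact h2 i hi (mt (S.mr _ hi).2 hr)

theorem opCorrect_summarySnce (S : StructCorrect w V H) : OpCorrect w 16 lb V H ↔
    (∀ i, w.IsPos i → (V (i + 1)).fair = true) ∧
    SummarySnceEqs w (fun i => (V (i + 1)).x = true) (fun i => (V (i + 1)).y = true)
      (fun i => (V (i + 1)).z = true) (fun i => (V (i + 1)).d = true) := by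
  simp only [OpCorrect, OpOK, forall_pos_and, S.forall_prev, S.forall_first]
  refine and_congr Iff.rfl ⟨fun ⟨h1, h2, h3, h4, h5, h6⟩ => ⟨h1, ?_, ?_, h4, ?_, ?_⟩,
    fun ⟨h1, h2, h3, h4, h5, h6⟩ => ⟨h1, ?_, ?_, h4, ?_, ?_⟩⟩
  · exact fun i hi hr => h2 i hi (mt (S.mr _ hi).1 hr)
  · intro c i he
    have hi := isPos_of_edge he
    rw [← S.mc _ (hi.mono (Nat.le_succ i)), ← S.edge _ _ he]
    exact h3 i hi ((S.mr _ hi).2 ⟨c, he⟩)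
  · intro i hi hr
    rw [← S.mc _ (hi.mono (Nat.le_succ i))]
    exact h5 i hi (mt (S.mr _ hi).1 hr)
  · intro c i he
    have hi := isPos_of_edge he
    rw [← S.mc _ (hi.mono (Nat.le_succ i)), ← S.edge _ _ he]
    exact h6 i hi ((S.mr _ hi).2 ⟨c, he⟩)
  · exact fun i hi hr => h2 i hi (mt (S.mr _ hi).2 hr)
  · intro i hi hr
    obtain ⟨c, he⟩ := (S.mr _ hi).1 hr
    rw [S.mc _ (hi.mono (Nat.le_succ i)), S.edge _ _ he]
    exact h3 c i he
  · intro i hi hr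
    rw [S.mc _ (hi.mono (Nat.le_succ i))]
    exact h5 i hi (mt (S.mr _ hi).2 hr)
  · intro i hi hr
    obtain ⟨c, he⟩ := (S.mr _ hi).1 hr
    rw [S.mc _ (hi.mono (Nat.le_succ i)), S.edge _ _ he]
    exact h6 c i he

end Laws

end NW

namespace NW

open NestedWord Filter

variable {A : Type} {w : NestedWord A}

/-! ### Correctness of the local conditions at one node -/

theorem opOK_of_ge {s : ℕ} (hs : 17 ≤ s) (lb : Bool) (p c h : View) :
    OpOK s lb p c h ↔ c.fair = true ∧ (c.z = true ↔ lb = true) := by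
  obtain ⟨t, rfl⟩ := Nat.exists_eq_add_of_le' hs
  rfl

theorem semOp_of_ge {s : ℕ} (hs : 17 ≤ s) (lb x y : ℕ → Prop) (i : ℕ) :
    SemOp w s lb x y i ↔ lb i := by
  obtain ⟨t, rfl⟩ := Nat.exists_eq_add_of_le' hs
  rfl

theorem SemUntl.mono {κ : PathKind} {x x' y y' : ℕ → Prop} {i : ℕ}
    (hx : ∀ i, w.IsPos i → x i → x' i) (hy : ∀ i, w.IsPos i → y i → y' i)
    (h : SemUntl w κ x y i) : SemUntl w κ x' y' i := by
  obtain ⟨j, k, s, hj, hij, hp, h1, h2⟩ := h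
  refine ⟨j, k, s, hj, hij, hp, hy j hj h1, fun p hpk => hx _ (hj.mono ?_) (h2 p hpk)⟩
  rw [← hp.2.1]
  exact (hp.lt_of_lt hpk le_rfl).le

theorem SemSnce.mono {κ : PathKind} {x x' y y' : ℕ → Prop} {i : ℕ} (hi : w.IsPos i)
    (hx : ∀ i, w.IsPos i → x i → x' i) (hy : ∀ i, w.IsPos i → y i → y' i)
    (h : SemSnce w κ x y i) : SemSnce w κ x' y' i := by
  obtain ⟨j, k, s, hij, hp, h1, h2⟩ := h
  refine ⟨j, k, s, hij, hp, hy j (hi.mono hij) h1,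
    fun p h0 hpk => hx _ (hi.mono ?_) (h2 p h0 hpk)⟩
  rcases hpk.eq_or_lt with rfl | hpk
  · exact hp.2.1.le
  · have := (hp.lt_of_lt hpk le_rfl).le
    rwa [hp.2.1] at this

theorem semUntl_congr {κ : PathKind} {x x' y y' : ℕ → Prop} {i : ℕ}
    (hx : ∀ i, w.IsPos i → (x i ↔ x' i)) (hy : ∀ i, w.IsPos i → (y i ↔ y' i)) :
    SemUntl w κ x y i ↔ SemUntl w κ x' y' i :=
  ⟨SemUntl.mono (fun i hi => (hx i hi).1) (fun i hi => (hy i hi).1),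
    SemUntl.mono (fun i hi => (hx i hi).2) (fun i hi => (hy i hi).2)⟩

theorem semSnce_congr {κ : PathKind} {x x' y y' : ℕ → Prop} {i : ℕ} (hi : w.IsPos i)
    (hx : ∀ i, w.IsPos i → (x i ↔ x' i)) (hy : ∀ i, w.IsPos i → (y i ↔ y' i)) :
    SemSnce w κ x y i ↔ SemSnce w κ x' y' i :=
  ⟨SemSnce.mono hi (fun i hi => (hx i hi).1) (fun i hi => (hy i hi).1),
    SemSnce.mono hi (fun i hi => (hx i hi).2) (fun i hi => (hy i hi).2)⟩

/-- Only the values of the arguments at positions matter. -/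
theorem semOp_congr {s : ℕ} {lb x x' y y' : ℕ → Prop} {i : ℕ} (hi : w.IsPos i)
    (hx : ∀ i, w.IsPos i → (x i ↔ x' i)) (hy : ∀ i, w.IsPos i → (y i ↔ y' i)) :
    SemOp w s lb x y i ↔ SemOp w s lb x' y' i := by
  rcases Nat.lt_or_ge s 17 with hs | hs
  · interval_cases s
    · exact Iff.rfl
    · exact Iff.rfl
    · exact Iff.rfl
    · exact not_congr (hx i hi)
    · exact or_congr (hx i hi) (hy i hi)
    · exact and_congr_right fun h => hx _ h
    · exact exists_congr fun j => and_congr_right fun h => hx _ (isPos_of_edge h)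
    · exact exists_congr fun j => and_congr_right fun h => hx _ (hi.mono (by omega))
    · exact exists_congr fun j => and_congr_right fun h => hx _ (hi.mono (w.edge_lt _ _ h).le)
    all_goals first | exact semUntl_congr hx hy | exact semSnce_congr hi hx hy
  · rw [semOp_of_ge hs, semOp_of_ge hs]

section

variable {V H : ℕ → View} {lb : ℕ → Bool} {s : ℕ}

/-- If the local conditions hold everywhere and progress recurs, then the guessed truth values are
the actual ones. -/
theorem OpCorrect.z_iff (S : StructCorrect w V H) (h : OpCorrect w s lb V H)
    (hF : (∀ i, w.IsPos i) → ∃ᶠ i in atTop, (V (i + 1)).fair = true) {i : ℕ} (hi : w.IsPos i) :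
    (V (i + 1)).z = true ↔ SemOp w s (fun i => lb i = true) (fun i => (V (i + 1)).x = true)
      (fun i => (V (i + 1)).y = true) i := by
  rcases Nat.lt_or_ge s 17 with hs | hs
  · interval_cases s
    · exact iff_of_true (h i hi).2 trivial
    · exact (h i hi).2.trans (S.call i hi)
    · exact (h i hi).2.trans (S.ret i hi)
    · exact (h i hi).2
    · exact (h i hi).2
    · by_cases hl : w.IsPos (i + 1)
      · exact ((h (i + 1) hl).2.1 (S.ex i hi)).trans (by simp [SemOp, hl])
      · exact iff_of_false ((h i hi).2.2 ((S.last i hi).2 hl)) fun h => hl h.1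
    · by_cases hm : w.MatchedCall i
      · obtain ⟨r, he⟩ := hm
        have hr := isPos_of_edge he
        have := (h r hr).2.2 ((S.mr r hr).2 ⟨i, he⟩)
        rw [S.edge _ _ he] at this
        refine this.trans ⟨fun hx => ⟨r, he, hx⟩, ?_⟩
        rintro ⟨r', he', hx⟩
        rwa [w.edge_right_unique _ _ _ he he']
      · exact iff_of_false ((h i hi).2.1 (mt (S.mc i hi).1 hm)) fun ⟨r, he, _⟩ => hm ⟨r, he⟩
    · cases i with
      | zero =>
        refine iff_of_false ((h 0 hi).2.1 (by simp [S.start])) ?_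
        rintro ⟨j, hj, -⟩
        omega
      | succ i =>
        refine ((h (i + 1) hi).2.2 (S.ex i (hi.mono (Nat.le_succ i)))).trans
          ⟨fun hx => ⟨i, rfl, hx⟩, ?_⟩
        rintro ⟨j, hj, hx⟩
        rwa [Nat.succ.inj hj] at hx
    · by_cases hm : w.MatchedRet i
      · obtain ⟨c, he⟩ := hm
        have := (h i hi).2.2 ((S.mr i hi).2 ⟨c, he⟩)
        rw [S.edge _ _ he] at this
        refine this.trans ⟨fun hx => ⟨c, he, hx⟩, ?_⟩
        rintro ⟨c', he', hx⟩
        rwa [w.edge_left_unique _ _ _ he he']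
      · exact iff_of_false ((h i hi).2.1 (mt (S.mr i hi).1 hm)) fun ⟨r, he, _⟩ => hm ⟨r, he⟩
    · obtain ⟨h1, h2⟩ := (opCorrect_linearUntl S).1 h
      exact h2.iff (fun hw => (hF hw).mono fun i => (h1 i (hw i)).1) hi
    · exact ((opCorrect_callUntl S).1 h).2.iff hi
    · obtain ⟨h1, h2⟩ := (opCorrect_abstrUntl S).1 h
      exact h2.iff (fun hw => (hF hw).mono fun i => (h1 i (hw i)).1) hi
    · obtain ⟨h1, h2⟩ := (opCorrect_summaryUntl S).1 h
      exact h2.iff (fun hw => (hF hw).mono fun i => (h1 i (hw i)).1) hi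
    · exact ((opCorrect_linearSnce S).1 h).2.iff hi
    · exact ((opCorrect_callSnce S).1 h).2.iff hi
    · exact ((opCorrect_abstrSnce S).1 h).2.iff hi
    · exact ((opCorrect_summarySnce S).1 h).2.iff hi
  · rw [semOp_of_ge hs]
    exact ((opOK_of_ge hs _ _ _ _).1 (h i hi)).2

end

/-- The truth values and progress marks in `V` are the given predicates. -/
structure HasValues (V : ℕ → View) (x y z d e F : ℕ → Prop) : Prop where
  x : (fun i => (V (i + 1)).x = true) = x
  y : (fun i => (V (i + 1)).y = true) = y
  z : (fun i => (V (i + 1)).z = true) = z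
  d : (fun i => (V (i + 1)).d = true) = d
  e : (fun i => (V (i + 1)).e = true) = e
  fair : (fun i => (V (i + 1)).fair = true) = F

/-- The actual truth values can be completed by auxiliary predicates and progress marks so that the
local conditions hold and progress recurs. -/
theorem exists_values (w : NestedWord A) (s : ℕ) (lb : ℕ → Bool) (x y : ℕ → Prop) :
    ∃ d e F : ℕ → Prop, ((∀ i, w.IsPos i) → ∃ᶠ i in atTop, F i) ∧
      ∀ V H, StructCorrect w V H →
        HasValues V x y (SemOp w s (fun i => lb i = true) x y) d e F → OpCorrect w s lb V H := by
  have hT : (∀ i, w.IsPos i) → ∃ᶠ _ in (atTop : Filter ℕ), True :=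
    fun _ => frequently_atTop.2 fun N => ⟨N, le_rfl, trivial⟩
  rcases Nat.lt_or_ge s 17 with hs | hs
  · rcases Nat.lt_or_ge s 9 with hs9 | hs9
    · refine ⟨fun _ => True, fun _ => True, fun _ => True, hT, ?_⟩
      rintro V H S ⟨hx, hy, hz, -, -, hF⟩ i hi
      replace hx := fun i => congr_fun hx i
      replace hy := fun i => congr_fun hy i
      replace hz := fun i => congr_fun hz i
      have hF : (V (i + 1)).fair = true := by simpa using congr_fun hF i
      have hp : ∀ j, j + 1 = i → (V i).ex = true := by
        rintro j rfl
        exact S.ex j (hi.mono (Nat.le_succ j))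
      interval_cases s
      · exact ⟨hF, by simpa [SemOp] using hz i⟩
      · exact ⟨hF, by rw [S.call i hi]; simpa [SemOp] using hz i⟩
      · exact ⟨hF, by rw [S.ret i hi]; simpa [SemOp] using hz i⟩
      · refine ⟨hF, ?_⟩
        simp only [SemOp] at hz hx
        rw [hz, hx]
      · refine ⟨hF, ?_⟩
        simp only [SemOp] at hz hx hy
        rw [hz, hx, hy]
      · simp only [SemOp] at hz hx
        refine ⟨hF, ?_, ?_⟩
        · cases i with
          | zero => simp [S.start]
          | succ i => simp [hz, hx, hi]
        · rw [S.last i hi, hz]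
          tauto
      · simp only [SemOp] at hz hx
        refine ⟨hF, ?_, ?_⟩
        · rw [S.mc i hi, hz]
          exact fun hm ⟨j, he, _⟩ => hm ⟨j, he⟩
        · rw [S.mr i hi]
          rintro ⟨c, he⟩
          rw [S.edge _ _ he, hz, hx]
          refine ⟨?_, fun h => ⟨i, he, h⟩⟩
          rintro ⟨j, he', h⟩
          rwa [w.edge_right_unique _ _ _ he he']
      · simp only [SemOp] at hz hx
        refine ⟨hF, ?_, ?_⟩
        · rw [hz]
          exact fun hex ⟨j, hj, _⟩ => hex (hp j hj)
        · cases i with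
          | zero => simp [S.start]
          | succ i => simp [hz, hx]
      · simp only [SemOp] at hz hx
        refine ⟨hF, ?_, ?_⟩
        · rw [S.mr i hi, hz]
          exact fun hm ⟨j, he, _⟩ => hm ⟨j, he⟩
        · rw [S.mr i hi]
          rintro ⟨c, he⟩
          rw [S.edge _ _ he, hz, hx]
          refine ⟨?_, fun h => ⟨c, he, h⟩⟩
          rintro ⟨j, he', h⟩
          rwa [w.edge_left_unique _ _ _ he he']
    · interval_cases s
      · refine ⟨fun _ => True, fun _ => True, _,
          fun _ => linearUntl_frequently (w := w) (x := x) (y := y), ?_⟩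
        rintro V H S ⟨hx, hy, hz, -, -, hF⟩
        rw [opCorrect_linearUntl S, hx, hy, hz]
        refine ⟨fun i _ => ?_, linearUntlEqs_sem⟩
        rw [congr_fun hF i, congr_fun hy i, congr_fun hz i]
        rfl
      · refine ⟨LaterInCall w (SemUntl w .call x y), fun _ => True, fun _ => True, hT, ?_⟩
        rintro V H S ⟨hx, hy, hz, hd, -, hF⟩
        rw [opCorrect_callUntl S, hx, hy, hz, hd]
        exact ⟨fun i _ => by simpa using congr_fun hF i, callUntlEqs_sem⟩
      · refine ⟨fun _ => True, fun _ => True, _,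
          fun _ => abstrUntl_frequently (w := w) (x := x) (y := y), ?_⟩
        rintro V H S ⟨hx, hy, hz, -, -, hF⟩
        rw [opCorrect_abstrUntl S, hx, hy, hz]
        refine ⟨fun i _ => ?_, abstrUntlEqs_sem⟩
        rw [congr_fun hF i, congr_fun hy i, congr_fun hz i]
        rfl
      · refine ⟨SumUntlIn w x y, SumUntlEnter w x y, _,
          summaryUntl_frequently (w := w) (x := x) (y := y), ?_⟩
        rintro V H S ⟨hx, hy, hz, hd, he, hF⟩
        rw [opCorrect_summaryUntl S, hx, hy, hz, hd, he]
        refine ⟨fun i _ => ?_, summaryUntlEqs_sem⟩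
        rw [congr_fun hF i, congr_fun hx i, congr_fun hy i, congr_fun hz i, congr_fun he i]
        rfl
      · refine ⟨fun _ => True, fun _ => True, fun _ => True, hT, ?_⟩
        rintro V H S ⟨hx, hy, hz, -, -, hF⟩
        rw [opCorrect_linearSnce S, hx, hy, hz]
        exact ⟨fun i _ => by simpa using congr_fun hF i, linearSnceEqs_sem⟩
      · refine ⟨fun i => ∃ c, w.InnermostCall c i ∧ SemSnce w .call x y c, fun _ => True,
          fun _ => True, hT, ?_⟩
        rintro V H S ⟨hx, hy, hz, hd, -, hF⟩
        rw [opCorrect_callSnce S, hx, hy, hz, hd]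
        exact ⟨fun i _ => by simpa using congr_fun hF i, callSnceEqs_sem⟩
      · refine ⟨fun _ => True, fun _ => True, fun _ => True, hT, ?_⟩
        rintro V H S ⟨hx, hy, hz, -, -, hF⟩
        rw [opCorrect_abstrSnce S, hx, hy, hz]
        exact ⟨fun i _ => by simpa using congr_fun hF i, abstrSnceEqs_sem⟩
      · refine ⟨SumSnceIn w x y, fun _ => True, fun _ => True, hT, ?_⟩
        rintro V H S ⟨hx, hy, hz, hd, -, hF⟩
        rw [opCorrect_summarySnce S, hx, hy, hz, hd]
        exact ⟨fun i _ => by simpa using congr_fun hF i, summarySnceEqs_sem⟩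
  · refine ⟨fun _ => True, fun _ => True, fun _ => True, hT, ?_⟩
    rintro V H S ⟨hx, hy, hz, -, -, hF⟩ i hi
    rw [opOK_of_ge hs]
    refine ⟨by simpa using congr_fun hF i, ?_⟩
    rw [congr_fun hz i, semOp_of_ge hs]

end NW

namespace NW

open NestedWord Filter

variable {A : Type} {w : NestedWord A}

/-! ### Correctness of the guessed descriptions of positions -/

/-- The local conditions on descriptions of positions hold along a word, and so do the acceptance
conditions on pending calls, pending returns and the last position. Indices are as in
`StructCorrect`. -/
structure StructRun (w : NestedWord A) (g h : ℕ → Core) : Prop where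
  start : (g 0).ex = false
  pendRet : ∀ i, w.ret i → ¬ w.MatchedRet i → (h i).ex = false
  pendCall : ∀ i, w.call i → ¬ w.MatchedCall i → (g (i + 1)).mat = false
  last : ∀ i, w.IsPos i → ¬ w.IsPos (i + 1) → (g (i + 1)).last = true
  ok : ∀ i, w.IsPos i → ∀ kc kr : Bool, (kc = true ↔ w.call i) → (kr = true ↔ w.ret i) →
    StructOK kc kr (g i) (g (i + 1)) (h i)

/-- A return is marked as matched exactly if its symbol has `ex`, which the symbols of calls have
and those of pending returns lack. A call is marked as matched by its return or unmarked by the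
acceptance condition, and `ins` follows by induction from left to right. -/
theorem StructRun.correct {V H : ℕ → View}
    (R : StructRun w (fun i => (V i).toCore) (fun i => (H i).toCore))
    (hV : ∀ c i, w.edge c i → H i = V (c + 1)) : StructCorrect w V H := by
  classical
  have hOK := fun i hi => R.ok i hi (decide (w.call i)) (decide (w.ret i)) (by simp) (by simp)
  have hex : ∀ i, w.IsPos i → (V (i + 1)).ex = true := fun i hi => (hOK i hi).1
  have hcall : ∀ i, w.IsPos i → ((V (i + 1)).call = true ↔ w.call i) := fun i hi => by
    rw [(hOK i hi).2.1]
    simp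
  have hret : ∀ i, w.IsPos i → ((V (i + 1)).ret = true ↔ w.ret i) := fun i hi => by
    rw [(hOK i hi).2.2.1]
    simp
  have hmr : ∀ i, w.IsPos i → ((V (i + 1)).mr = true ↔ w.MatchedRet i) := fun i hi => by
    simp only [Core.mr, Bool.and_eq_true, hret i hi]
    constructor
    · rintro ⟨h1, h2⟩
      by_contra hm
      have := ((hOK i hi).2.2.2.2.1 (by simpa using h1)).1 h2
      exact absurd this (by simp [R.pendRet i h1 hm])
    · rintro ⟨c, he⟩
      have hr := w.edge_ret _ _ he
      refine ⟨hr, ((hOK i hi).2.2.2.2.1 (by simpa using hr)).2 ?_⟩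
      rw [hV c i he]
      exact hex c (hi.mono (w.edge_lt _ _ he).le)
  have hmc : ∀ i, w.IsPos i → ((V (i + 1)).mc = true ↔ w.MatchedCall i) := fun i hi => by
    simp only [Core.mc, Bool.and_eq_true, hcall i hi]
    constructor
    · rintro ⟨h1, h2⟩
      by_contra hm
      exact absurd h2 (by simpa using R.pendCall i h1 hm)
    · rintro ⟨r, he⟩
      have hr := isPos_of_edge he
      have h2 := (hOK r hr).2.2.2.2.2.1 (by simpa using w.edge_ret _ _ he)
      rw [hV i r he] at h2
      exact ⟨w.edge_call _ _ he, h2 (hex i hi)⟩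
  refine ⟨R.start, hV, hex, hcall, hret, hmc, hmr, ?_, ?_⟩
  · intro i
    induction i using Nat.strong_induction_on with
    | _ i ih =>
      intro hi
      by_cases hm : w.MatchedRet i
      · obtain ⟨c, he⟩ := hm
        have hlt := w.edge_lt _ _ he
        rw [(hOK i hi).2.2.2.2.2.2.2.1 ((hmr i hi).2 ⟨c, he⟩), hV c i he,
          ih c hlt (hi.mono hlt.le), inside_ret he]
      · rw [(hOK i hi).2.2.2.2.2.2.2.2 (mt (hmr i hi).1 hm)]
        cases i with
        | zero => simp [R.start, not_inside_zero]
        | succ i =>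
          have hi' := hi.mono (Nat.le_succ i)
          rw [ih i (Nat.lt_succ_self i) hi', hex i hi', hmc i hi', inside_succ hm]
          simp
  · intro i hi
    constructor
    · exact fun h hl => (hOK (i + 1) hl).2.2.2.1 (hex i hi) h
    · exact R.last i hi

open Classical in
/-- The correct description of position `i`, with given values of the other bits. -/
noncomputable def actualCore (w : NestedWord A) (z d e F : ℕ → Prop) (i : ℕ) : Core where
  ex := true
  call := decide (w.call i)
  ret := decide (w.ret i)
  mat := decide (w.MatchedCall i ∨ w.MatchedRet i)
  ins := decide (w.Inside i)
  last := decide (¬ w.IsPos (i + 1))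
  fair := decide (F i)
  z := decide (z i)
  d := decide (d i)
  e := decide (e i)

theorem actualCore_mc {z d e F : ℕ → Prop} {i : ℕ} :
    (actualCore w z d e F i).mc = true ↔ w.MatchedCall i := by
  simp only [Core.mc, actualCore, Bool.and_eq_true, decide_eq_true_eq]
  exact ⟨fun ⟨h1, h2⟩ => h2.resolve_right fun h => not_call_of_matchedRet h h1,
    fun h => ⟨h.call, Or.inl h⟩⟩

theorem actualCore_mr {z d e F : ℕ → Prop} {i : ℕ} :
    (actualCore w z d e F i).mr = true ↔ w.MatchedRet i := by
  simp only [Core.mr, actualCore, Bool.and_eq_true, decide_eq_true_eq]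
  exact ⟨fun ⟨h1, h2⟩ => h2.resolve_left fun h => not_ret_of_call h.call h1,
    fun h => ⟨w.edge_ret _ _ h.choose_spec, Or.inr h⟩⟩

theorem structCorrect_actual {V H : ℕ → View} {z d e F : ℕ → Prop} (h0 : (V 0).ex = false)
    (hV : ∀ i, (V (i + 1)).toCore = actualCore w z d e F i)
    (hH : ∀ c i, w.edge c i → H i = V (c + 1)) : StructCorrect w V H where
  start := h0
  edge := hH
  ex i _ := by rw [hV]; rfl
  call i _ := by rw [hV]; simp [actualCore]
  ret i _ := by rw [hV]; simp [actualCore]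
  mc i _ := by rw [hV, actualCore_mc]
  mr i _ := by rw [hV, actualCore_mr]
  ins i _ := by rw [hV]; simp [actualCore]
  last i _ := by rw [hV]; simp [actualCore]

theorem structOK_actual {g h : ℕ → Core} {z d e F : ℕ → Prop} (h0 : (g 0).ex = false)
    (hg : ∀ i, g (i + 1) = actualCore w z d e F i) (hh : ∀ c i, w.edge c i → h i = g (c + 1))
    (hp : ∀ i, w.ret i → ¬ w.MatchedRet i → (h i).ex = false) {i : ℕ} (hi : w.IsPos i)
    {kc kr : Bool} (hc : kc = true ↔ w.call i) (hr : kr = true ↔ w.ret i) :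
    StructOK kc kr (g i) (g (i + 1)) (h i) := by
  have hmr : (g (i + 1)).mr = true ↔ w.MatchedRet i := by rw [hg, actualCore_mr]
  have hins : ∀ i, (g (i + 1)).ins = true ↔ w.Inside i := fun i => by
    rw [hg]
    simp [actualCore]
  have hmat : (g (i + 1)).mat = true ↔ w.MatchedCall i ∨ w.MatchedRet i := by
    rw [hg]
    simp [actualCore]
  have hex : ∀ i, (g (i + 1)).ex = true := fun i => by
    rw [hg]
    rfl
  refine ⟨hex i, ?_, ?_, ?_, ?_, ?_, ?_, ?_, ?_⟩
  · rw [hg, Bool.eq_iff_iff, hc]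
    simp [actualCore]
  · rw [hg, Bool.eq_iff_iff, hr]
    simp [actualCore]
  · cases i with
    | zero => simp [h0]
    | succ i =>
      rw [hg]
      simp [actualCore, hi]
  · intro hr'
    rw [hmat]
    constructor
    · rintro (hm | ⟨c, he⟩)
      · exact absurd (hr.1 hr') (not_ret_of_call hm.call)
      · rw [hh c i he]
        exact hex c
    · intro hx
      by_contra hm
      rw [hp i (hr.1 hr') fun h => hm (Or.inr h)] at hx
      exact absurd hx (by simp)
  · intro hr' hx
    by_cases hm : w.MatchedRet i
    · obtain ⟨c, he⟩ := hm
      rw [hh c i he, hg]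
      simpa [actualCore] using Or.inl ⟨i, he⟩
    · rw [hp i (hr.1 hr') hm] at hx
      exact absurd hx (by simp)
  · rw [hc, hr, hmat]
    rintro h1 h2 (hm | ⟨c, he⟩)
    · exact h1 hm.call
    · exact h2 (w.edge_ret _ _ he)
  · rw [hmr]
    rintro ⟨c, he⟩
    rw [hh c i he, hins, hins, inside_ret he]
  · rw [hmr]
    intro hm
    cases i with
    | zero => simp [h0, hins, not_inside_zero]
    | succ i =>
      rw [hins, hins, hex, hg, actualCore_mc, inside_succ hm]
      simp

/-! ### Syntax trees -/

/-- Syntax trees whose nodes carry the codes of symbols. -/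
inductive Tree where
  | leaf : ℕ → Tree
  | un : ℕ → Tree → Tree
  | bin : ℕ → Tree → Tree → Tree

namespace Tree

/-- The number of nodes. -/
def size : Tree → ℕ
  | leaf _ => 1
  | un _ t => t.size + 1
  | bin _ t u => t.size + u.size + 1

/-- Prefix notation. -/
def code : Tree → List ℕ
  | leaf s => [s]
  | un s t => s :: t.code
  | bin s t u => s :: (t.code ++ u.code)

/-- The meaning of a tree; `lb s` is the meaning of the proposition with code `s`. -/
def Sem (w : NestedWord A) (lb : ℕ → ℕ → Bool) : Tree → ℕ → Prop
  | leaf s => SemOp w s (fun i => lb s i = true) (fun _ => False) (fun _ => False)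
  | un s t => SemOp w s (fun i => lb s i = true) (t.Sem w lb) (fun _ => False)
  | bin s t u => SemOp w s (fun i => lb s i = true) (t.Sem w lb) (u.Sem w lb)

/-- The code of the symbol at the root. -/
def sym : Tree → ℕ
  | leaf s => s
  | un s _ => s
  | bin s _ _ => s

/-- The view at the root, when the nodes are numbered in prefix order from `o` on and carry the
guesses `G`. -/
def view (G : ℕ → Core) (o : ℕ) : Tree → View
  | leaf _ => ⟨G o, false, false⟩
  | un _ _ => ⟨G o, (G (o + 1)).z, false⟩
  | bin _ t _ => ⟨G o, (G (o + 1)).z, (G (o + 1 + t.size)).z⟩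

theorem size_pos (t : Tree) : 0 < t.size := by
  cases t <;> simp [size]

theorem code_length (t : Tree) : t.code.length = t.size := by
  induction t with
  | leaf s => rfl
  | un s t ih => simp [code, size, ih]
  | bin s t u iht ihu => simp [code, size, iht, ihu]

theorem view_toCore (G : ℕ → Core) (o : ℕ) (t : Tree) : (t.view G o).toCore = G o := by
  cases t <;> rfl

theorem view_congr {G G' : ℕ → Core} {o : ℕ} (t : Tree)
    (h : ∀ v, o ≤ v → v < o + t.size → G v = G' v) : t.view G o = t.view G' o := by
  cases t with
  | leaf s => simp [view, h o le_rfl (by simp [size])]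
  | un s t =>
    have := t.size_pos
    simp only [size] at h
    simp [view, h o le_rfl (by omega), h (o + 1) (by omega) (by omega)]
  | bin s t u =>
    have := t.size_pos
    have := u.size_pos
    simp only [size] at h
    simp [view, h o le_rfl (by omega), h (o + 1) (by omega) (by omega),
      h (o + 1 + t.size) (by omega) (by omega)]

/-- The local conditions at the root of a tree; `lb s` is the truth value of the proposition with
code `s` at the current position. -/
def RootOK (lb : ℕ → Bool) (kc kr : Bool) (P C H : ℕ → Core) (t : Tree) (o : ℕ) : Prop :=
  StructOK kc kr (P o) (C o) (H o) ∧ OpOK t.sym (lb t.sym) (t.view P o) (t.view C o) (t.view H o)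

/-- The local conditions at all nodes. -/
def AllOK (lb : ℕ → Bool) (kc kr : Bool) (P C H : ℕ → Core) : Tree → ℕ → Prop
  | leaf s, o => RootOK lb kc kr P C H (leaf s) o
  | un s t, o => RootOK lb kc kr P C H (un s t) o ∧ t.AllOK lb kc kr P C H (o + 1)
  | bin s t u, o => RootOK lb kc kr P C H (bin s t u) o ∧ t.AllOK lb kc kr P C H (o + 1) ∧
      u.AllOK lb kc kr P C H (o + 1 + t.size)

theorem AllOK.root {lb : ℕ → Bool} {kc kr : Bool} {P C H : ℕ → Core} {t : Tree} {o : ℕ}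
    (h : t.AllOK lb kc kr P C H o) : t.RootOK lb kc kr P C H o := by
  cases t with
  | leaf s => exact h
  | un s t => exact h.1
  | bin s t u => exact h.1

/-- A labelling of all times and nodes of a tree that satisfies all local conditions and the
acceptance conditions, the node numbers starting from `o`. `G 0` is the label before the first
position, `G (i + 1)` that of position `i`, and `H i` the label at the call that matches `i`. -/
structure Run (w : NestedWord A) (lb : ℕ → ℕ → Bool) (G H : ℕ → ℕ → Core) (t : Tree) (o : ℕ) :
    Prop where
  start : ∀ v, o ≤ v → v < o + t.size → (G 0 v).ex = false
  edge : ∀ c i, w.edge c i → ∀ v, o ≤ v → v < o + t.size → H i v = G (c + 1) v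
  pendRet : ∀ i, w.ret i → ¬ w.MatchedRet i → ∀ v, o ≤ v → v < o + t.size → (H i v).ex = false
  pendCall : ∀ i, w.call i → ¬ w.MatchedCall i →
    ∀ v, o ≤ v → v < o + t.size → (G (i + 1) v).mat = false
  last : ∀ i, w.IsPos i → ¬ w.IsPos (i + 1) →
    ∀ v, o ≤ v → v < o + t.size → (G (i + 1) v).last = true
  fair : (∀ i, w.IsPos i) → ∀ v, o ≤ v → v < o + t.size → ∃ᶠ i in atTop, (G (i + 1) v).fair = true
  ok : ∀ i, w.IsPos i → ∀ kc kr : Bool, (kc = true ↔ w.call i) → (kr = true ↔ w.ret i) →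
    t.AllOK (fun s => lb s i) kc kr (G i) (G (i + 1)) (H i) o

/-- In a labelling that satisfies all conditions, the truth value at the root is the actual one. -/
theorem Run.z_iff {lb : ℕ → ℕ → Bool} {G H : ℕ → ℕ → Core} {t : Tree} {o : ℕ}
    (R : Run w lb G H t o) {i : ℕ} (hi : w.IsPos i) :
    (G (i + 1) o).z = true ↔ t.Sem w lb i := by
  -- restriction to a subtree
  have sub : ∀ (u : Tree) (o' : ℕ), o ≤ o' → o' + u.size ≤ o + t.size →
      (∀ lb kc kr P C H, t.AllOK lb kc kr P C H o → u.AllOK lb kc kr P C H o') →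
      Run w lb G H u o' := fun u o' h1 h2 h3 =>
    ⟨fun v hv hv' => R.start v (by omega) (by omega),
      fun c i he v hv hv' => R.edge c i he v (by omega) (by omega),
      fun i h h' v hv hv' => R.pendRet i h h' v (by omega) (by omega),
      fun i h h' v hv hv' => R.pendCall i h h' v (by omega) (by omega),
      fun i h h' v hv hv' => R.last i h h' v (by omega) (by omega),
      fun h v hv hv' => R.fair h v (by omega) (by omega),
      fun i hi kc kr hc hr => h3 _ _ _ _ _ _ (R.ok i hi kc kr hc hr)⟩
  have hpos := t.size_pos
  have hH : ∀ c i, w.edge c i → t.view (H i) o = t.view (G (c + 1)) o :=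
    fun c i he => t.view_congr (R.edge c i he)
  have S : StructCorrect w (fun i => t.view (G i) o) (fun i => t.view (H i) o) := by
    refine StructRun.correct ?_ hH
    simp only [view_toCore]
    exact ⟨R.start o le_rfl (by omega),
      fun i h h' => R.pendRet i h h' o le_rfl (by omega),
      fun i h h' => R.pendCall i h h' o le_rfl (by omega),
      fun i h h' => R.last i h h' o le_rfl (by omega),
      fun i hi kc kr hc hr => (R.ok i hi kc kr hc hr).root.1⟩
  have O : OpCorrect w t.sym (fun i => lb t.sym i) (fun i => t.view (G i) o)
      (fun i => t.view (H i) o) := by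
    classical
    exact fun i hi => (R.ok i hi (decide (w.call i)) (decide (w.ret i)) (by simp)
      (by simp)).root.2
  have hz := O.z_iff S (fun hw => by
    simpa only [view_toCore] using R.fair hw o le_rfl (by omega)) hi
  simp only [view_toCore] at hz
  rw [hz]
  cases t with
  | leaf s => exact semOp_congr hi (fun i _ => by simp [view]) (fun i _ => by simp [view])
  | un s t =>
    refine semOp_congr hi (fun i hi => ?_) (fun i _ => by simp [view])
    exact (sub t (o + 1) (by omega) (by simp [size]; omega) fun _ _ _ _ _ _ h => h.2).z_iff hi
  | bin s t u =>
    refine semOp_congr hi (fun i hi => ?_) (fun i hi => ?_)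
    · exact (sub t (o + 1) (by omega) (by simp [size]; omega)
        fun _ _ _ _ _ _ h => h.2.1).z_iff hi
    · exact (sub u (o + 1 + t.size) (by omega) (by simp [size]; omega)
        fun _ _ _ _ _ _ h => h.2.2).z_iff hi

/-- The actual truth values extend to a labelling `K` of the positions that satisfies all
conditions. The label `G 0` before the first position and the labels `H i` at pending returns may be
anything without `ex`. -/
theorem exists_labelling (w : NestedWord A) (lb : ℕ → ℕ → Bool) (t : Tree) (o : ℕ) :
    ∃ K : ℕ → ℕ → Core,
      (∀ v, o ≤ v → v < o + t.size → ((∀ i, w.IsPos i) → ∃ᶠ i in atTop, (K i v).fair = true) ∧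
        ∃ z d e F, ∀ i, K i v = actualCore w z d e F i) ∧
      (∀ i, (K i o).z = true ↔ t.Sem w lb i) ∧
      ∀ G H : ℕ → ℕ → Core, (∀ i v, o ≤ v → v < o + t.size → G (i + 1) v = K i v) →
        (∀ v, o ≤ v → v < o + t.size → (G 0 v).ex = false) →
        (∀ c i, w.edge c i → ∀ v, o ≤ v → v < o + t.size → H i v = G (c + 1) v) →
        (∀ i, w.ret i → ¬ w.MatchedRet i → ∀ v, o ≤ v → v < o + t.size → (H i v).ex = false) →
        ∀ i, w.IsPos i → ∀ kc kr : Bool, (kc = true ↔ w.call i) → (kr = true ↔ w.ret i) →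
          t.AllOK (fun s => lb s i) kc kr (G i) (G (i + 1)) (H i) o := by
  -- the conditions at the root, given the labels of the rest
  have root : ∀ (t : Tree) (o : ℕ) (x y : ℕ → Prop) (d e F : ℕ → Prop),
      (∀ i, t.Sem w lb i ↔ SemOp w t.sym (fun i => lb t.sym i = true) x y i) →
      (∀ V H, StructCorrect w V H → HasValues V x y (SemOp w t.sym (fun i => lb t.sym i = true) x y)
        d e F → OpCorrect w t.sym (fun i => lb t.sym i) V H) →
      ∀ G H : ℕ → ℕ → Core, (∀ i, G (i + 1) o = actualCore w (t.Sem w lb) d e F i) →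
        (∀ i, (t.view (G (i + 1)) o).x = true ↔ x i) →
        (∀ i, (t.view (G (i + 1)) o).y = true ↔ y i) →
        (∀ v, o ≤ v → v < o + t.size → (G 0 v).ex = false) →
        (∀ c i, w.edge c i → ∀ v, o ≤ v → v < o + t.size → H i v = G (c + 1) v) →
        (∀ i, w.ret i → ¬ w.MatchedRet i → ∀ v, o ≤ v → v < o + t.size → (H i v).ex = false) →
        ∀ i, w.IsPos i → ∀ kc kr : Bool, (kc = true ↔ w.call i) → (kr = true ↔ w.ret i) →
          t.RootOK (fun s => lb s i) kc kr (G i) (G (i + 1)) (H i) o := by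
    intro t o x y d e F hz hO G H hG hx hy h0 hH hp i hi kc kr hc hr
    have hpos := t.size_pos
    have hzf : t.Sem w lb = SemOp w t.sym (fun i => lb t.sym i = true) x y :=
      funext fun i => propext (hz i)
    refine ⟨structOK_actual (g := fun i => G i o) (h := fun i => H i o)
      (h0 o le_rfl (by omega)) hG (fun c i he => hH c i he o le_rfl (by omega))
      (fun i h h' => hp i h h' o le_rfl (by omega)) hi hc hr, ?_⟩
    refine hO (fun i => t.view (G i) o) (fun i => t.view (H i) o) ?_ ?_ i hi
    · refine structCorrect_actual (z := t.Sem w lb) (d := d) (e := e) (F := F) ?_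
        (fun i => ?_) fun c i he => t.view_congr (hH c i he)
      · rw [view_toCore]
        exact h0 o le_rfl (by omega)
      · rw [view_toCore]
        exact hG i
    · refine ⟨funext fun i => propext (hx i), funext fun i => propext (hy i), ?_, ?_, ?_, ?_⟩
      all_goals
        refine funext fun i => propext ?_
        simp [view_toCore, hG, actualCore, hzf]
  induction t generalizing o with
  | leaf s =>
    obtain ⟨d, e, F, hF, hO⟩ := exists_values w s (lb s) (fun _ => False) (fun _ => False)
    refine ⟨fun i _ => actualCore w ((leaf s).Sem w lb) d e F i,
      fun v _ _ => ⟨fun hw => by simpa [actualCore] using hF hw, _, _, _, _, fun i => rfl⟩,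
      fun i => by simp [actualCore], ?_⟩
    intro G H hG h0 hH hp
    exact root (leaf s) o _ _ d e F (fun i => Iff.rfl) hO G H
      (fun i => hG i o le_rfl (by simp [size])) (fun i => by simp [view])
      (fun i => by simp [view]) h0 hH hp
  | un s t ih =>
    obtain ⟨K, hK1, hK2, hK3⟩ := ih (o + 1)
    obtain ⟨d, e, F, hF, hO⟩ := exists_values w s (lb s) (t.Sem w lb) (fun _ => False)
    have hpos := t.size_pos
    simp only [size]
    refine ⟨fun i v => if v = o then actualCore w ((un s t).Sem w lb) d e F i else K i v,
      fun v hv hv' => ?_, fun i => by simp [actualCore], ?_⟩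
    · by_cases hvo : v = o
      · simp only [hvo, if_true]
        exact ⟨fun hw => by simpa [actualCore] using hF hw, _, _, _, _, fun i => rfl⟩
      · simp only [hvo, if_false]
        exact hK1 v (by omega) (by omega)
    · intro G H hG h0 hH hp i hi kc kr hc hr
      beta_reduce at hG
      have hGK : ∀ i v, o + 1 ≤ v → v < o + 1 + t.size → G (i + 1) v = K i v := fun i v h h' => by
        rw [hG i v (by omega) (by omega), if_neg (by omega)]
      refine ⟨root (un s t) o _ _ d e F (fun i => Iff.rfl) hO G H
        (fun i => by simpa using hG i o le_rfl (by omega)) (fun i => ?_)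
        (fun i => by simp [view]) h0 hH hp i hi kc kr hc hr, ?_⟩
      · rw [← hK2 i, ← hGK i (o + 1) le_rfl (by omega)]
        rfl
      · exact hK3 G H hGK (fun v h h' => h0 v (by omega) (by omega))
          (fun c i he v h h' => hH c i he v (by omega) (by omega))
          (fun i hr hm v h h' => hp i hr hm v (by omega) (by omega)) i hi kc kr hc hr
  | bin s t u iht ihu =>
    obtain ⟨K, hK1, hK2, hK3⟩ := iht (o + 1)
    obtain ⟨L, hL1, hL2, hL3⟩ := ihu (o + 1 + t.size)
    obtain ⟨d, e, F, hF, hO⟩ := exists_values w s (lb s) (t.Sem w lb) (u.Sem w lb)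
    have hpos := t.size_pos
    have hpos' := u.size_pos
    simp only [size]
    refine ⟨fun i v => if v = o then actualCore w ((bin s t u).Sem w lb) d e F i else
      if v < o + 1 + t.size then K i v else L i v,
      fun v hv hv' => ?_, fun i => by simp [actualCore], ?_⟩
    · by_cases hvo : v = o
      · simp only [hvo, if_true]
        exact ⟨fun hw => by simpa [actualCore] using hF hw, _, _, _, _, fun i => rfl⟩
      · by_cases hvt : v < o + 1 + t.size
        · simp only [hvo, hvt, if_false, if_true]
          exact hK1 v (by omega) (by omega)
        · simp only [hvo, hvt, if_false]
          exact hL1 v (by omega) (by omega)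
    · intro G H hG h0 hH hp i hi kc kr hc hr
      beta_reduce at hG
      have hGK : ∀ i v, o + 1 ≤ v → v < o + 1 + t.size → G (i + 1) v = K i v := fun i v h h' => by
        rw [hG i v (by omega) (by omega), if_neg (by omega), if_pos h']
      have hGL : ∀ i v, o + 1 + t.size ≤ v → v < o + 1 + t.size + u.size →
          G (i + 1) v = L i v := fun i v h h' => by
        rw [hG i v (by omega) (by omega), if_neg (by omega), if_neg (by omega)]
      refine ⟨root (bin s t u) o _ _ d e F (fun i => Iff.rfl) hO G H
        (fun i => by simpa using hG i o le_rfl (by omega)) (fun i => ?_) (fun i => ?_)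
        h0 hH hp i hi kc kr hc hr, ?_, ?_⟩
      · rw [← hK2 i, ← hGK i (o + 1) le_rfl (by omega)]
        rfl
      · rw [← hL2 i, ← hGL i (o + 1 + t.size) le_rfl (by omega)]
        rfl
      · exact hK3 G H hGK (fun v h h' => h0 v (by omega) (by omega))
          (fun c i he v h h' => hH c i he v (by omega) (by omega))
          (fun i hr hm v h h' => hp i hr hm v (by omega) (by omega)) i hi kc kr hc hr
      · exact hL3 G H hGL (fun v h h' => h0 v (by omega) (by omega))
          (fun c i he v h h' => hH c i he v (by omega) (by omega))
          (fun i hr hm v h h' => hp i hr hm v (by omega) (by omega)) i hi kc kr hc hr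

end Tree

end NW

namespace NW

open NestedWord Filter

/-! ### Formulas as trees, and checking all nodes with a stack -/

/-- The number of arguments of the operator with code `s`. -/
def arity (s : ℕ) : ℕ :=
  if s < 3 ∨ 17 ≤ s then 0 else if s = 4 ∨ 9 ≤ s then 2 else 1

namespace Tree

/-- Every node has as many children as its symbol has arguments. -/
def WellFormed : Tree → Prop
  | leaf s => arity s = 0
  | un s t => arity s = 1 ∧ t.WellFormed
  | bin s t u => arity s = 2 ∧ t.WellFormed ∧ u.WellFormed

end Tree

namespace Formula

variable {n : ℕ}

/-- The syntax tree of a formula. -/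
def tree : Formula n → Tree
  | top => .leaf 0
  | prop p => .leaf (17 + p.val)
  | call => .leaf 1
  | ret => .leaf 2
  | neg φ => .un 3 φ.tree
  | or φ ψ => .bin 4 φ.tree ψ.tree
  | next φ => .un 5 φ.tree
  | anext φ => .un 6 φ.tree
  | prev φ => .un 7 φ.tree
  | aprev φ => .un 8 φ.tree
  | untl κ φ ψ => .bin (9 + κ.toNat) φ.tree ψ.tree
  | snce κ φ ψ => .bin (13 + κ.toNat) φ.tree ψ.tree

theorem tree_code (φ : Formula n) : φ.tree.code = φ.code := by
  induction φ <;> simp_all [tree, Tree.code, Formula.code]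

theorem tree_size (φ : Formula n) : φ.tree.size = φ.size := by
  induction φ <;> simp_all [tree, Tree.size, Formula.size]

theorem tree_wellFormed (φ : Formula n) : φ.tree.WellFormed := by
  induction φ with
  | untl κ φ ψ h1 h2 => exact ⟨by cases κ <;> rfl, h1, h2⟩
  | snce κ φ ψ h1 h2 => exact ⟨by cases κ <;> rfl, h1, h2⟩
  | _ => simp_all [tree, Tree.WellFormed, arity]

theorem code_length (φ : Formula n) : φ.code.length = φ.size := by
  rw [← tree_code, Tree.code_length, tree_size]

end Formula

/-- The truth value of the proposition with code `s` under a letter, given by its truth values. -/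
def propValue (a : List Bool) (s : ℕ) : Bool := a.getD (s - 17) false

theorem propValue_code {n : ℕ} (a : Letter n) (p : Fin n) :
    propValue (Letter.code a) (17 + p.val) = true ↔ p ∈ a := by
  simp [propValue, Letter.code]

theorem Formula.sat_iff {n : ℕ} (w : NestedWord (Letter n)) (φ : Formula n) :
    φ.Sat w = φ.tree.Sem w fun s i => propValue (Letter.code (w.label i)) s := by
  induction φ with
  | prop p =>
    funext i
    simp only [Formula.Sat, Formula.tree, Tree.Sem]
    rw [semOp_of_ge (by omega), propValue_code]
  | untl κ φ ψ h1 h2 =>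
    funext i
    cases κ <;> simp only [Formula.Sat, Formula.tree, Tree.Sem, h1, h2] <;> rfl
  | snce κ φ ψ h1 h2 =>
    funext i
    cases κ <;> simp only [Formula.Sat, Formula.tree, Tree.Sem, h1, h2] <;> rfl
  | _ =>
    funext i
    simp only [Formula.Sat, Formula.tree, Tree.Sem, *]
    rfl

open Classical in
/-- The check of one node. The triples `x`, `y` hold the truth values of its children at the
previous position, the current one and the matching call. -/
noncomputable def nodeCheck (s : ℕ) (lb kc kr : Bool) (p c h : Core) (x y : Bool × Bool × Bool) :
    Bool :=
  decide (StructOK kc kr p c h ∧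
    OpOK s lb ⟨p, x.1, y.1⟩ ⟨c, x.2.1, y.2.1⟩ ⟨h, x.2.2, y.2.2⟩)

theorem nodeCheck_iff {s : ℕ} {lb kc kr : Bool} {p c h : Core} {x y : Bool × Bool × Bool} :
    nodeCheck s lb kc kr p c h x y = true ↔ StructOK kc kr p c h ∧
      OpOK s lb ⟨p, x.1, y.1⟩ ⟨c, x.2.1, y.2.1⟩ ⟨h, x.2.2, y.2.2⟩ := by
  classical
  rw [nodeCheck, decide_eq_true_eq]

/-- One step of the evaluation of a formula in prefix notation, from right to left. The stack holds
the truth values of the subformulas whose parent has not been reached, and the flag records whether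
all checks have succeeded. Missing arguments count as false. -/
noncomputable def checkStep (a : List Bool) (kc kr : Bool) (s : ℕ) (p c h : Core)
    (st : Bool × List (Bool × Bool × Bool)) : Bool × List (Bool × Bool × Bool) :=
  (st.1 && nodeCheck s (propValue a s) kc kr p c h
      ((st.2.take (arity s)).getD 0 (false, false, false))
      ((st.2.take (arity s)).getD 1 (false, false, false)),
    (p.z, c.z, h.z) :: st.2.drop (arity s))

theorem foldr_checkStep {a : List Bool} {kc kr : Bool} {P C H : ℕ → Core} {L : ℕ → ℕ} (t : Tree)
    (ht : t.WellFormed) (o : ℕ) (hL : ∀ v < t.size, L (o + v) = t.code.getD v 0)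
    (st : Bool × List (Bool × Bool × Bool)) :
    ((((List.range' o t.size).foldr
      (fun v => checkStep a kc kr (L v) (P v) (C v) (H v)) st).1 = true ↔
        st.1 = true ∧ t.AllOK (propValue a) kc kr P C H o) ∧
    ((List.range' o t.size).foldr
      (fun v => checkStep a kc kr (L v) (P v) (C v) (H v)) st).2 =
        ((P o).z, (C o).z, (H o).z) :: st.2) := by
  induction t generalizing o st with
  | leaf s =>
    have h0 : L o = s := by simpa [Tree.code] using hL 0 (by simp [Tree.size])
    have ha : arity s = 0 := ht
    simp only [Tree.size, List.range'_one, List.foldr_cons, List.foldr_nil, checkStep, h0, ha]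
    simp [nodeCheck_iff, Tree.AllOK, Tree.RootOK, Tree.view, Tree.sym]
  | un s t ih =>
    obtain ⟨ha, ht⟩ := ht
    have h0 : L o = s := by simpa [Tree.code] using hL 0 (by simp [Tree.size])
    obtain ⟨ih1, ih2⟩ := ih ht (o + 1) (fun v hv => by
      have := hL (v + 1) (by simp only [Tree.size]; omega)
      simpa [Tree.code, Nat.add_assoc, Nat.add_comm 1 v] using this) st
    simp only [Tree.size, List.range'_succ, List.foldr_cons]
    generalize (List.range' (o + 1) t.size).foldr
      (fun v => checkStep a kc kr (L v) (P v) (C v) (H v)) st = r at ih1 ih2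
    simp only [checkStep, h0, ha, ih2, Bool.and_eq_true, ih1]
    simp only [nodeCheck_iff, Tree.AllOK, Tree.RootOK, Tree.view, Tree.sym, List.take_succ_cons,
      List.take_zero, List.getD_cons_zero, List.getD_cons_succ, List.getD_nil, List.drop_succ_cons,
      List.drop_zero]
    tauto
  | bin s t u iht ihu =>
    obtain ⟨ha, ht, hu⟩ := ht
    have h0 : L o = s := by simpa [Tree.code] using hL 0 (by simp [Tree.size])
    obtain ⟨ihu1, ihu2⟩ := ihu hu (o + 1 + t.size) (fun v hv => by
      have := hL (v + t.size + 1) (by simp only [Tree.size]; omega)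
      rw [show o + 1 + t.size + v = o + (v + t.size + 1) by omega, this]
      simp only [Tree.code, List.getD_cons_succ]
      rw [List.getD_append_right _ _ _ _ (by rw [Tree.code_length]; omega), Tree.code_length,
        Nat.add_sub_cancel]) st
    obtain ⟨iht1, iht2⟩ := iht ht (o + 1) (fun v hv => by
      have := hL (v + 1) (by simp only [Tree.size]; omega)
      rw [show o + 1 + v = o + (v + 1) by omega, this]
      simp only [Tree.code, List.getD_cons_succ]
      rw [List.getD_append _ _ _ _ (by rw [Tree.code_length]; omega)])
      ((List.range' (o + 1 + t.size) u.size).foldr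
        (fun v => checkStep a kc kr (L v) (P v) (C v) (H v)) st)
    simp only [Tree.size, List.range'_succ, List.foldr_cons]
    rw [← List.range'_append_1, List.foldr_append]
    generalize (List.range' (o + 1 + t.size) u.size).foldr
      (fun v => checkStep a kc kr (L v) (P v) (C v) (H v)) st = r' at iht1 iht2 ihu1 ihu2
    generalize (List.range' (o + 1) t.size).foldr
      (fun v => checkStep a kc kr (L v) (P v) (C v) (H v)) r' = r at iht1 iht2
    simp only [checkStep, h0, ha, iht2, ihu2, Bool.and_eq_true, iht1, ihu1]
    simp only [nodeCheck_iff, Tree.AllOK, Tree.RootOK, Tree.view, Tree.sym, List.take_succ_cons,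
      List.take_zero, List.getD_cons_zero, List.getD_cons_succ, List.drop_succ_cons,
      List.drop_zero]
    tauto

/-! ### Recurrence of several events, tracked by one bit for each -/

/-- Collect the events `F v` in the bits `f v`, and start again whenever all bits are set. Then all
bits are set infinitely often exactly if every event occurs infinitely often. -/
theorem frequently_all_iff {m : ℕ} {f F : ℕ → ℕ → Prop}
    (h : ∀ i, ∀ v < m, (f (i + 1) v ↔ F i v ∨ (f i v ∧ ¬ ∀ u < m, f i u))) :
    (∃ᶠ i in atTop, ∀ v < m, f i v) ↔ ∀ v < m, ∃ᶠ i in atTop, F i v := by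
  simp only [frequently_atTop]
  constructor
  · intro hf v hv N
    obtain ⟨i, hi, hi'⟩ := hf N
    obtain ⟨j, hj, hj'⟩ := hf (i + 1)
    by_contra! hF
    have : ∀ k, i + 1 ≤ k → ¬ f k v := by
      intro k hk
      induction k, hk using Nat.le_induction with
      | base =>
        rw [h i v hv]
        have := hF i hi
        tauto
      | succ k hk ih =>
        rw [h k v hv]
        have := hF k (by omega)
        tauto
    exact this j hj (hj' v hv)
  · intro hF N
    by_contra! hf
    have mono : ∀ v < m, ∀ i j, N ≤ i → i ≤ j → f i v → f j v := by
      intro v hv i j hi hij hfi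
      induction j, hij using Nat.le_induction with
      | base => exact hfi
      | succ j hj ih =>
        rw [h j v hv]
        refine Or.inr ⟨ih, fun hall => ?_⟩
        obtain ⟨u, hu, hu'⟩ := hf j (by omega)
        exact hu' (hall u hu)
    have ev : ∀ v < m, ∃ i, N ≤ i ∧ f i v := fun v hv => by
      obtain ⟨i, hi, hi'⟩ := hF v hv N
      exact ⟨i + 1, by omega, (h i v hv).2 (Or.inl hi')⟩
    have all : ∀ k ≤ m, ∃ i, N ≤ i ∧ ∀ v < k, f i v := by
      intro k
      induction k with
      | zero => exact fun _ => ⟨N, le_rfl, by simp⟩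
      | succ k ih =>
        intro hk
        obtain ⟨i, hi, hi'⟩ := ih (by omega)
        obtain ⟨j, hj, hj'⟩ := ev k (by omega)
        refine ⟨max i j, by omega, fun v hv => ?_⟩
        rcases Nat.lt_succ_iff_lt_or_eq.1 hv with hv' | rfl
        · exact mono v (by omega) i _ hi (by omega) (hi' v hv')
        · exact mono v (by omega) j _ hj (by omega) hj'
    obtain ⟨i, hi, hi'⟩ := all m le_rfl
    obtain ⟨u, hu, hu'⟩ := hf i hi
    exact hu' (hi' u hu)

end NW

namespace NW

open NestedWord Filter

/-! ### The automaton -/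

instance : Finite Core :=
  Finite.of_injective
    (fun g : Core => (g.ex, g.call, g.ret, g.mat, g.ins, g.last, g.fair, g.z, g.d, g.e))
    fun g g' h => by
      cases g
      cases g'
      simpa using h

/-- The number of labels of one node: a guess, and a bit that collects progress marks. -/
noncomputable def base : ℕ := Nat.card (Core × Bool)

theorem base_pos : 0 < base := Nat.card_pos_iff.2 ⟨⟨⟨⟨false, false, false, false, false, false,
  false, false, false, false⟩, false⟩⟩, inferInstance⟩

/-- The label that a digit stands for. -/
noncomputable def ofDigit : Fin base ≃ Core × Bool := (Finite.equivFin (Core × Bool)).symm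

/-- States and hierarchical symbols are numbers, written in base `base`. Digit number `v` is the
label of node number `v`. -/
noncomputable def digit (q v : ℕ) : Core × Bool :=
  ofDigit ⟨q / base ^ v % base, Nat.mod_lt _ base_pos⟩

theorem exists_digits (m : ℕ) (g : ℕ → Core × Bool) :
    ∃ q < base ^ m, ∀ v < m, digit q v = g v := by
  have key : ∀ (m : ℕ) (g : ℕ → Fin base), ∃ q < base ^ m, ∀ v < m, q / base ^ v % base = g v := by
    intro m
    induction m with
    | zero => exact fun _ => ⟨0, by simp⟩
    | succ m ih =>
      intro g
      obtain ⟨q, hq, hq'⟩ := ih fun v => g (v + 1)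
      refine ⟨g 0 + base * q, ?_, ?_⟩
      · have h1 := (g 0).isLt
        have h2 : base * (q + 1) ≤ base * base ^ m := Nat.mul_le_mul_left _ hq
        rw [pow_succ']
        rw [mul_add] at h2
        omega
      · rintro (_ | v) hv
        · simp [Nat.mod_eq_of_lt (g 0).isLt]
        · rw [pow_succ', ← Nat.div_div_eq_div_mul, Nat.add_mul_div_left _ _ base_pos,
            Nat.div_eq_of_lt (g 0).isLt, zero_add]
          exact hq' v (by omega)
  obtain ⟨q, hq, hq'⟩ := key m fun v => ofDigit.symm (g v)
  refine ⟨q, hq, fun v hv => ?_⟩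
  simp [digit, hq' v hv]

/-- The `n` lowest binary digits of a number. -/
def bits (n k : ℕ) : List Bool := (List.range n).map fun i => decide (k / 2 ^ i % 2 = 1)

theorem exists_bits {n : ℕ} (a : Letter n) : ∃ k < 2 ^ n, bits n k = Letter.code a := by
  refine ⟨Nat.ofBits fun p => decide (p ∈ a), Nat.ofBits_lt_two_pow _, ?_⟩
  refine List.ext_getElem (by simp [bits, Letter.code]) fun i h1 h2 => ?_
  have hi : i < n := by simpa [bits] using h1
  simp only [bits, Letter.code, List.getElem_map, List.getElem_range, List.getElem_ofFn]
  rw [← Nat.testBit_eq_decide_div_mod_eq, Nat.testBit_ofBits_lt _ _ hi]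

/-- The checks of all nodes of the formula with code `L`, for a transition from `q` to `q'` that
reads the letter `a`, and the symbol `p` if it is a return. -/
noncomputable def treeCheck (L : List ℕ) (kc kr : Bool) (a : List Bool) (q q' p : ℕ) : Bool :=
  ((List.range L.length).foldr (fun v => checkStep a kc kr (L.getD v 0) (digit q v).1
    (digit q' v).1 (digit p v).1) (true, [])).1

/-- `R` holds for the labels of all `m` nodes. -/
def AllNodes (m : ℕ) (R : Core × Bool → Prop) (q : ℕ) : Prop := ∀ v < m, R (digit q v)

/-- The condition on transitions: all nodes pass their checks, the bits that collect progress marks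
are updated and reset once all of them are set, and the formula holds at the first position. -/
def TransOK (L : List ℕ) (kc kr : Bool) (a : List Bool) (q q' p : ℕ) : Prop :=
  treeCheck L kc kr a q q' p = true ∧
  (∀ v < L.length, ((digit q' v).2 = true ↔
    (digit q' v).1.fair = true ∨
      ((digit q v).2 = true ∧ ¬ AllNodes L.length (fun d => d.2 = true) q))) ∧
  ((digit q 0).1.ex = false → (digit q' 0).1.z = true)

/-- The letter, states and symbol with number `t`, where states and symbols are below `N`. -/
def decodeTrans (n N t : ℕ) : List Bool × ℕ × ℕ × ℕ :=
  (bits n (t / N / N / N), t % N, t / N % N, t / N / N % N)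

theorem exists_decodeTrans {n N q q' p : ℕ} (a : Letter n) (hq : q < N) (hq' : q' < N)
    (hp : p < N) :
    ∃ t < N * (N * (N * 2 ^ n)), decodeTrans n N t = (Letter.code a, q, q', p) := by
  have hN : 0 < N := by omega
  obtain ⟨k, hk, hka⟩ := exists_bits a
  have aux : ∀ x y M, x < N → y < M → x + N * y < N * M := fun x y M hx hy => by
    have : N * (y + 1) ≤ N * M := Nat.mul_le_mul_left _ hy
    rw [mul_add] at this
    omega
  have d : ∀ x y, x < N → (x + N * y) / N = y := fun x y hx => by
    rw [Nat.add_mul_div_left _ _ hN, Nat.div_eq_of_lt hx, zero_add]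
  have r : ∀ x y, x < N → (x + N * y) % N = x := fun x y hx => by
    rw [Nat.add_mul_mod_self_left, Nat.mod_eq_of_lt hx]
  refine ⟨q + N * (q' + N * (p + N * k)), aux _ _ _ hq (aux _ _ _ hq' (aux _ _ _ hp hk)), ?_⟩
  rw [decodeTrans, d _ _ hq, d _ _ hq', d _ _ hp, r _ _ hq, r _ _ hq', r _ _ hp, hka]

open Classical in
/-- All transitions between numbers below `base ^ L.length`, as letter, states and symbol. -/
noncomputable def transList (n : ℕ) (L : List ℕ) (kc kr : Bool) : List (List Bool × ℕ × ℕ × ℕ) :=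
  ((List.range (base ^ L.length * (base ^ L.length * (base ^ L.length * 2 ^ n)))).map
    (decodeTrans n (base ^ L.length))).filter fun t => TransOK L kc kr t.1 t.2.1 t.2.2.1 t.2.2.2

theorem length_transList (n : ℕ) (L : List ℕ) (kc kr : Bool) : (transList n L kc kr).length ≤
    base ^ L.length * (base ^ L.length * (base ^ L.length * 2 ^ n)) :=
  (List.length_filter_le _ _).trans (by simp)

theorem mem_transList {n : ℕ} {L : List ℕ} {kc kr : Bool} {a : Letter n} {q q' p : ℕ} :
    (Letter.code a, q, q', p) ∈ transList n L kc kr ↔ q < base ^ L.length ∧ q' < base ^ L.length ∧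
      p < base ^ L.length ∧ TransOK L kc kr (Letter.code a) q q' p := by
  simp only [transList, List.mem_filter, decide_eq_true_eq, List.mem_map, List.mem_range]
  constructor
  · rintro ⟨⟨t, -, ht⟩, hT⟩
    have hN : 0 < base ^ L.length := pow_pos base_pos _
    simp only [decodeTrans, Prod.mk.injEq] at ht
    obtain ⟨-, rfl, rfl, rfl⟩ := ht
    exact ⟨Nat.mod_lt _ hN, Nat.mod_lt _ hN, Nat.mod_lt _ hN, hT⟩
  · rintro ⟨hq, hq', hp, hT⟩
    exact ⟨exists_decodeTrans a hq hq' hp, hT⟩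

open Classical in
/-- The numbers below `base ^ m` all of whose nodes satisfy `R`. -/
noncomputable def stateList (m : ℕ) (R : Core × Bool → Prop) : List ℕ :=
  (List.range (base ^ m)).filter fun q => AllNodes m R q

theorem mem_stateList {m : ℕ} {R : Core × Bool → Prop} {q : ℕ} :
    q ∈ stateList m R ↔ q < base ^ m ∧ AllNodes m R q := by
  simp [stateList]

theorem length_stateList (m : ℕ) (R : Core × Bool → Prop) :
    (stateList m R).length ≤ base ^ m :=
  (List.length_filter_le _ _).trans (List.length_range).le

/-- The automaton for the formula with code `x.2` over `x.1` propositions; states are final if all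
nodes satisfy `R`. A state is the label of the last position read, and the symbol of a call is the
label of the call. -/
noncomputable def automaton (R : Core × Bool → Prop) (x : ℕ × List ℕ) : BNWACode where
  numStates := base ^ x.2.length
  numSymbols := base ^ x.2.length
  init := stateList x.2.length fun d => d.1.ex = false
  final := stateList x.2.length R
  hinit := stateList x.2.length fun d => d.1.ex = false
  hfinal := stateList x.2.length fun d => d.1.mat = false
  callTrans := (transList x.1 x.2 true false).map fun t => (t.2.1, t.1, t.2.2.1, t.2.2.1)
  intTrans := (transList x.1 x.2 false false).map fun t => (t.2.1, t.1, t.2.2.1)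
  retTrans := (transList x.1 x.2 false true).map fun t => (t.2.1, t.2.2.2, t.1, t.2.2.1)

section Acceptance

variable {n : ℕ} {φ : Formula n} {R : Core × Bool → Prop} {w : NestedWord (Letter n)}

theorem treeCheck_iff {kc kr : Bool} {a : List Bool} {q q' p : ℕ} :
    treeCheck φ.code kc kr a q q' p = true ↔
      φ.tree.AllOK (propValue a) kc kr (fun v => (digit q v).1) (fun v => (digit q' v).1)
        (fun v => (digit p v).1) 0 := by
  have := (foldr_checkStep (a := a) (kc := kc) (kr := kr) (P := fun v => (digit q v).1)
    (C := fun v => (digit q' v).1) (H := fun v => (digit p v).1) (L := fun v => φ.code.getD v 0)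
    φ.tree φ.tree_wellFormed 0 (fun v _ => by rw [φ.tree_code, zero_add]) (true, [])).1
  rw [φ.tree_size, ← φ.code_length, ← List.range_eq_range'] at this
  simpa [treeCheck] using this

/-- In a run of the automaton, every transition satisfies `TransOK` for some number in the place of
the symbol of the matching call. -/
theorem exists_symbol_of_isRun {q : ℕ → Fin (base ^ φ.code.length)}
    {h : {i // w.call i} → Fin (base ^ φ.code.length)}
    (hrun : ((automaton R (n, φ.code)).toBNWA n).IsRun w q h) (i : ℕ) (hi : w.IsPos i) :
    ∃ p : ℕ, (∀ c, w.edge c i → p = q (c + 1)) ∧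
      (w.ret i → ¬ w.MatchedRet i → AllNodes φ.code.length (fun d => d.1.ex = false) p) ∧
      ∀ kc kr : Bool, (kc = true ↔ w.call i) → (kr = true ↔ w.ret i) →
        TransOK φ.code kc kr (Letter.code (w.label i)) (q i) (q (i + 1)) p := by
  obtain ⟨-, hcall, hint, hret, hpend⟩ := hrun
  have hsym : ∀ c : {i // w.call i}, (h c : ℕ) = q (c + 1) := fun c => by
    obtain ⟨t, -, h2⟩ := List.mem_map.1 (hcall c)
    simp only [Prod.mk.injEq] at h2
    exact h2.2.2.2.symm.trans h2.2.2.1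
  have noedge : ¬ w.ret i → ∀ c, w.edge c i → False := fun hr c he => hr (w.edge_ret _ _ he)
  by_cases hc : w.call i
  · have hr := not_ret_of_call hc
    obtain ⟨⟨a, q1, q2, p⟩, h1, h2⟩ := List.mem_map.1 (hcall ⟨i, hc⟩)
    simp only [Prod.mk.injEq] at h2
    obtain ⟨rfl, rfl, rfl, -⟩ := h2
    refine ⟨p, fun c he => (noedge hr c he).elim, fun h => absurd h hr, fun kc kr hkc hkr => ?_⟩
    obtain rfl : kc = true := hkc.2 hc
    obtain rfl : kr = false := by simpa using mt hkr.1 hr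
    exact (mem_transList.1 h1).2.2.2
  · by_cases hr : w.ret i
    · have key : ∀ p, (((q i : ℕ), p, Letter.code (w.label i), (q (i + 1) : ℕ)) ∈
          (automaton R (n, φ.code)).retTrans) → ∀ kc kr : Bool, (kc = true ↔ w.call i) →
          (kr = true ↔ w.ret i) →
          TransOK φ.code kc kr (Letter.code (w.label i)) (q i) (q (i + 1)) p := by
        intro p hp kc kr hkc hkr
        obtain ⟨⟨a, q1, q2, p'⟩, h1, h2⟩ := List.mem_map.1 hp
        simp only [Prod.mk.injEq] at h2
        obtain ⟨rfl, rfl, rfl, rfl⟩ := h2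
        obtain rfl : kr = true := hkr.2 hr
        obtain rfl : kc = false := by simpa using mt hkc.1 hc
        exact (mem_transList.1 h1).2.2.2
      by_cases hm : w.MatchedRet i
      · obtain ⟨c, he⟩ := hm
        refine ⟨h ⟨c, w.edge_call _ _ he⟩, fun c' he' => ?_, fun _ hn => absurd ⟨c, he⟩ hn,
          key _ (hret ⟨c, w.edge_call _ _ he⟩ i he)⟩
        obtain rfl := w.edge_left_unique _ _ _ he he'
        exact hsym _
      · obtain ⟨p, hp, hp'⟩ := hpend i hr hm
        exact ⟨p, fun c he => absurd ⟨c, he⟩ hm, fun _ _ => (mem_stateList.1 hp).2, key _ hp'⟩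
    · obtain ⟨⟨a, q1, q2, p⟩, h1, h2⟩ := List.mem_map.1 (hint i hi hc hr)
      simp only [Prod.mk.injEq] at h2
      obtain ⟨rfl, rfl, rfl⟩ := h2
      refine ⟨p, fun c he => (noedge hr c he).elim, fun h => absurd h hr, fun kc kr hkc hkr => ?_⟩
      obtain rfl : kc = false := by simpa using mt hkc.1 hc
      obtain rfl : kr = false := by simpa using mt hkr.1 hr
      exact (mem_transList.1 h1).2.2.2

theorem size_pos (φ : Formula n) : 0 < φ.size := by
  rw [← φ.tree_size]
  exact φ.tree.size_pos

/-- Soundness, in terms of what the two notions of acceptance provide. -/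
theorem isModel_of_isRun {q : ℕ → Fin (base ^ φ.code.length)}
    {h : {i // w.call i} → Fin (base ^ φ.code.length)}
    (hrun : ((automaton R (n, φ.code)).toBNWA n).IsRun w q h)
    (hpend : ∀ c : {i // w.call i}, (¬ ∃ j, w.edge c.1 j) →
      h c ∈ ((automaton R (n, φ.code)).toBNWA n).hfinal)
    (h0 : w.IsPos 0)
    (hlast : ∀ i, w.IsPos i → ¬ w.IsPos (i + 1) →
      AllNodes φ.code.length (fun d => d.1.last = true) (q (i + 1)))
    (hinf : (∀ i, w.IsPos i) →
      ∃ᶠ i in atTop, AllNodes φ.code.length (fun d => d.2 = true) (q i)) : φ.IsModel w := by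
  have hsym := exists_symbol_of_isRun hrun
  obtain ⟨hinit, hcall, -⟩ := hrun
  have hinit : AllNodes φ.code.length (fun d => d.1.ex = false) (q 0) := (mem_stateList.1 hinit).2
  choose! p hp1 hp2 hp3 using hsym
  have hlen : φ.code.length = φ.tree.size := by rw [φ.code_length, φ.tree_size]
  have hb : ∀ {v}, v < 0 + φ.tree.size → v < φ.code.length := fun h => by omega
  have hT : ∀ i, w.IsPos i → ∃ kc kr : Bool,
      TransOK φ.code kc kr (Letter.code (w.label i)) (q i) (q (i + 1)) (p i) := fun i hi => by
    classical
    exact ⟨_, _, hp3 i hi (decide (w.call i)) (decide (w.ret i)) (by simp) (by simp)⟩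
  refine ⟨h0, ?_⟩
  have run : Tree.Run w (fun s i => propValue (Letter.code (w.label i)) s)
      (fun i v => (digit (q i) v).1) (fun i v => (digit (p i) v).1) φ.tree 0 := by
    refine ⟨fun v _ hv => hinit v (hb hv), fun c i he v _ hv => ?_, fun i hr hm v _ hv => ?_,
      fun i hc hm v _ hv => ?_, fun i hi hl v _ hv => hlast i hi hl v (hb hv),
      fun hw v _ hv => ?_, fun i hi kc kr hc hr => ?_⟩
    · show (digit (p i) v).1 = (digit (q (c + 1)) v).1
      rw [hp1 i (isPos_of_edge he) c he]
    · exact hp2 i (w.ret_lt i hr) hr hm v (hb hv)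
    · obtain ⟨t, -, h2⟩ := List.mem_map.1 (hcall ⟨i, hc⟩)
      simp only [Prod.mk.injEq] at h2
      have := (mem_stateList.1 (hpend ⟨i, hc⟩ hm)).2
      rw [← h2.2.2.2, h2.2.2.1] at this
      exact this v (hb hv)
    · have hstep : ∀ i, ∀ v < φ.code.length, ((digit (q (i + 1)) v).2 = true ↔
          (digit (q (i + 1)) v).1.fair = true ∨ ((digit (q i) v).2 = true ∧
            ¬ ∀ u < φ.code.length, (digit (q i) u).2 = true)) := fun i v hv => by
        obtain ⟨kc, kr, -, hT, -⟩ := hT i (hw i)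
        exact hT v hv
      exact (frequently_all_iff (f := fun i v => (digit (q i) v).2 = true)
        (F := fun i v => (digit (q (i + 1)) v).1.fair = true) hstep).1 (hinf hw) v (hb hv)
    · exact treeCheck_iff.1 (hp3 i hi kc kr hc hr).1
  rw [φ.sat_iff w, ← run.z_iff h0]
  obtain ⟨kc, kr, -, -, hz⟩ := hT 0 h0
  exact hz (hinit 0 (by rw [φ.code_length]; exact size_pos φ))

/-- Completeness: a model has a run whose labels are the actual ones and pass all acceptance
conditions. -/
theorem exists_run_of_isModel (R : Core × Bool → Prop) (hφ : φ.IsModel w) :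
    ∃ (q : ℕ → Fin (base ^ φ.code.length)) (h : {i // w.call i} → Fin (base ^ φ.code.length)),
      ((automaton R (n, φ.code)).toBNWA n).IsRun w q h ∧
      (∀ c : {i // w.call i}, (¬ ∃ j, w.edge c.1 j) →
        h c ∈ ((automaton R (n, φ.code)).toBNWA n).hfinal) ∧
      (∀ i, w.IsPos i → ¬ w.IsPos (i + 1) →
        AllNodes φ.code.length (fun d => d.1.ex = true ∧ d.1.last = true) (q (i + 1))) ∧
      ((∀ i, w.IsPos i) →
        ∃ᶠ i in atTop, AllNodes φ.code.length (fun d => d.2 = true) (q i)) := by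
  classical
  obtain ⟨K, hK1, hK2, hK3⟩ := Tree.exists_labelling w
    (fun s i => propValue (Letter.code (w.label i)) s) φ.tree 0
  have hlen : φ.tree.size = φ.code.length := by rw [φ.code_length, φ.tree_size]
  simp only [zero_add, hlen] at hK1 hK3
  -- the bits that collect progress marks, given the marks
  let f : ℕ → ℕ → Bool := fun i => Nat.rec (fun _ => false)
    (fun i f v => (K i v).fair || (f v && !decide (∀ u < φ.code.length, f u = true))) i
  have hf : ∀ i v, (f (i + 1) v = true ↔ (K i v).fair = true ∨
      (f i v = true ∧ ¬ ∀ u < φ.code.length, f i u = true)) := fun i v => by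
    have : f (i + 1) v =
        ((K i v).fair || (f i v && !decide (∀ u < φ.code.length, f i u = true))) := rfl
    rw [this]
    simp
  let blank : Core := ⟨false, false, false, false, false, false, false, false, false, false⟩
  let g : ℕ → ℕ → Core × Bool := fun i v => (Nat.casesOn i blank fun i => K i v, f i v)
  choose q hq hqg using fun i => exists_digits φ.code.length (g i)
  have hqK : ∀ i v, v < φ.code.length → (digit (q (i + 1)) v).1 = K i v := fun i v hv => by
    rw [hqg _ v hv]
  have hqf : ∀ i v, v < φ.code.length → (digit (q i) v).2 = f i v := fun i v hv => by
    rw [hqg _ v hv]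
  have hq0 : AllNodes φ.code.length (fun d => d.1.ex = false) (q 0) := fun v hv => by
    show (digit (q 0) v).1.ex = false
    rw [hqg 0 v hv]
    rfl
  -- the symbol read at `i`
  let p : ℕ → ℕ := fun i => if hm : w.MatchedRet i then q (hm.choose + 1) else q 0
  have hp : ∀ i, p i < base ^ φ.code.length := fun i => by
    dsimp only [p]
    split_ifs
    · exact hq _
    · exact hq _
  have hp1 : ∀ c i, w.edge c i → p i = q (c + 1) := fun c i he => by
    have hm : w.MatchedRet i := ⟨c, he⟩
    simp only [p, hm, dif_pos]
    rw [w.edge_left_unique _ _ _ hm.choose_spec he]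
  have hp2 : ∀ i, ¬ w.MatchedRet i → p i = q 0 := fun i hm => by simp only [p, hm, dif_neg,
    not_false_eq_true]
  have hT : ∀ i, w.IsPos i → ∀ kc kr : Bool, (kc = true ↔ w.call i) → (kr = true ↔ w.ret i) →
      TransOK φ.code kc kr (Letter.code (w.label i)) (q i) (q (i + 1)) (p i) := by
    intro i hi kc kr hc hr
    refine ⟨treeCheck_iff.2 ?_, fun v hv => ?_, fun hex => ?_⟩
    · refine hK3 (fun i v => (digit (q i) v).1) (fun i v => (digit (p i) v).1)
        (fun i v _ hv => hqK i v hv) (fun v _ hv => hq0 v hv) (fun c i he v _ _ => ?_)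
        (fun i _ hm v _ hv => ?_) i hi kc kr hc hr
      · simp only [hp1 c i he]
      · simp only [hp2 i hm]
        exact hq0 v hv
    · have : AllNodes φ.code.length (fun d => d.2 = true) (q i) ↔
          ∀ u < φ.code.length, f i u = true :=
        forall₂_congr fun u hu => by
          show (digit (q i) u).2 = true ↔ _
          rw [hqf i u hu]
      rw [hqf _ v hv, hqf _ v hv, hqK _ v hv, this]
      exact hf i v
    · have h0 : 0 < φ.code.length := by
        rw [φ.code_length]
        exact size_pos φ
      cases i with
      | zero =>
        rw [hqK 0 0 h0, hK2, ← φ.sat_iff w]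
        exact hφ.2
      | succ i =>
        obtain ⟨-, z, d, e, F, hv⟩ := hK1 0 le_rfl h0
        rw [hqK i 0 h0, hv] at hex
        simp [actualCore] at hex
  refine ⟨fun i => ⟨q i, hq i⟩, fun c => ⟨q (c + 1), hq _⟩, ⟨?_, fun c => ?_, fun i hi hc hr => ?_,
    fun c i he => ?_, fun i hr hm => ?_⟩, fun c hc => ?_, fun i _ hl v hv => ?_, fun hw => ?_⟩
  · exact mem_stateList.2 ⟨hq 0, hq0⟩
  · exact List.mem_map.2 ⟨(Letter.code (w.label c), q c, q (c + 1), p c), mem_transList.2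
      ⟨hq _, hq _, hp _, hT c (w.call_lt c c.2) true false (by simp [c.2])
        (by simp [not_ret_of_call c.2])⟩, rfl⟩
  · exact List.mem_map.2 ⟨(Letter.code (w.label i), q i, q (i + 1), p i), mem_transList.2
      ⟨hq _, hq _, hp _, hT i hi false false (by simp [hc]) (by simp [hr])⟩, rfl⟩
  · have hr := w.edge_ret _ _ he
    refine List.mem_map.2 ⟨(Letter.code (w.label i), q i, q (i + 1), p i), mem_transList.2
      ⟨hq _, hq _, hp _, hT i (w.ret_lt i hr) false true
        (by simp [not_call_of_matchedRet ⟨c.1, he⟩]) (by simp [hr])⟩, ?_⟩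
    simp only [hp1 _ _ he]
  · refine ⟨⟨q 0, hq 0⟩, mem_stateList.2 ⟨hq 0, hq0⟩, List.mem_map.2
      ⟨(Letter.code (w.label i), q i, q (i + 1), p i), mem_transList.2
      ⟨hq _, hq _, hp _, hT i (w.ret_lt i hr) false true ?_ (by simp [hr])⟩, ?_⟩⟩
    · have : ¬ w.call i := fun hc => not_ret_of_call hc hr
      simp [this]
    · simp only [hp2 _ hm]
  · refine mem_stateList.2 ⟨hq _, fun v hv => ?_⟩
    obtain ⟨-, z, d, e, F, hv'⟩ := hK1 v (Nat.zero_le v) hv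
    rw [hqK _ v hv, hv']
    have h1 : ¬ w.MatchedCall c := hc
    have h2 : ¬ w.MatchedRet c := fun h => not_call_of_matchedRet h c.2
    simp [actualCore, h1, h2]
  · obtain ⟨-, z, d, e, F, hv'⟩ := hK1 v (Nat.zero_le v) hv
    simp only
    rw [hqK _ v hv, hv']
    simp [actualCore, hl]
  · have := (frequently_all_iff (m := φ.code.length) (f := fun i v => f i v = true)
      (F := fun i v => (K i v).fair = true) fun i v _ => hf i v).2
      fun v hv => (hK1 v (Nat.zero_le v) hv).1 hw
    refine this.mono fun i hi v hv => ?_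
    show (digit (q i) v).2 = true
    rw [hqf i v hv]
    exact hi v hv

theorem accepts_iff_of_infinite (hw : w.length = ⊤) :
    ((automaton (fun d => d.2 = true) (n, φ.code)).toBNWA n).Accepts w ↔ φ.IsModel w := by
  have hpos : ∀ i, w.IsPos i := fun i => by simp [IsPos, hw]
  constructor
  · rintro ⟨q, h, hrun, hpend, -, hinf⟩
    exact isModel_of_isRun hrun hpend (hpos 0) (fun i _ hl => absurd (hpos _) hl)
      fun _ => (hinf hw).mono fun i hi => (mem_stateList.1 hi).2
  · intro hφ
    obtain ⟨q, h, hrun, hpend, -, hinf⟩ := exists_run_of_isModel (fun d => d.2 = true) hφ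
    exact ⟨q, h, hrun, hpend, fun l hl => by simp [hw] at hl,
      fun _ => (hinf hpos).mono fun i hi => mem_stateList.2 ⟨(q i).2, hi⟩⟩

theorem accepts_iff_of_finite (hw : w.length ≠ ⊤) :
    ((automaton (fun d => d.1.ex = true ∧ d.1.last = true) (n, φ.code)).toBNWA n).Accepts w ↔
      φ.IsModel w := by
  obtain ⟨l, hl⟩ := ENat.ne_top_iff_exists.1 hw
  have hpos : ∀ i, w.IsPos i ↔ i < l := fun i => by simp [IsPos, ← hl]
  have hlen : 0 < φ.code.length := by
    rw [φ.code_length]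
    exact size_pos φ
  constructor
  · rintro ⟨q, h, hrun, hpend, hfin, -⟩
    have hql := (mem_stateList.1 (hfin l hl.symm)).2
    have hl0 : 0 < l := by
      by_contra h0
      obtain rfl : l = 0 := by omega
      have := (mem_stateList.1 hrun.1).2 0 hlen
      have := (hql 0 hlen).1
      simp_all
    refine isModel_of_isRun hrun hpend ((hpos 0).2 hl0) (fun i hi hi' v hv => ?_)
      fun hall => absurd ((hpos l).1 (hall l)) (lt_irrefl l)
    rw [hpos] at hi hi'
    obtain rfl : l = i + 1 := by omega
    exact (hql v hv).2
  · intro hφ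
    obtain ⟨q, h, hrun, hpend, hfin, -⟩ :=
      exists_run_of_isModel (fun d => d.1.ex = true ∧ d.1.last = true) hφ
    refine ⟨q, h, hrun, hpend, fun l' hl' => ?_, fun h => absurd h hw⟩
    obtain rfl : l = l' := by
      rw [hl'] at hl
      exact_mod_cast hl
    have hl0 := (hpos 0).1 hφ.1
    obtain ⟨i, rfl⟩ : ∃ i, l = i + 1 := ⟨l - 1, by omega⟩
    exact mem_stateList.2 ⟨(q _).2, hfin i ((hpos i).2 (by omega))
      fun h => absurd ((hpos _).1 h) (by omega)⟩

end Acceptance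

end NW

namespace NW

open NestedWord Filter

/-! ### Computability -/

noncomputable instance : Primcodable Core :=
  Primcodable.ofEquiv (Fin (Nat.card Core)) (Finite.equivFin Core)

theorem primrec_pow : Primrec₂ fun a b : ℕ => a ^ b :=
  Primrec₂.unpaired'.1 Nat.Primrec.pow

/-- A function that depends on a number and on an element of a finite type is primitive recursive
if it is constant in the number from some point on. -/
theorem primrec_of_eventually_const {α β : Type*} [Primcodable α] [Finite α] [Primcodable β]
    (k : ℕ) (f : ℕ → α → β) (h : ∀ s, k ≤ s → f s = f k) : Primrec₂ f := by
  induction k generalizing f with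
  | zero =>
    have : f = fun _ => f 0 := funext fun s => h s (Nat.zero_le s)
    rw [this]
    exact (Primrec.dom_finite (f 0)).comp Primrec.snd
  | succ k ih =>
    refine (Primrec.ite (Primrec.nat_le.comp Primrec.fst (Primrec.const k))
      ((ih (fun s => f (min s k)) fun s hs => by simp [hs]).comp Primrec.fst Primrec.snd)
      ((Primrec.dom_finite (f (k + 1))).comp Primrec.snd)).of_eq fun x => ?_
    split_ifs with hx
    · simp [hx]
    · rw [h x.1 (by omega)]

/-- Reading a digit is a lookup in a table of length `base`. -/
theorem primrec_digit : Primrec₂ digit := by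
  have h : ∀ q v, digit q v =
      (List.ofFn ofDigit).getD (q / base ^ v % base) (ofDigit ⟨0, base_pos⟩) := fun q v => by
    have := Nat.mod_lt (q / base ^ v) base_pos
    rw [List.getD_eq_getElem _ _ (by simpa using this), List.getElem_ofFn, digit]
  refine Primrec.of_eq ?_ fun x => (h x.1 x.2).symm
  exact (Primrec.list_getD _).comp (Primrec.const _) (Primrec.nat_mod.comp (Primrec.nat_div.comp
    Primrec.fst (primrec_pow.comp (Primrec.const base) Primrec.snd)) (Primrec.const base))

theorem primrec_bits : Primrec₂ bits := by
  refine Primrec.list_map (Primrec.list_range.comp Primrec.fst) ?_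
  refine PrimrecPred.decide ?_
  exact Primrec.eq.comp (Primrec.nat_mod.comp (Primrec.nat_div.comp (Primrec.snd.comp Primrec.fst)
    (primrec_pow.comp (Primrec.const 2) Primrec.snd)) (Primrec.const 2)) (Primrec.const 1)

theorem primrec_arity : Primrec arity := by
  refine Primrec.ite (PrimrecPred.or ?_ ?_) (Primrec.const 0)
    (Primrec.ite (PrimrecPred.or ?_ ?_) (Primrec.const 2) (Primrec.const 1))
  · exact Primrec.nat_lt.comp Primrec.id (Primrec.const 3)
  · exact Primrec.nat_le.comp (Primrec.const 17) Primrec.id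
  · exact Primrec.eq.comp Primrec.id (Primrec.const 4)
  · exact Primrec.nat_le.comp (Primrec.const 9) Primrec.id

/-- All codes from `17` on stand for propositions and are checked alike. -/
theorem primrec_nodeCheck (kc kr : Bool) : Primrec₂ fun (s : ℕ)
    (t : Bool × (Core × Core × Core) × (Bool × Bool × Bool) × (Bool × Bool × Bool)) =>
      nodeCheck s t.1 kc kr t.2.1.1 t.2.1.2.1 t.2.1.2.2 t.2.2.1 t.2.2.2 := by
  refine primrec_of_eventually_const 17 _ fun s hs => funext fun t => ?_
  rw [Bool.eq_iff_iff, nodeCheck_iff, nodeCheck_iff, opOK_of_ge hs, opOK_of_ge le_rfl]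

section

variable {α : Type*} [Primcodable α]

theorem primrec_checkStep (kc kr : Bool) {a : α → List Bool} {s : α → ℕ} {p c h : α → Core}
    {st : α → Bool × List (Bool × Bool × Bool)} (ha : Primrec a) (hs : Primrec s)
    (hp : Primrec p) (hc : Primrec c) (hh : Primrec h) (hst : Primrec st) :
    Primrec fun x => checkStep (a x) kc kr (s x) (p x) (c x) (h x) (st x) := by
  have hz : Primrec Core.z := Primrec.dom_finite _
  have hst2 := Primrec.snd.comp hst
  have har := primrec_arity.comp hs
  have harg : ∀ k : ℕ, Primrec fun x =>
      ((st x).2.take (arity (s x))).getD k (false, false, false) := fun k =>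
    (Primrec.list_getD _).comp (Primrec.list_take.comp har hst2) (Primrec.const k)
  have hv : Primrec fun x => propValue (a x) (s x) :=
    (Primrec.list_getD _).comp ha (Primrec.nat_sub.comp hs (Primrec.const 17))
  exact Primrec.pair
    (Primrec.and.comp (Primrec.fst.comp hst) ((primrec_nodeCheck kc kr).comp hs
      (Primrec.pair hv (Primrec.pair (Primrec.pair hp (Primrec.pair hc hh))
        (Primrec.pair (harg 0) (harg 1))))))
    (Primrec.list_cons.comp
      (Primrec.pair (hz.comp hp) (Primrec.pair (hz.comp hc) (hz.comp hh)))
      (Primrec.list_drop.comp har hst2))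

theorem primrec_treeCheck (kc kr : Bool) {L : α → List ℕ} {a : α → List Bool} {q q' p : α → ℕ}
    (hL : Primrec L) (ha : Primrec a) (hq : Primrec q) (hq' : Primrec q') (hp : Primrec p) :
    Primrec fun x => treeCheck (L x) kc kr (a x) (q x) (q' x) (p x) := by
  have hv : Primrec fun y : α × ℕ × Bool × List (Bool × Bool × Bool) => y.2.1 :=
    Primrec.fst.comp Primrec.snd
  have hd : ∀ {q : α → ℕ}, Primrec q →
      Primrec fun y : α × ℕ × Bool × List (Bool × Bool × Bool) => (digit (q y.1) y.2.1).1 :=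
    fun hq => Primrec.fst.comp (primrec_digit.comp (hq.comp Primrec.fst) hv)
  exact Primrec.fst.comp (Primrec.list_foldr (Primrec.list_range.comp (Primrec.list_length.comp hL))
    (Primrec.const (true, [])) (primrec_checkStep kc kr (ha.comp Primrec.fst)
      ((Primrec.list_getD 0).comp (hL.comp Primrec.fst) hv) (hd hq) (hd hq') (hd hp)
      (Primrec.snd.comp Primrec.snd)).to₂)

theorem primrecPred_forall_lt {m : α → ℕ} {R : ℕ → α → Prop} (hm : Primrec m)
    (hR : PrimrecRel R) : PrimrecPred fun x => ∀ v < m x, R v x :=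
  (PrimrecRel.comp (PrimrecRel.forall_mem_list hR) (Primrec.list_range.comp hm)
    Primrec.id).of_eq fun x => by simp

theorem primrecPred_of_finite [Finite α] (R : α → Prop) : PrimrecPred R := by
  classical
  exact ⟨inferInstance, Primrec.dom_finite _⟩

theorem primrecPred_allNodes (R : Core × Bool → Prop) {m q : α → ℕ} (hm : Primrec m)
    (hq : Primrec q) : PrimrecPred fun x => AllNodes (m x) R (q x) :=
  primrecPred_forall_lt hm
    ((primrecPred_of_finite R).comp (primrec_digit.comp (hq.comp Primrec.snd) Primrec.fst))

theorem primrecPred_transOK (kc kr : Bool) {L : α → List ℕ} {a : α → List Bool} {q q' p : α → ℕ}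
    (hL : Primrec L) (ha : Primrec a) (hq : Primrec q) (hq' : Primrec q') (hp : Primrec p) :
    PrimrecPred fun x => TransOK (L x) kc kr (a x) (q x) (q' x) (p x) := by
  have hd : ∀ (R : Core × Bool → Prop) {q : α → ℕ}, Primrec q →
      PrimrecPred fun y : ℕ × α => R (digit (q y.2) y.1) := fun R q hq =>
    (primrecPred_of_finite R).comp (primrec_digit.comp (hq.comp Primrec.snd) Primrec.fst)
  have h0 : ∀ (R : Core × Bool → Prop) {q : α → ℕ}, Primrec q →
      PrimrecPred fun x => R (digit (q x) 0) := fun R q hq =>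
    (primrecPred_of_finite R).comp (primrec_digit.comp hq (Primrec.const 0))
  have hm := Primrec.list_length.comp hL
  have hall := primrecPred_allNodes (fun d => d.2 = true) (hm.comp (Primrec.snd (α := ℕ)))
    (hq.comp Primrec.snd)
  refine (Primrec.eq.comp (primrec_treeCheck kc kr hL ha hq hq' hp) (Primrec.const true)).and
    (PrimrecPred.and (primrecPred_forall_lt hm (R := fun v x => ((digit (q' x) v).2 = true ↔
      (digit (q' x) v).1.fair = true ∨ ((digit (q x) v).2 = true ∧
        ¬ AllNodes (L x).length (fun d => d.2 = true) (q x)))) ?_) ?_)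
  · have h1 := hd (fun d => d.2 = true) hq'
    have h2 := (hd (fun d => d.1.fair = true) hq').or ((hd (fun d => d.2 = true) hq).and hall.not)
    exact ((h1.not.or h2).and (h2.not.or h1)).of_eq fun x => by tauto
  · exact ((h0 (fun d => d.1.ex = false) hq).not.or (h0 (fun d => d.1.z = true) hq')).of_eq
      fun x => by tauto

end

theorem primrec_transList (kc kr : Bool) :
    Primrec fun x : ℕ × List ℕ => transList x.1 x.2 kc kr := by
  classical
  have hN : Primrec fun x : ℕ × List ℕ => base ^ x.2.length :=
    primrec_pow.comp (Primrec.const base) (Primrec.list_length.comp Primrec.snd)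
  have hK : Primrec fun x : ℕ × List ℕ => 2 ^ x.1 := primrec_pow.comp (Primrec.const 2) Primrec.fst
  have hR : PrimrecRel fun (t : List Bool × ℕ × ℕ × ℕ) (L : List ℕ) =>
      TransOK L kc kr t.1 t.2.1 t.2.2.1 t.2.2.2 :=
    primrecPred_transOK kc kr Primrec.snd (Primrec.fst.comp Primrec.fst)
      (Primrec.fst.comp (Primrec.snd.comp Primrec.fst))
      (Primrec.fst.comp (Primrec.snd.comp (Primrec.snd.comp Primrec.fst)))
      (Primrec.snd.comp (Primrec.snd.comp (Primrec.snd.comp Primrec.fst)))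
  refine hR.listFilter.comp (Primrec.list_map (Primrec.list_range.comp
    (Primrec.nat_mul.comp hN (Primrec.nat_mul.comp hN (Primrec.nat_mul.comp hN hK)))) ?_)
    Primrec.snd
  have hN := hN.comp (Primrec.fst (β := ℕ))
  have h1 := Primrec.nat_div.comp (Primrec.snd (α := ℕ × List ℕ)) hN
  have h2 := Primrec.nat_div.comp h1 hN
  exact Primrec.pair
    (primrec_bits.comp (Primrec.fst.comp Primrec.fst) (Primrec.nat_div.comp h2 hN))
    (Primrec.pair (Primrec.nat_mod.comp Primrec.snd hN)
      (Primrec.pair (Primrec.nat_mod.comp h1 hN) (Primrec.nat_mod.comp h2 hN)))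

theorem primrec_stateList (R : Core × Bool → Prop) : Primrec fun m => stateList m R := by
  classical
  have hR : PrimrecRel fun q m => AllNodes m R q :=
    primrecPred_allNodes R Primrec.snd Primrec.fst
  exact hR.listFilter.comp (Primrec.list_range.comp
    (primrec_pow.comp (Primrec.const base) Primrec.id)) Primrec.id

theorem primrec_automaton (R : Core × Bool → Prop) : Primrec (automaton R) := by
  have hm : Primrec fun x : ℕ × List ℕ => x.2.length := Primrec.list_length.comp Primrec.snd
  have hN : Primrec fun x : ℕ × List ℕ => base ^ x.2.length :=
    primrec_pow.comp (Primrec.const base) hm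
  have hS := fun R => (primrec_stateList R).comp hm
  have h1 : Primrec fun y : (ℕ × List ℕ) × List Bool × ℕ × ℕ × ℕ => y.2.1 :=
    Primrec.fst.comp Primrec.snd
  have h2 : Primrec fun y : (ℕ × List ℕ) × List Bool × ℕ × ℕ × ℕ => y.2.2.1 :=
    Primrec.fst.comp (Primrec.snd.comp Primrec.snd)
  have h3 : Primrec fun y : (ℕ × List ℕ) × List Bool × ℕ × ℕ × ℕ => y.2.2.2.1 :=
    Primrec.fst.comp (Primrec.snd.comp (Primrec.snd.comp Primrec.snd))
  have h4 : Primrec fun y : (ℕ × List ℕ) × List Bool × ℕ × ℕ × ℕ => y.2.2.2.2 :=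
    Primrec.snd.comp (Primrec.snd.comp (Primrec.snd.comp Primrec.snd))
  refine (Primrec.of_equiv_iff BNWACode.equivTuple).1 ?_
  exact Primrec.pair hN (Primrec.pair hN (Primrec.pair (hS _) (Primrec.pair (hS R)
    (Primrec.pair (hS _) (Primrec.pair (hS _) (Primrec.pair
      (Primrec.list_map (primrec_transList true false) (Primrec.pair h2
        (Primrec.pair h1 (Primrec.pair h3 h3))))
      (Primrec.pair
        (Primrec.list_map (primrec_transList false false) (Primrec.pair h2 (Primrec.pair h1 h3)))
        (Primrec.list_map (primrec_transList false true) (Primrec.pair h2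
          (Primrec.pair h4 (Primrec.pair h1 h3)))))))))))

/-! ### The size bounds -/

theorem stateSize_le (R : Core × Bool → Prop) {n : ℕ} (φ : Formula n) :
    (automaton R (n, φ.code)).stateSize ≤ 2 ^ ((3 * base + 4) * φ.size) := by
  have h1 : base ^ φ.size ≤ 2 ^ (base * φ.size) := by
    rw [pow_mul]
    exact Nat.pow_le_pow_left (Nat.lt_two_pow_self).le _
  have h2 := size_pos φ
  calc (automaton R (n, φ.code)).stateSize = 2 * base ^ φ.size := by
        simp only [BNWACode.stateSize, automaton, φ.code_length]
        ring
    _ ≤ 2 * 2 ^ (base * φ.size) := by gcongr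
    _ = 2 ^ (base * φ.size + 1) := by ring
    _ ≤ 2 ^ ((3 * base + 4) * φ.size) := Nat.pow_le_pow_right (by norm_num) (by nlinarith)

/-- There are six numbers and lists of size at most `N = base ^ |φ|`, and three lists of
transitions, each of length at most `N ^ 3 * 2 ^ n`. -/
theorem totalSize_le (R : Core × Bool → Prop) {n : ℕ} (φ : Formula n) :
    (automaton R (n, φ.code)).totalSize ≤ 2 ^ ((3 * base + 4) * φ.size) * 2 ^ n := by
  have h1 : base ^ φ.size ≤ 2 ^ (base * φ.size) := by
    rw [pow_mul]
    exact Nat.pow_le_pow_left (Nat.lt_two_pow_self).le _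
  have h2 := size_pos φ
  have hS := fun R => length_stateList φ.code.length R
  have hT := length_transList n φ.code
  simp only [φ.code_length] at hS hT
  have hle : (automaton R (n, φ.code)).totalSize ≤
      6 * base ^ φ.size + 3 * (base ^ φ.size * (base ^ φ.size * (base ^ φ.size * 2 ^ n))) := by
    simp only [BNWACode.totalSize, automaton, List.length_map, φ.code_length]
    linarith [hS R, hS fun d => d.1.ex = false, hS fun d => d.1.mat = false, hT true false,
      hT false false, hT false true]
  set N := base ^ φ.size
  have hN : 1 ≤ N := Nat.pow_pos base_pos
  have hK : 1 ≤ 2 ^ n := Nat.one_le_two_pow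
  calc (automaton R (n, φ.code)).totalSize ≤ 6 * N + 3 * (N * (N * (N * 2 ^ n))) := hle
    _ = 6 * (N * 1 * 1 * 1) + 3 * (N * N * N * 2 ^ n) := by ring
    _ ≤ 6 * (N * N * N * 2 ^ n) + 3 * (N * N * N * 2 ^ n) := by gcongr
    _ ≤ 2 ^ 4 * (N * N * N * 2 ^ n) := by
      rw [← add_mul]
      exact Nat.mul_le_mul_right _ (by norm_num)
    _ ≤ 2 ^ 4 * (2 ^ (base * φ.size) * 2 ^ (base * φ.size) * 2 ^ (base * φ.size) * 2 ^ n) := by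
      gcongr
    _ = 2 ^ (3 * (base * φ.size) + 4) * 2 ^ n := by ring
    _ ≤ 2 ^ ((3 * base + 4) * φ.size) * 2 ^ n :=
      Nat.mul_le_mul_right _ (Nat.pow_le_pow_right (by norm_num) (by nlinarith))

end NW

theorem theorem5p1 :
    ∃ (C : ℕ) (buildInf buildFin : ℕ × List ℕ → NW.BNWACode),
      Computable buildInf ∧ Computable buildFin ∧
      ∀ (n : ℕ) (φ : NW.Formula n),
        (∀ M ∈ [buildInf (n, φ.code), buildFin (n, φ.code)],
          M.stateSize ≤ 2 ^ (C * φ.size) ∧ M.totalSize ≤ 2 ^ (C * φ.size) * 2 ^ n) ∧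
        (∀ w : NW.NestedWord (NW.Letter n), w.length = ⊤ →
          (((buildInf (n, φ.code)).toBNWA n).Accepts w ↔ φ.IsModel w)) ∧
        (∀ w : NW.NestedWord (NW.Letter n), w.length ≠ ⊤ →
          (((buildFin (n, φ.code)).toBNWA n).Accepts w ↔ φ.IsModel w)) := by
  refine ⟨3 * NW.base + 4, NW.automaton fun d => d.2 = true,
    NW.automaton fun d => d.1.ex = true ∧ d.1.last = true, (NW.primrec_automaton _).to_comp,
    (NW.primrec_automaton _).to_comp, fun n φ => ⟨?_, fun w => NW.accepts_iff_of_infinite,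
      fun w => NW.accepts_iff_of_finite⟩⟩
  simp only [List.mem_cons, List.not_mem_nil, or_false, forall_eq_or_imp, forall_eq]
  exact ⟨⟨NW.stateSize_le _ φ, NW.totalSize_le _ φ⟩, NW.stateSize_le _ φ, NW.totalSize_le _ φ⟩
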